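/- **Theorem (lower bound in the homogeneous setting).** There are universal constants $\bar c_1,\bar c_2,\bar c_3>0$ such that the following holds. *Environment.* There are $n\ge 1$ workers, the nodes of a connected graph in which each link $\{i,j\}$ has a bandwidth $b_{ij}=b_{ji}>0$: in each of its two directions it can transmit $b_{ij}$ coordinates per second. Worker $i$ needs $h_i>0$ seconds to compute one stochastic gradient; all other local operations take no time. For $U\subseteq[n]$ the cut value is $\sum_{x\in U,\,y\notin U} b_{xy}$. Let $T=([n],F,w)$ be any Gomory–Hu tree of the graph, i.e. a tree on $[n]$ such that for every edge $\{i,j\}\in F$ the component of $i$ in $T-\{i,j\}$ is a minimum $i$–$j$ cut and $w_{ij}$ is its value. List its edges (ties in any order) so that the weights satisfy $\bar w_1\le\dots\le\bar w_{n-1}$, put $\bar w_n=\infty$ and $d/\bar w_n=0$, and let $S_{k,1},\dots,S_{k,k}$ be the components of $T$ after its first $k-1$ edges are removed. For $S\subseteq[n]$ let $h_{\pi_1(S)}\le\dots\le h_{\pi_{|S|}(S)}$ be the numbers $h_i$, $i\in S$, in sorted order. *Protocol.* Each worker $i$ has local information $I_i$, a set of vectors of $\mathbb R^d$, initially empty,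 and runs two loops in parallel. (1) Computation loop: based on $I_i$, choose a point $x$ with $\operatorname{supp}(x)\subseteq\bigcup_{y\in I_i}\operatorname{supp}(y)$, compute $\nabla f(x;\xi)$ with a fresh independent sample $\xi\sim\mathcal D_\xi$, which takes $h_i$ seconds, add it to $I_i$, and optionally wait (the waiting may depend on $I_i$). (2) Communication loop, $k=0,1,\dots$: based on $I_i$, choose a vector $s$ with $\operatorname{supp}(s)\subseteq\bigcup_{y\in I_i}\operatorname{supp}(y)$ and send the list $\big((\nu^k_{i,j},\,c^k_{i,j}\,[s]_{\nu^k_{i,j}})\big)_{j=1}^{p_i^k}$, $p_i^k\ge1$, to some other worker by any (possibly fractional, multi-path, store-and-forward) routing that respects all bandwidths, without waiting for its completion; when the whole list has arrived, its receiver adds $\sum_j c^k_{i,j}[s]_{\nu^k_{i,j}}e_{\nu^k_{i,j}}$ to its local information. The algorithm may be randomized. The indices $\nu^k_{i,j}$, the numbers $c^k_{i,j}$ and $p_i^k$, the sending times, the destinations and the routing are arbitrary functions of the algorithm's own randomness; they do not depend on $f$, on the samples $\xi$, or on the local information. Let $G_t$ be the set of all points that can be constructed by time $t$, i.e. of all $y\in\mathbb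 R^d$ with $\operatorname{supp}(y)\subseteq\bigcup_{v\in I_i}\operatorname{supp}(v)$ for some worker $i$, where $I_i$ is taken at time $t$. *Claim.* Let $L,\Delta,\varepsilon,\sigma^2>0$ and let $n,d\ge1$ be integers with $$\frac{L\Delta}{\varepsilon}\ \ge\ \bar c_1\log^{10}(n+1),\qquad d\ \ge\ \frac{\bar c_3\,L\Delta}{\log^{3}(n+1)\,\varepsilon}.$$ Then for every such environment and every algorithm of this kind there are a differentiable function $f:\mathbb R^d\to\mathbb R$ with $\|\nabla f(x)-\nabla f(y)\|\le L\|x-y\|$ for all $x,y$ and $f(0)-\inf f\le\Delta$, and a stochastic oracle (a distribution $\mathcal D_\xi$ and a mapping $\nabla f(x;\xi)$, the same for all workers) with $\mathbb E_\xi[\nabla f(x;\xi)]=\nabla f(x)$ and $\mathbb E_\xi\|\nabla f(x;\xi)-\nabla f(x)\|^2\le\sigma^2$ for all $x$, such that $$\mathbb E\Big[\inf_{y\in G_t}\|\nabla f(y)\|^2\Big]>\varepsilon$$ for all $$t\ \le\ \frac{\bar c_2}{\log^{14}(n+1)}\ \min_{k\in[n]}\left(\frac{d}{\bar w_k}+\min_{p\in[k]}\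 \min_{m\in[|S_{k,p}|]}\left[\Big(\frac1m\sum_{i=1}^m\frac1{h_{\pi_i(S_{k,p})}}\Big)^{-1}\Big(1+\frac{\sigma^2}{m\varepsilon}\Big)\right]\right)\frac{L\Delta}{\varepsilon}.$$ -/

import Mathlib

open MeasureTheory

noncomputable section

namespace Decentralized

/-! ### The environment -/

/-- Points of `ℝ^d` with the Euclidean norm. -/
abbrev Vec (d : ℕ) : Type := EuclideanSpace ℝ (Fin d)

/-- A computation and communication environment with `n` workers: a connected graph whose link
`{i, j}` carries `bw i j = bw j i > 0` coordinates per second in each of the two directions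
(simultaneously), and the number `time i > 0` of seconds worker `i` needs for one stochastic
gradient. -/
structure Network (n : ℕ) where
  graph : SimpleGraph (Fin n)
  connected : graph.Connected
  bw : Fin n → Fin n → ℝ
  bw_symm : ∀ i j, bw i j = bw j i
  bw_pos : ∀ i j, graph.Adj i j → 0 < bw i j
  bw_zero : ∀ i j, ¬ graph.Adj i j → bw i j = 0
  time : Fin n → ℝ
  time_pos : ∀ i, 0 < time i

/-! ### Communication

The `k`-th message of worker `i` is the list of pairs `(idx i k r, coef i k r * s (idx i k r))`,
`r < size i k`, formed from a vector `s`. -/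

/-- One realization of the part of the communication that does not look at the local information:
when the messages are sent, to whom, which coordinates they contain, and how they are routed.
`flow i k u v t` is the number of coordinates (possibly fractional) of message `(i, k)` that have
been transmitted over the directed link `u → v` up to time `t`. -/
structure CommPlan {n : ℕ} (N : Network n) (d : ℕ) where
  sendTime : Fin n → ℕ → ℝ
  sendTime_nonneg : ∀ i k, 0 ≤ sendTime i k
  sendTime_mono : ∀ i, Monotone (sendTime i)
  dest : Fin n → ℕ → Fin n
  size : Fin n → ℕ → ℕ
  one_le_size : ∀ i k, 1 ≤ size i k
  idx : Fin n → ℕ → ℕ → Fin d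
  coef : Fin n → ℕ → ℕ → ℝ
  flow : Fin n → ℕ → Fin n → Fin n → ℝ → ℝ
  /-- nothing is transmitted before the message is sent -/
  flow_start : ∀ i k u v t, t ≤ sendTime i k → flow i k u v t = 0
  flow_mono : ∀ i k u v, Monotone (flow i k u v)
  /-- all messages together respect the bandwidth of every directed link -/
  flow_capacity : ∀ (u v : Fin n) (s t : ℝ), s ≤ t → ∀ M : Finset (Fin n × ℕ),
    ∑ m ∈ M, (flow m.1 m.2 u v t - flow m.1 m.2 u v s) ≤ N.bw u v * (t - s)
  /-- a node forwards only what it has received, the sender only what it owns or has received -/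
  flow_conservation : ∀ i k v t,
    ∑ w, flow i k v w t ≤ (if v = i then (size i k : ℝ) else 0) + ∑ u, flow i k u v t
  /-- what has reached the destination stays there -/
  flow_dest : ∀ i k, dest i k ≠ i → ∀ w t, flow i k (dest i k) w t = 0

namespace CommPlan

variable {n d : ℕ} {N : Network n} (P : CommPlan N d)

/-- Message `(i, k)` has completely arrived at its destination by time `t`. (A message that a worker
addresses to itself has no effect.) -/
def Delivered (i : Fin n) (k : ℕ) (t : ℝ) : Prop :=
  P.dest i k ≠ i ∧ (P.size i k : ℝ) ≤ ∑ u, P.flow i k u (P.dest i k) t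

/-- The vector which the receiver of message `(i, k)` decompresses when it was formed from `s`. -/
def decode (i : Fin n) (k : ℕ) (s : Vec d) : Vec d :=
  ∑ r ∈ Finset.range (P.size i k),
    EuclideanSpace.single (P.idx i k r) (P.coef i k r * s (P.idx i k r))

/-- The total bandwidth of the network. -/
def _root_.Decentralized.Network.totalBw (N : Network n) : ℝ := ∑ v, ∑ u, N.bw u v

theorem bw_nonneg (N : Network n) (u v : Fin n) : 0 ≤ N.bw u v := by
  by_cases h : N.graph.Adj u v
  · exact (N.bw_pos u v h).le
  · exact (N.bw_zero u v h).ge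

/-- Sending takes time: a message is not delivered within less than `1 / totalBw` seconds. -/
theorem Delivered.delay {i : Fin n} {k : ℕ} {t : ℝ} (h : P.Delivered i k t) :
    P.sendTime i k * N.totalBw + 1 ≤ t * N.totalBw := by
  obtain ⟨-, h⟩ := h
  have h1 : (1 : ℝ) ≤ P.size i k := by exact_mod_cast P.one_le_size i k
  have hlt : P.sendTime i k ≤ t := by
    by_contra! hlt
    have h0 : ∑ u, P.flow i k u (P.dest i k) t = 0 :=
      Finset.sum_eq_zero fun u _ => P.flow_start i k u _ t hlt.le
    linarith
  have h2 : ∑ u, P.flow i k u (P.dest i k) t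
      ≤ ∑ u, N.bw u (P.dest i k) * (t - P.sendTime i k) := by
    refine Finset.sum_le_sum fun u _ => ?_
    have := P.flow_capacity u (P.dest i k) _ _ hlt {(i, k)}
    simpa [P.flow_start i k u _ _ le_rfl] using this
  have h3 : ∑ u, N.bw u (P.dest i k) ≤ N.totalBw :=
    Finset.single_le_sum (f := fun v => ∑ u, N.bw u v)
      (fun v _ => Finset.sum_nonneg fun u _ => bw_nonneg N u v) (Finset.mem_univ (P.dest i k))
  rw [← Finset.sum_mul] at h2
  have h4 := mul_le_mul_of_nonneg_right h3 (sub_nonneg.2 hlt)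
  nlinarith

theorem Delivered.floor_lt {i j : Fin n} {k l : ℕ} (h : P.Delivered i k (P.sendTime j l)) :
    ⌊P.sendTime i k * N.totalBw⌋₊ < ⌊P.sendTime j l * N.totalBw⌋₊ := by
  have h0 : 0 ≤ N.totalBw :=
    Finset.sum_nonneg fun v _ => Finset.sum_nonneg fun u _ => bw_nonneg N u v
  have h1 := Nat.floor_le_floor (Delivered.delay P h)
  rw [Nat.floor_add_one (mul_nonneg (P.sendTime_nonneg i k) h0)] at h1
  omega

end CommPlan

/-! ### Zero-respecting algorithms -/

/-- The local information of a worker: the stochastic gradients it has computed (indexed by the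
iterations of its computation loop) and the vectors it has received (indexed by sender and message
number). A vector that is not available (yet) is listed as `0`. -/
abbrev LocalInfo (n d : ℕ) : Type := (ℕ → Vec d) × (Fin n → ℕ → Vec d)

/-- The union of the supports of all available vectors. -/
def LocalInfo.support {n d : ℕ} (I : LocalInfo n d) : Set (Fin d) :=
  {c | (∃ m, I.1 m c ≠ 0) ∨ ∃ j k, I.2 j k c ≠ 0}

/-- A zero-respecting algorithm. `Z` is the sample space of all its random choices (including those
of the sparsifiers); they are shared by the workers.
At each iteration of its computation loop a worker looks at the local information and the current
time, and either computes a stochastic gradient (`compute = true`) at the point `query`, or waits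
for `pause` seconds (a longer or an event-driven wait is a succession of such iterations).
The vector from which a message is formed depends on the local information at the moment of
sending. -/
structure Algorithm {n : ℕ} (N : Network n) (d : ℕ) (Z : Type*) [MeasurableSpace Z] where
  plan : Z → CommPlan N d
  compute : Fin n → ℕ → Z × ℝ × LocalInfo n d → Bool
  query : Fin n → ℕ → Z × ℝ × LocalInfo n d → Vec d
  pause : Fin n → ℕ → Z × ℝ × LocalInfo n d → ℝ
  message : Fin n → ℕ → Z × LocalInfo n d → Vec d
  pause_nonneg : ∀ i m a, 0 ≤ pause i m a
  /-- only coordinates from the local information are used -/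
  query_support : ∀ i m z t I c, query i m (z, t, I) c ≠ 0 → c ∈ I.support
  message_support : ∀ i k z I c, message i k (z, I) c ≠ 0 → c ∈ I.support
  measurable_sendTime : ∀ i k, Measurable fun z => (plan z).sendTime i k
  measurable_dest : ∀ i k, Measurable fun z => (plan z).dest i k
  measurable_size : ∀ i k, Measurable fun z => (plan z).size i k
  measurable_idx : ∀ i k r, Measurable fun z => (plan z).idx i k r
  measurable_coef : ∀ i k r, Measurable fun z => (plan z).coef i k r
  measurable_flow : ∀ i k u v t, Measurable fun z => (plan z).flow i k u v t
  measurable_compute : ∀ i m, Measurable (compute i m)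
  measurable_query : ∀ i m, Measurable (query i m)
  measurable_pause : ∀ i m, Measurable (pause i m)
  measurable_message : ∀ i k, Measurable (message i k)

namespace Algorithm

variable {n d : ℕ} {N : Network n} {Z : Type*} [MeasurableSpace Z] {Ξ : Type*}
  (A : Algorithm N d Z)
  -- the stochastic gradient mapping `(x, ξ) ↦ ∇f(x; ξ)`
  (g : Vec d → Ξ → Vec d)
  -- the random choices of the algorithm
  (z : Z)
  -- the sample used by worker `i` in iteration `m` of its computation loop
  (ξ : Fin n × ℕ → Ξ)

open scoped Classical in
/-- The vectors received by worker `i` up to time `t`, when message `(j, k)` carries the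
vector `M j k`. -/
def received (M : Fin n → ℕ → Vec d) (i : Fin n) (t : ℝ) (j : Fin n) (k : ℕ) : Vec d :=
  if (A.plan z).dest j k = i ∧ (A.plan z).Delivered j k t then M j k else 0

/-- The starting time of iteration `m` of the computation loop of worker `i`, together with the
stochastic gradients computed in the iterations before. -/
def loopState (M : Fin n → ℕ → Vec d) (i : Fin n) : ℕ → ℝ × (ℕ → Vec d)
  | 0 => (0, 0)
  | m + 1 =>
    let S := loopState M i m
    let a : Z × ℝ × LocalInfo n d := (z, S.1, (S.2, A.received z M i S.1))
    if A.compute i m a then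
      (S.1 + N.time i, Function.update S.2 m (g (A.query i m a) (ξ (i, m))))
    else (S.1 + A.pause i m a, S.2)

open scoped Classical in
/-- The local information of worker `i` at time `t`, when message `(j, k)` carries `M j k`. -/
def infoOf (M : Fin n → ℕ → Vec d) (i : Fin n) (t : ℝ) : LocalInfo n d :=
  (fun m => if (A.loopState g z ξ M i (m + 1)).1 ≤ t
      then (A.loopState g z ξ M i (m + 1)).2 m else 0,
    A.received z M i t)

open scoped Classical in
/-- The decompressed content of message `(i, k)`. It depends on the messages that have been
delivered before it is sent. -/
def content (i : Fin n) (k : ℕ) : Vec d :=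
  (A.plan z).decode i k (A.message i k (z, A.infoOf g z ξ
    (fun j l => if _h : (A.plan z).Delivered j l ((A.plan z).sendTime i k) then content j l else 0)
    i ((A.plan z).sendTime i k)))
  termination_by ⌊(A.plan z).sendTime i k * N.totalBw⌋₊
  decreasing_by exact CommPlan.Delivered.floor_lt _ _h

/-- The local information of worker `i` at time `t`. -/
def info (i : Fin n) (t : ℝ) : LocalInfo n d := A.infoOf g z ξ (A.content g z ξ) i t

/-- The local information at time `t` depends only on the messages delivered by time `t`. -/
theorem infoOf_congr {M M' : Fin n → ℕ → Vec d} {t : ℝ}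
    (h : ∀ j l, (A.plan z).Delivered j l t → M j l = M' j l) (i : Fin n) :
    A.infoOf g z ξ M i t = A.infoOf g z ξ M' i t := by
  have hrec : ∀ s ≤ t, A.received z M i s = A.received z M' i s := by
    intro s hs
    funext j l
    unfold received
    split_ifs with hd
    · exact h j l ⟨hd.2.1, hd.2.2.trans
        (Finset.sum_le_sum fun u _ => (A.plan z).flow_mono j l u _ hs)⟩
    · rfl
  have hstep : ∀ (M : Fin n → ℕ → Vec d) m,
      (A.loopState g z ξ M i m).1 ≤ (A.loopState g z ξ M i (m + 1)).1 := by
    intro M m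
    simp only [loopState]
    split_ifs
    · exact le_add_of_nonneg_right (N.time_pos i).le
    · exact le_add_of_nonneg_right (A.pause_nonneg i m _)
  have key : ∀ m, A.loopState g z ξ M i m = A.loopState g z ξ M' i m ∨
      (t < (A.loopState g z ξ M i m).1 ∧ t < (A.loopState g z ξ M' i m).1) := by
    intro m
    induction m with
    | zero => exact Or.inl rfl
    | succ m ih =>
      by_cases hlt : t < (A.loopState g z ξ M i m).1 ∧ t < (A.loopState g z ξ M' i m).1
      · exact Or.inr ⟨hlt.1.trans_le (hstep M m), hlt.2.trans_le (hstep M' m)⟩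
      · have e := ih.resolve_right hlt
        have hle : (A.loopState g z ξ M' i m).1 ≤ t := by
          by_contra! hc
          exact hlt ⟨by rwa [e], hc⟩
        left
        simp only [loopState]
        rw [e, hrec _ hle]
  unfold infoOf
  rw [hrec t le_rfl]
  congr 1
  funext m
  rcases key (m + 1) with e | ⟨h1, h2⟩
  · rw [e]
  · rw [if_neg h1.not_ge, if_neg h2.not_ge]

/-- A message is formed from the local information of its sender at the moment of sending. -/
theorem content_eq (i : Fin n) (k : ℕ) :
    A.content g z ξ i k = (A.plan z).decode i k
      (A.message i k (z, A.info g z ξ i ((A.plan z).sendTime i k))) := by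
  rw [content, info, A.infoOf_congr g z ξ (M' := A.content g z ξ)]
  intro j l h
  rw [dif_pos h]

/-- All points which the algorithm can construct up to time `t` from the local information of some
worker. -/
def reachable (t : ℝ) : Set (Vec d) :=
  {y | ∃ i, ∀ c, y c ≠ 0 → c ∈ (A.info g z ξ i t).support}

end Algorithm

/-! ### Functions and oracles -/

/-- `f` is differentiable and `L`-smooth, bounded from below, and `f 0 - inf f ≤ Δ`. -/
def SmoothClass {d : ℕ} (L Δ : ℝ) (f : Vec d → ℝ) : Prop :=
  Differentiable ℝ f ∧ (∀ x y, ‖gradient f x - gradient f y‖ ≤ L * ‖x - y‖) ∧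
    BddBelow (Set.range f) ∧ f 0 - ⨅ x, f x ≤ Δ

/-- With `ξ ∼ D`, the vector `g x ξ` is an unbiased estimate of `∇f(x)` of variance at most
`σsq`. -/
def IsOracle {d : ℕ} {Ξ : Type*} [MeasurableSpace Ξ] (D : Measure Ξ) (g : Vec d → Ξ → Vec d)
    (f : Vec d → ℝ) (σsq : ℝ) : Prop :=
  Measurable (Function.uncurry g) ∧ ∀ x, Integrable (g x) D ∧ ∫ ξ, g x ξ ∂D = gradient f x ∧
    Integrable (fun ξ => ‖g x ξ - gradient f x‖ ^ 2) D ∧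
    ∫ ξ, ‖g x ξ - gradient f x‖ ^ 2 ∂D ≤ σsq

/-! ### Gomory–Hu trees and the time complexity -/

open scoped Classical in
/-- The value of the cut `(U, V ∖ U)`. -/
def cutValue {n : ℕ} (N : Network n) (U : Set (Fin n)) : ℝ :=
  ∑ x, ∑ y, if x ∈ U ∧ y ∉ U then N.bw x y else 0

/-- `(U, V ∖ U)` is a minimum `i`–`j` cut. -/
def IsMinCut {n : ℕ} (N : Network n) (i j : Fin n) (U : Set (Fin n)) : Prop :=
  i ∈ U ∧ j ∉ U ∧ ∀ U' : Set (Fin n), i ∈ U' → j ∉ U' → cutValue N U ≤ cutValue N U'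

/-- A Gomory–Hu tree of the network, with its edges listed in the order of nondecreasing weight. -/
structure SortedGomoryHuTree {n : ℕ} (N : Network n) where
  tree : SimpleGraph (Fin n)
  isTree : tree.IsTree
  weight : Sym2 (Fin n) → ℝ
  isMinCut : ∀ i j, tree.Adj i j →
    IsMinCut N i j {v | (tree.deleteEdges {s(i, j)}).Reachable i v}
  weight_eq : ∀ i j, tree.Adj i j →
    weight s(i, j) = cutValue N {v | (tree.deleteEdges {s(i, j)}).Reachable i v}
  edge : Fin (n - 1) ≃ tree.edgeSet
  sorted : Monotone fun k => weight (edge k)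

/-- The numbers `h i`, `i ∈ S`, in nondecreasing order. -/
def sortedTimes {n : ℕ} (h : Fin n → ℝ) (S : Finset (Fin n)) : List ℝ :=
  (S.val.map h).sort (· ≤ ·)

/-- The minimum over `m ∈ {1, …, |S|}` (here `m = l + 1`) of
`(1/m ∑_{i ≤ m} 1 / h_{π_i(S)})⁻¹ (1 + r / m)`. -/
def batchTime {n : ℕ} (h : Fin n → ℝ) (r : ℝ) (S : Finset (Fin n)) : ℝ :=
  ⨅ l : Fin S.card,
    (1 / ((l : ℝ) + 1) * (((sortedTimes h S).take (l + 1)).map fun a => 1 / a).sum)⁻¹ *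
      (1 + r / ((l : ℝ) + 1))

namespace SortedGomoryHuTree

variable {n : ℕ} {N : Network n} (T : SortedGomoryHuTree N)

/-- The forest that remains when the first `k` edges are removed; its components are
`S_{k+1,1}, …, S_{k+1,k+1}`. -/
def forest (k : ℕ) : SimpleGraph (Fin n) :=
  T.tree.deleteEdges {e | ∃ j : Fin (n - 1), (j : ℕ) < k ∧ (T.edge j : Sym2 (Fin n)) = e}

open scoped Classical in
/-- `min_{k ∈ [n]} (d / w̄_k + min_{p ∈ [k]} batchTime S_{k,p})`, where the index `k` runs from `0`
here, and `d / w̄_n = 0` since `w̄_n = ∞`. -/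
def graceTime (d r : ℝ) : ℝ :=
  ⨅ k : Fin n, ((if hk : (k : ℕ) < n - 1 then d / T.weight (T.edge ⟨k, hk⟩) else 0) +
    ⨅ C : (T.forest k).ConnectedComponent, batchTime N.time r C.supp.toFinset)

end SortedGomoryHuTree

end Decentralized

end

open Decentralized

/-! The hard function is a chain of blocks of `K` coordinates each, `K` logarithmic in `n`: the gate of
a block stays shut, with vanishing gradient behind it, until *all* coordinates of the preceding block
are nonzero, and the gradient is large as long as a single coordinate of the chain vanishes
(`chainFun`, `le_norm_hardGrad_sq`). The coordinates of the chain are placed at random positions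
among the `d` coordinates, and the oracle multiplies the entries at the frontier of the chain by
independent biased coins (`hardOracle`, `isOracle_hardOracle`). So a worker that knows a complete
block and needs a given coordinate of the next one has only two ways to get it: a coin comes up for
it, or somebody who knows it sends it. What is sent has been chosen independently of the positions.

Let `γ` be the minimum in the time complexity. The Gomory–Hu tree splits the workers into groups
`G i` such that little can be sent into `G i` within a small multiple of `γ / K` seconds, because the
cut values are at most of order `d / γ`, and such that the workers in `G i` are either in a set `C i`
for which few coins come up in that time, or have a smaller level than `i` (`exists_groups`). The
groups are obtained from the laminar family of the sides of those edges of the tree whose cuts are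
small, and the level of a worker is the binary logarithm of the size of the smallest side that
contains it; there are only logarithmically many levels.

Divide time into slots of length `θ`, a small multiple of `γ / K`. If block `u` is not reached at the
beginning of a window of two slots, then no block much beyond `u` is reached at its end, unless one of
the workers `i` gets a *complete* block, each coordinate of which is hit by a coin of `C i` or sent
into `G i` (`not_reached_of_not_got`, by induction on time and on the levels). One coordinate is got
with probability at most `1 / 4`, a complete block with probability at most `4 ^ (-K)`, and a union
bound over workers and blocks applies (`sum_measure_fast_le`). Both parts need independence in spite
of the adaptivity of the algorithm. Before block `u` is reached, nothing depends on the later coins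
and positions (`not_reached_congr`, a consequence of causality). For the coins, the assignments of
trials to the coordinates are counted in the worlds in which exactly these trials are forced to
succeed; the forced worlds are indistinguishable up to the first trial in which two assignments
differ, so that an assignment is determined by the ordinal numbers of its trials
(`Valid.eq`, `measure_hit_le`).

Hence most stages of `K` blocks take at least two slots, and by Markov's inequality `W` stages are unlikely to
be completed within `W` slots (`sum_measure_reached_le`). For some placement of the chain, the
expected squared gradient norm is then more than `ε` up to the time `W * θ`
(`exists_hard_instance`), where `W` is of order `L * Δ / ε`, up to a power of `K`. -/

noncomputable section

namespace Decentralized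

/-! ### Scalar building blocks -/

/-- The square of the positive part, a `C^{1,1}` function. -/
def sqPos (x : ℝ) : ℝ := max x 0 ^ 2

theorem sqPos_nonneg (x : ℝ) : 0 ≤ sqPos x := sq_nonneg _

theorem hasDerivAt_sqPos (x : ℝ) : HasDerivAt sqPos (2 * max x 0) x := by
  rcases lt_trichotomy x 0 with h | rfl | h
  · rw [max_eq_right h.le, mul_zero]
    refine (hasDerivAt_const x (0 : ℝ)).congr_of_eventuallyEq ?_
    filter_upwards [Iio_mem_nhds h] with y hy
    simp [sqPos, max_eq_right (le_of_lt (Set.mem_Iio.1 hy))]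
  · have h1 : HasDerivWithinAt sqPos 0 (Set.Iic 0) 0 := by
      refine (hasDerivWithinAt_const (0 : ℝ) (Set.Iic 0) (0 : ℝ)).congr (fun y hy => ?_) ?_
      · simp [sqPos, max_eq_right (show y ≤ 0 from hy)]
      · simp [sqPos]
    have h2 : HasDerivWithinAt sqPos 0 (Set.Ici 0) 0 := by
      have : HasDerivWithinAt (fun y : ℝ => y ^ 2) 0 (Set.Ici 0) 0 := by
        simpa using (hasDerivAt_pow 2 (0 : ℝ)).hasDerivWithinAt (s := Set.Ici 0)
      refine this.congr (fun y hy => ?_) ?_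
      · simp [sqPos, max_eq_left (show 0 ≤ y from hy)]
      · simp [sqPos]
    have h3 := h1.union h2
    rw [Set.Iic_union_Ici, hasDerivWithinAt_univ] at h3
    simpa using h3
  · rw [max_eq_left h.le]
    have : HasDerivAt (fun y : ℝ => y ^ 2) (2 * x) x := by simpa using hasDerivAt_pow 2 x
    refine this.congr_of_eventuallyEq ?_
    filter_upwards [Ioi_mem_nhds h] with y hy
    simp [sqPos, max_eq_left (le_of_lt (Set.mem_Ioi.1 hy))]

/-- A `C^{1,1}` step from `0` (on `x ≤ 0`) to `1` (on `1 ≤ x`); its derivative is a tent of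
height `2`. -/
def step (x : ℝ) : ℝ := 2 * sqPos x - 4 * sqPos (x - 1 / 2) + 2 * sqPos (x - 1)

/-- The derivative of `step`. -/
def stepDeriv (x : ℝ) : ℝ := 4 * max x 0 - 8 * max (x - 1 / 2) 0 + 4 * max (x - 1) 0

theorem hasDerivAt_step (x : ℝ) : HasDerivAt step (stepDeriv x) x := by
  have h1 := (hasDerivAt_sqPos x).const_mul 2
  have h2 := ((hasDerivAt_sqPos (x - 1 / 2)).comp x
    ((hasDerivAt_id x).sub_const (1 / 2))).const_mul 4
  have h3 := ((hasDerivAt_sqPos (x - 1)).comp x ((hasDerivAt_id x).sub_const 1)).const_mul 2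
  refine ((h1.sub h2).add h3).congr_deriv ?_
  unfold stepDeriv
  ring

theorem step_of_nonpos {x : ℝ} (h : x ≤ 0) : step x = 0 := by
  rw [step, sqPos, sqPos, sqPos, max_eq_right h, max_eq_right (by linarith),
    max_eq_right (by linarith)]
  ring

theorem step_of_one_le {x : ℝ} (h : 1 ≤ x) : step x = 1 := by
  rw [step, sqPos, sqPos, sqPos, max_eq_left (by linarith), max_eq_left (by linarith),
    max_eq_left (by linarith)]
  ring

theorem step_nonneg (x : ℝ) : 0 ≤ step x := by
  unfold step sqPos
  rcases max_cases x 0 with ⟨e1, h1⟩ | ⟨e1, h1⟩ <;>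
  rcases max_cases (x - 1 / 2) 0 with ⟨e2, h2⟩ | ⟨e2, h2⟩ <;>
  rcases max_cases (x - 1) 0 with ⟨e3, h3⟩ | ⟨e3, h3⟩ <;> rw [e1, e2, e3] <;> nlinarith

theorem step_le_one (x : ℝ) : step x ≤ 1 := by
  unfold step sqPos
  rcases max_cases x 0 with ⟨e1, h1⟩ | ⟨e1, h1⟩ <;>
  rcases max_cases (x - 1 / 2) 0 with ⟨e2, h2⟩ | ⟨e2, h2⟩ <;>
  rcases max_cases (x - 1) 0 with ⟨e3, h3⟩ | ⟨e3, h3⟩ <;> rw [e1, e2, e3] <;>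
  nlinarith [sq_nonneg (1 - x)]

theorem stepDeriv_nonneg (x : ℝ) : 0 ≤ stepDeriv x := by
  unfold stepDeriv
  rcases max_cases x 0 with ⟨e1, h1⟩ | ⟨e1, h1⟩ <;>
  rcases max_cases (x - 1 / 2) 0 with ⟨e2, h2⟩ | ⟨e2, h2⟩ <;>
  rcases max_cases (x - 1) 0 with ⟨e3, h3⟩ | ⟨e3, h3⟩ <;> rw [e1, e2, e3] <;> linarith

theorem stepDeriv_le_two (x : ℝ) : stepDeriv x ≤ 2 := by
  unfold stepDeriv
  rcases max_cases x 0 with ⟨e1, h1⟩ | ⟨e1, h1⟩ <;>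
  rcases max_cases (x - 1 / 2) 0 with ⟨e2, h2⟩ | ⟨e2, h2⟩ <;>
  rcases max_cases (x - 1) 0 with ⟨e3, h3⟩ | ⟨e3, h3⟩ <;> rw [e1, e2, e3] <;> linarith

theorem stepDeriv_of_nonpos {x : ℝ} (h : x ≤ 0) : stepDeriv x = 0 := by
  rw [stepDeriv, max_eq_right h, max_eq_right (by linarith), max_eq_right (by linarith)]
  ring

theorem one_le_stepDeriv {x : ℝ} (h1 : 1 / 4 ≤ x) (h2 : x ≤ 3 / 4) : 1 ≤ stepDeriv x := by
  unfold stepDeriv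
  rw [max_eq_left (show 0 ≤ x by linarith), max_eq_right (show x - 1 ≤ 0 by linarith)]
  rcases max_cases (x - 1 / 2) 0 with ⟨e2, h2⟩ | ⟨e2, h2⟩ <;> rw [e2] <;> linarith

theorem stepDeriv_half : stepDeriv (1 / 2) = 2 := by
  norm_num [stepDeriv, max_def]

theorem abs_max_zero_sub_le (x y : ℝ) : |max x 0 - max y 0| ≤ |x - y| := by
  simpa using abs_max_sub_max_le_abs x y 0

theorem abs_stepDeriv_sub_le (x y : ℝ) : |stepDeriv x - stepDeriv y| ≤ 16 * |x - y| := by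
  have h1 := abs_le.1 (abs_max_zero_sub_le x y)
  have h2 := abs_le.1 (abs_max_zero_sub_le (x - 1 / 2) (y - 1 / 2))
  have h3 := abs_le.1 (abs_max_zero_sub_le (x - 1) (y - 1))
  rw [show x - 1 / 2 - (y - 1 / 2) = x - y by ring] at h2
  rw [show x - 1 - (y - 1) = x - y by ring] at h3
  rw [abs_le]
  unfold stepDeriv
  constructor <;> linarith

theorem abs_step_sub_le (x y : ℝ) : |step x - step y| ≤ 2 * |x - y| := by
  have := Convex.norm_image_sub_le_of_norm_hasDerivWithin_le (f := step) (f' := stepDeriv)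
    (s := Set.univ) (C := 2) (x := y) (y := x) (fun z _ => (hasDerivAt_step z).hasDerivWithinAt)
    (fun z _ => by
      rw [Real.norm_eq_abs, abs_of_nonneg (stepDeriv_nonneg z)]; exact stepDeriv_le_two z)
    convex_univ trivial trivial
  simpa [Real.norm_eq_abs] using this

/-- The bounded increasing function that rewards progress in one coordinate. -/
def reward (x : ℝ) : ℝ := 8 * step ((x + 2) / 4)

/-- The derivative of `reward`. -/
def rewardDeriv (x : ℝ) : ℝ := 2 * stepDeriv ((x + 2) / 4)

theorem hasDerivAt_reward (x : ℝ) : HasDerivAt reward (rewardDeriv x) x := by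
  have h := ((hasDerivAt_step ((x + 2) / 4)).comp x
    (((hasDerivAt_id x).add_const 2).div_const 4)).const_mul 8
  refine h.congr_deriv ?_
  unfold rewardDeriv
  ring

theorem reward_nonneg (x : ℝ) : 0 ≤ reward x := mul_nonneg (by norm_num) (step_nonneg _)

theorem reward_le (x : ℝ) : reward x ≤ 8 := by
  have := step_le_one ((x + 2) / 4)
  unfold reward; linarith

theorem rewardDeriv_nonneg (x : ℝ) : 0 ≤ rewardDeriv x :=
  mul_nonneg (by norm_num) (stepDeriv_nonneg _)

theorem rewardDeriv_le (x : ℝ) : rewardDeriv x ≤ 4 := by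
  have := stepDeriv_le_two ((x + 2) / 4)
  unfold rewardDeriv; linarith

theorem two_le_rewardDeriv {x : ℝ} (h1 : -1 ≤ x) (h2 : x ≤ 1) : 2 ≤ rewardDeriv x := by
  have := one_le_stepDeriv (x := (x + 2) / 4) (by linarith) (by linarith)
  unfold rewardDeriv; linarith

theorem abs_scale_sub (x y : ℝ) : |(x + 2) / 4 - (y + 2) / 4| = |x - y| / 4 := by
  rw [show (x + 2) / 4 - (y + 2) / 4 = (x - y) / 4 by ring, abs_div]
  norm_num

theorem abs_reward_sub_le (x y : ℝ) : |reward x - reward y| ≤ 4 * |x - y| := by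
  have := abs_step_sub_le ((x + 2) / 4) ((y + 2) / 4)
  rw [abs_scale_sub] at this
  unfold reward
  rw [← mul_sub, abs_mul]
  norm_num
  linarith

theorem abs_rewardDeriv_sub_le (x y : ℝ) : |rewardDeriv x - rewardDeriv y| ≤ 8 * |x - y| := by
  have := abs_stepDeriv_sub_le ((x + 2) / 4) ((y + 2) / 4)
  rw [abs_scale_sub] at this
  unfold rewardDeriv
  rw [← mul_sub, abs_mul]
  norm_num
  linarith

/-- The penalty of negative coordinates, with derivative `-2 max (-x) 0`. -/
def penalty (x : ℝ) : ℝ := sqPos (-x)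

theorem hasDerivAt_penalty (x : ℝ) : HasDerivAt penalty (-(2 * max (-x) 0)) x := by
  have h := (hasDerivAt_sqPos (-x)).comp x (hasDerivAt_neg x)
  refine h.congr_deriv ?_
  ring

/-! ### The chain function -/

/-- The indices of a chain of `B` blocks of `K` coordinates each. -/
abbrev Chain (B K : ℕ) : Type := Fin B × Fin K

section ChainFunction

variable {B K : ℕ}

/-- The gate of block `b` is `1` when all coordinates of the preceding block are at least `1`, and
vanishes unless all of them are nonzero. Block `0` has no predecessor, and its gate is open. -/
def gate (b : ℕ) (y : Chain B K → ℝ) : ℝ := ∏ c with (c.1 : ℕ) + 1 = b, step (y c)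

/-- The hard function, in unscaled coordinates. -/
def chainFun (y : Chain B K → ℝ) : ℝ :=
  ∑ c : Chain B K, (penalty (y c) - gate c.1 y * reward (y c))

/-- The partial derivatives of `chainFun`. -/
def chainGrad (y : Chain B K → ℝ) (c : Chain B K) : ℝ :=
  -(2 * max (-y c) 0) - gate c.1 y * rewardDeriv (y c) -
    stepDeriv (y c) * (∏ e with (e.1 : ℕ) = c.1 ∧ e ≠ c, step (y e)) *
      ∑ c' with (c'.1 : ℕ) = c.1 + 1, reward (y c')

theorem gate_nonneg (b : ℕ) (y : Chain B K → ℝ) : 0 ≤ gate b y :=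
  Finset.prod_nonneg fun _ _ => step_nonneg _

theorem gate_le_one (b : ℕ) (y : Chain B K → ℝ) : gate b y ≤ 1 :=
  Finset.prod_le_one (fun _ _ => step_nonneg _) fun _ _ => step_le_one _

theorem gate_eq_zero {b : ℕ} {y : Chain B K → ℝ} {e : Chain B K} (he : (e.1 : ℕ) + 1 = b)
    (h : y e = 0) : gate b y = 0 :=
  Finset.prod_eq_zero (i := e) (by simpa using he) (by rw [h]; exact step_of_nonpos le_rfl)

theorem hasFDerivAt_gate (b : ℕ) (y : Chain B K → ℝ) :
    HasFDerivAt (gate b) (∑ e with (e.1 : ℕ) + 1 = b,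
      (∏ e' ∈ (Finset.univ.filter fun c : Chain B K => (c.1 : ℕ) + 1 = b).erase e, step (y e')) •
        (stepDeriv (y e) • (ContinuousLinearMap.proj e : (Chain B K → ℝ) →L[ℝ] ℝ))) y := by
  classical
  have := HasFDerivAt.finsetProd (u := Finset.univ.filter fun c : Chain B K => (c.1 : ℕ) + 1 = b)
    (g := fun c (y : Chain B K → ℝ) => step (y c)) (x := y)
    (g' := fun e => stepDeriv (y e) • (ContinuousLinearMap.proj e : (Chain B K → ℝ) →L[ℝ] ℝ))
    (fun e _ => HasDerivAt.comp_hasFDerivAt (f := fun y : Chain B K → ℝ => y e) y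
      (hasDerivAt_step (y e)) (ContinuousLinearMap.proj e : (Chain B K → ℝ) →L[ℝ] ℝ).hasFDerivAt)
  exact this

theorem hasFDerivAt_chainFun (y : Chain B K → ℝ) :
    HasFDerivAt chainFun
      (∑ c, chainGrad y c • (ContinuousLinearMap.proj c : (Chain B K → ℝ) →L[ℝ] ℝ)) y := by
  have hp : ∀ c : Chain B K, HasFDerivAt (fun y : Chain B K → ℝ => y c)
      (ContinuousLinearMap.proj c : (Chain B K → ℝ) →L[ℝ] ℝ) y := fun c =>
    (ContinuousLinearMap.proj c : (Chain B K → ℝ) →L[ℝ] ℝ).hasFDerivAt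
  have h := HasFDerivAt.fun_sum (u := Finset.univ) fun (c : Chain B K) _ =>
    ((hasDerivAt_penalty (y c)).comp_hasFDerivAt y (hp c)).sub
      ((hasFDerivAt_gate c.1 y).mul ((hasDerivAt_reward (y c)).comp_hasFDerivAt y (hp c)))
  refine h.congr_fderiv (ContinuousLinearMap.ext fun v => ?_)
  simp only [sum_apply, smul_apply, ContinuousLinearMap.proj_apply, smul_eq_mul, sub_apply,
    add_apply, Function.comp_apply]
  have key : ∑ c : Chain B K, reward (y c) * ∑ e with (e.1 : ℕ) + 1 = c.1,
      (∏ e' ∈ (Finset.univ.filter fun c' : Chain B K => (c'.1 : ℕ) + 1 = c.1).erase e,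
        step (y e')) * (stepDeriv (y e) * v e) =
      ∑ e : Chain B K, stepDeriv (y e) * (∏ e' with (e'.1 : ℕ) = e.1 ∧ e' ≠ e, step (y e')) *
        (∑ c with (c.1 : ℕ) = e.1 + 1, reward (y c)) * v e := by
    simp_rw [Finset.mul_sum, Finset.sum_mul, Finset.sum_filter]
    rw [Finset.sum_comm]
    refine Finset.sum_congr rfl fun e _ => Finset.sum_congr rfl fun c _ => ?_
    by_cases hec : (e.1 : ℕ) + 1 = c.1
    · rw [if_pos hec, if_pos hec.symm]
      have : (Finset.univ.filter fun c' : Chain B K => (c'.1 : ℕ) + 1 = c.1).erase e =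
          Finset.univ.filter fun e' : Chain B K => (e'.1 : ℕ) = e.1 ∧ e' ≠ e := by
        ext e'
        simp only [Finset.mem_erase, Finset.mem_filter, Finset.mem_univ, true_and]
        constructor
        · rintro ⟨h1, h2⟩; exact ⟨by omega, h1⟩
        · rintro ⟨h1, h2⟩; exact ⟨h2, by omega⟩
      rw [this]
      ring
    · rw [if_neg hec, if_neg (fun h => hec h.symm)]
  rw [Finset.sum_sub_distrib, Finset.sum_add_distrib, key]
  simp_rw [chainGrad, sub_mul, Finset.sum_sub_distrib]
  rw [sub_sub]
  congr 2
  exact Finset.sum_congr rfl fun c _ => by ring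

theorem chainFun_zero_nonpos : chainFun (0 : Chain B K → ℝ) ≤ 0 := by
  refine Finset.sum_nonpos fun c _ => ?_
  have h1 : penalty ((0 : Chain B K → ℝ) c) = 0 := by simp [penalty, sqPos]
  rw [h1]
  have := mul_nonneg (gate_nonneg c.1 (0 : Chain B K → ℝ)) (reward_nonneg ((0 : Chain B K → ℝ) c))
  linarith

theorem le_chainFun (y : Chain B K → ℝ) : -(8 * (B * K : ℝ)) ≤ chainFun y := by
  have h : ∀ c ∈ (Finset.univ : Finset (Chain B K)),
      (-8 : ℝ) ≤ penalty (y c) - gate c.1 y * reward (y c) := by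
    intro c _
    have h1 : 0 ≤ penalty (y c) := sqPos_nonneg _
    have h2 : gate c.1 y * reward (y c) ≤ 1 * 8 :=
      mul_le_mul (gate_le_one _ _) (reward_le _) (reward_nonneg _) zero_le_one
    linarith
  have := Finset.card_nsmul_le_sum _ _ _ h
  simp only [Finset.card_univ, Fintype.card_prod, Fintype.card_fin, nsmul_eq_mul] at this
  push_cast at this
  unfold chainFun
  linarith

/-- As long as some coordinate is below `1`, the gradient is large: all three parts of the partial
derivatives are nonpositive, and in the first block with such a coordinate the gate is open. -/
theorem exists_chainGrad_le {y : Chain B K → ℝ} (h : ∃ c, y c < 1) :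
    ∃ c, chainGrad y c ≤ -2 := by
  classical
  obtain ⟨c, hc, hmin⟩ := Finset.exists_min_image (Finset.univ.filter fun c : Chain B K => y c < 1)
    (fun c => (c.1 : ℕ)) (by obtain ⟨c, hc⟩ := h; exact ⟨c, by simpa using hc⟩)
  simp only [Finset.mem_filter, Finset.mem_univ, true_and] at hc hmin
  refine ⟨c, ?_⟩
  have hgate : gate c.1 y = 1 := by
    refine Finset.prod_eq_one fun e he => step_of_one_le ?_
    simp only [Finset.mem_filter, Finset.mem_univ, true_and] at he
    by_contra! hlt
    have := hmin e hlt
    omega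
  have h3 : 0 ≤ stepDeriv (y c) * (∏ e with (e.1 : ℕ) = c.1 ∧ e ≠ c, step (y e)) *
      ∑ c' with (c'.1 : ℕ) = c.1 + 1, reward (y c') :=
    mul_nonneg (mul_nonneg (stepDeriv_nonneg _) (Finset.prod_nonneg fun _ _ => step_nonneg _))
      (Finset.sum_nonneg fun _ _ => reward_nonneg _)
  unfold chainGrad
  rw [hgate]
  rcases le_or_gt (-1) (y c) with h1 | h1
  · have := two_le_rewardDeriv h1 hc.le
    have := le_max_right (-y c) 0
    linarith
  · have := le_max_left (-y c) 0
    have := rewardDeriv_nonneg (y c)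
    linarith

theorem chainGrad_of_eq_zero {y : Chain B K → ℝ} {c : Chain B K} (h : y c = 0) :
    chainGrad y c = -(4 * gate c.1 y) := by
  have h2 : rewardDeriv 0 = 4 := by
    unfold rewardDeriv
    rw [show ((0 : ℝ) + 2) / 4 = 1 / 2 by norm_num, stepDeriv_half]; norm_num
  unfold chainGrad
  rw [h, h2, stepDeriv_of_nonpos le_rfl]
  simp
  ring

theorem abs_prod_sub_prod_le {ι : Type*} (s : Finset ι) (u v : ι → ℝ)
    (hu : ∀ i ∈ s, |u i| ≤ 1) (hv : ∀ i ∈ s, |v i| ≤ 1) :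
    |∏ i ∈ s, u i - ∏ i ∈ s, v i| ≤ ∑ i ∈ s, |u i - v i| := by
  classical
  induction s using Finset.induction_on with
  | empty => simp
  | insert a s ha ih =>
    rw [Finset.prod_insert ha, Finset.prod_insert ha, Finset.sum_insert ha]
    have ih' := ih (fun i hi => hu i (Finset.mem_insert_of_mem hi))
      (fun i hi => hv i (Finset.mem_insert_of_mem hi))
    have hp : |∏ i ∈ s, u i| ≤ 1 := by
      rw [Finset.abs_prod]
      exact Finset.prod_le_one (fun _ _ => abs_nonneg _)
        fun i hi => hu i (Finset.mem_insert_of_mem hi)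
    have e : u a * ∏ i ∈ s, u i - v a * ∏ i ∈ s, v i =
        (u a - v a) * ∏ i ∈ s, u i + v a * (∏ i ∈ s, u i - ∏ i ∈ s, v i) := by ring
    rw [e]
    refine (abs_add_le _ _).trans ?_
    rw [abs_mul, abs_mul]
    have hva := hv a (Finset.mem_insert_self a s)
    have h1 := mul_le_mul_of_nonneg_left hp (abs_nonneg (u a - v a))
    have h2 := mul_le_mul_of_nonneg_right hva (abs_nonneg (∏ i ∈ s, u i - ∏ i ∈ s, v i))
    linarith

theorem abs_prod_step_sub_le (s : Finset (Chain B K)) (y y' : Chain B K → ℝ) :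
    |∏ c ∈ s, step (y c) - ∏ c ∈ s, step (y' c)| ≤ 2 * ∑ c ∈ s, |y c - y' c| := by
  have h1 : ∀ x, |step x| ≤ 1 := fun x => by
    rw [abs_of_nonneg (step_nonneg x)]; exact step_le_one x
  refine (abs_prod_sub_prod_le s _ _ (fun c _ => h1 _) (fun c _ => h1 _)).trans ?_
  rw [Finset.mul_sum]
  exact Finset.sum_le_sum fun c _ => abs_step_sub_le _ _

theorem card_block_le (b : ℕ) :
    (Finset.univ.filter fun c : Chain B K => (c.1 : ℕ) = b).card ≤ K := by
  calc _ ≤ (Finset.univ : Finset (Fin K)).card := by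
        refine Finset.card_le_card_of_injOn (fun c => c.2) (fun _ _ => by simp) ?_
        intro c hc c' hc' h
        simp at hc hc'
        exact Prod.ext (Fin.ext (hc.trans hc'.symm)) h
    _ = K := by simp

/-- The indices in the blocks next to that of `c`, and in its own block. -/
def nearby (c : Chain B K) : Finset (Chain B K) :=
  Finset.univ.filter fun e => (e.1 : ℕ) + 1 = c.1 ∨ (e.1 : ℕ) = c.1 ∨ (e.1 : ℕ) = c.1 + 1

theorem mem_nearby_comm {c e : Chain B K} : e ∈ nearby c ↔ c ∈ nearby e := by
  simp only [nearby, Finset.mem_filter, Finset.mem_univ, true_and]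
  omega

theorem card_nearby_le (c : Chain B K) : (nearby c).card ≤ 3 * K := by
  classical
  have : nearby c ⊆ (Finset.univ.filter fun e : Chain B K => (e.1 : ℕ) = (c.1 : ℕ) - 1) ∪
      ((Finset.univ.filter fun e : Chain B K => (e.1 : ℕ) = c.1) ∪
      (Finset.univ.filter fun e : Chain B K => (e.1 : ℕ) = c.1 + 1)) := by
    intro e he
    simp only [nearby, Finset.mem_filter, Finset.mem_univ, true_and, Finset.mem_union] at he ⊢
    omega
  refine (Finset.card_le_card this).trans ((Finset.card_union_le _ _).trans ?_)
  have h1 := card_block_le (B := B) (K := K) ((c.1 : ℕ) - 1)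
  have h2 := Finset.card_union_le (Finset.univ.filter fun e : Chain B K => (e.1 : ℕ) = c.1)
    (Finset.univ.filter fun e : Chain B K => (e.1 : ℕ) = c.1 + 1)
  have h3 := card_block_le (B := B) (K := K) c.1
  have h4 := card_block_le (B := B) (K := K) (c.1 + 1)
  omega

theorem abs_mul_sub_mul_le {a a' b b' A C : ℝ} (ha : |a| ≤ A) (hb' : |b'| ≤ C) :
    |a * b - a' * b'| ≤ A * |b - b'| + C * |a - a'| := by
  rw [show a * b - a' * b' = a * (b - b') + b' * (a - a') by ring]
  refine (abs_add_le _ _).trans ?_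
  rw [abs_mul, abs_mul]
  exact add_le_add (mul_le_mul_of_nonneg_right ha (abs_nonneg _))
    (mul_le_mul_of_nonneg_right hb' (abs_nonneg _))

theorem abs_chainGrad_sub_le (y y' : Chain B K → ℝ) (c : Chain B K) :
    |chainGrad y c - chainGrad y' c| ≤ 256 * K * ∑ e ∈ nearby c, |y e - y' e| := by
  classical
  have hK : (1 : ℝ) ≤ K := by exact_mod_cast (Fin.pos c.2)
  set u : Chain B K → ℝ := fun e => |y e - y' e| with hu
  have hu0 : ∀ e, 0 ≤ u e := fun e => abs_nonneg _
  set Sn := ∑ e ∈ nearby c, u e with hSn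
  have hsub : ∀ s : Finset (Chain B K), s ⊆ nearby c → ∑ e ∈ s, u e ≤ Sn := fun s hs =>
    Finset.sum_le_sum_of_subset_of_nonneg hs fun e _ _ => hu0 e
  have hSn0 : 0 ≤ Sn := Finset.sum_nonneg fun e _ => hu0 e
  have huc : u c ≤ Sn := by
    have := hsub {c} (by simp [nearby])
    simpa using this
  -- the penalty
  have h1 : |2 * max (-y c) 0 - 2 * max (-y' c) 0| ≤ 2 * Sn := by
    rw [← mul_sub, abs_mul]
    have := abs_max_zero_sub_le (-y c) (-y' c)
    rw [show -y c - -y' c = -(y c - y' c) by ring, abs_neg] at this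
    norm_num
    linarith
  -- the reward of the coordinate itself
  have h2 : |gate c.1 y * rewardDeriv (y c) - gate c.1 y' * rewardDeriv (y' c)| ≤ 16 * Sn := by
    have hg : |gate c.1 y - gate c.1 y'| ≤ 2 * Sn :=
      (abs_prod_step_sub_le _ y y').trans (mul_le_mul_of_nonneg_left (hsub _ (by
        intro e he; simp only [nearby, Finset.mem_filter, Finset.mem_univ, true_and] at he ⊢
        exact Or.inl he)) (by norm_num))
    have := abs_mul_sub_mul_le (a := gate c.1 y) (a' := gate c.1 y') (b := rewardDeriv (y c))
      (b' := rewardDeriv (y' c)) (A := 1) (C := 4)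
      (by rw [abs_of_nonneg (gate_nonneg _ _)]; exact gate_le_one _ _)
      (by rw [abs_of_nonneg (rewardDeriv_nonneg _)]; exact rewardDeriv_le _)
    have h3 := abs_rewardDeriv_sub_le (y c) (y' c)
    change _ ≤ 8 * u c at h3
    linarith
  -- the rewards of the next block
  set P := fun y : Chain B K → ℝ => ∏ e with (e.1 : ℕ) = c.1 ∧ e ≠ c, step (y e) with hP
  set Q := fun y : Chain B K → ℝ => ∑ c' with (c'.1 : ℕ) = c.1 + 1, reward (y c') with hQ
  have hP0 : ∀ y, 0 ≤ P y := fun y => Finset.prod_nonneg fun _ _ => step_nonneg _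
  have hP1 : ∀ y, P y ≤ 1 := fun y =>
    Finset.prod_le_one (fun _ _ => step_nonneg _) fun _ _ => step_le_one _
  have hPd : |P y - P y'| ≤ 2 * Sn :=
    (abs_prod_step_sub_le _ y y').trans (mul_le_mul_of_nonneg_left (hsub _ (by
      intro e he; simp only [nearby, Finset.mem_filter, Finset.mem_univ, true_and] at he ⊢
      exact Or.inr (Or.inl he.1))) (by norm_num))
  have hQd : |Q y - Q y'| ≤ 4 * Sn := by
    simp only [hQ]
    rw [← Finset.sum_sub_distrib]
    refine (Finset.abs_sum_le_sum_abs _ _).trans ?_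
    refine (Finset.sum_le_sum fun e _ => abs_reward_sub_le (y e) (y' e)).trans ?_
    rw [← Finset.mul_sum]
    exact mul_le_mul_of_nonneg_left (hsub _ (by
      intro e he; simp only [nearby, Finset.mem_filter, Finset.mem_univ, true_and] at he ⊢
      exact Or.inr (Or.inr he))) (by norm_num)
  have hQ0 : ∀ y, 0 ≤ Q y := fun y => Finset.sum_nonneg fun _ _ => reward_nonneg _
  have hQ1 : ∀ y, Q y ≤ 8 * K := fun y => by
    have := Finset.sum_le_card_nsmul (Finset.univ.filter fun c' : Chain B K => (c'.1 : ℕ) = c.1 + 1)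
      (fun c' => reward (y c')) 8 (fun _ _ => reward_le _)
    have h2 : ((Finset.univ.filter fun c' : Chain B K => (c'.1 : ℕ) = c.1 + 1).card : ℝ) ≤ K := by
      exact_mod_cast card_block_le _
    rw [nsmul_eq_mul] at this
    linarith
  have h3 : |stepDeriv (y c) * P y * Q y - stepDeriv (y' c) * P y' * Q y'| ≤
      (8 + 160 * K) * Sn := by
    have hSP := abs_mul_sub_mul_le (a := stepDeriv (y c)) (a' := stepDeriv (y' c)) (b := P y)
      (b' := P y') (A := 2) (C := 1)
      (by rw [abs_of_nonneg (stepDeriv_nonneg _)]; exact stepDeriv_le_two _)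
      (by rw [abs_of_nonneg (hP0 _)]; exact hP1 _)
    have hS := abs_stepDeriv_sub_le (y c) (y' c)
    change _ ≤ 16 * u c at hS
    have hSP' : |stepDeriv (y c) * P y - stepDeriv (y' c) * P y'| ≤ 20 * Sn := by linarith
    have := abs_mul_sub_mul_le (a := stepDeriv (y c) * P y) (a' := stepDeriv (y' c) * P y')
      (b := Q y) (b' := Q y') (A := 2) (C := 8 * K)
      (by
        rw [abs_of_nonneg (mul_nonneg (stepDeriv_nonneg _) (hP0 _))]
        calc stepDeriv (y c) * P y ≤ 2 * 1 :=
              mul_le_mul (stepDeriv_le_two _) (hP1 _) (hP0 _) (by norm_num)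
          _ = 2 := by norm_num)
      (by rw [abs_of_nonneg (hQ0 _)]; exact hQ1 _)
    have h5 := mul_le_mul_of_nonneg_left hSP' (show (0 : ℝ) ≤ 8 * K by positivity)
    nlinarith
  have e : chainGrad y c - chainGrad y' c =
      -(2 * max (-y c) 0 - 2 * max (-y' c) 0) -
      (gate c.1 y * rewardDeriv (y c) - gate c.1 y' * rewardDeriv (y' c)) -
      (stepDeriv (y c) * P y * Q y - stepDeriv (y' c) * P y' * Q y') := by
    simp only [chainGrad, hP, hQ]; ring
  rw [e]
  have h4 := abs_le.1 h1
  have h5 := abs_le.1 h2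
  have h6 := abs_le.1 h3
  have h7 : Sn ≤ K * Sn := le_mul_of_one_le_left hSn0 hK
  rw [abs_le]
  constructor <;> nlinarith

/-- The gradient of the chain function is `768 K²`-Lipschitz. -/
theorem sum_chainGrad_sub_sq_le (y y' : Chain B K → ℝ) :
    ∑ c, (chainGrad y c - chainGrad y' c) ^ 2 ≤ (768 * K ^ 2) ^ 2 * ∑ c, (y c - y' c) ^ 2 := by
  classical
  have h1 : ∀ c, (chainGrad y c - chainGrad y' c) ^ 2 ≤
      (256 * K) ^ 2 * (3 * K) * ∑ e ∈ nearby c, (y e - y' e) ^ 2 := by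
    intro c
    have h := abs_chainGrad_sub_le y y' c
    have hcs := sq_sum_le_card_mul_sum_sq (s := nearby c) (f := fun e => |y e - y' e|)
    simp only [sq_abs] at hcs
    have hcard : ((nearby c).card : ℝ) ≤ 3 * K := by exact_mod_cast card_nearby_le c
    have hs : 0 ≤ ∑ e ∈ nearby c, (y e - y' e) ^ 2 := Finset.sum_nonneg fun _ _ => sq_nonneg _
    calc (chainGrad y c - chainGrad y' c) ^ 2 = |chainGrad y c - chainGrad y' c| ^ 2 :=
          (sq_abs _).symm
      _ ≤ (256 * K * ∑ e ∈ nearby c, |y e - y' e|) ^ 2 := pow_le_pow_left₀ (abs_nonneg _) h 2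
      _ = (256 * K) ^ 2 * (∑ e ∈ nearby c, |y e - y' e|) ^ 2 := by ring
      _ ≤ (256 * K) ^ 2 * (3 * K * ∑ e ∈ nearby c, (y e - y' e) ^ 2) :=
          mul_le_mul_of_nonneg_left (hcs.trans (mul_le_mul_of_nonneg_right hcard hs)) (sq_nonneg _)
      _ = _ := by ring
  refine (Finset.sum_le_sum fun c _ => h1 c).trans ?_
  rw [← Finset.mul_sum]
  have h2 : ∑ c : Chain B K, ∑ e ∈ nearby c, (y e - y' e) ^ 2 ≤
      3 * K * ∑ e, (y e - y' e) ^ 2 := by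
    rw [Finset.sum_comm' (t' := Finset.univ) (s' := fun e => nearby e)
      (by intro c e; simp [mem_nearby_comm]), Finset.mul_sum]
    refine Finset.sum_le_sum fun e _ => ?_
    rw [Finset.sum_const, nsmul_eq_mul]
    exact mul_le_mul_of_nonneg_right (by exact_mod_cast card_nearby_le e) (sq_nonneg _)
  calc _ ≤ (256 * (K : ℝ)) ^ 2 * (3 * K) * (3 * K * ∑ e, (y e - y' e) ^ 2) :=
        mul_le_mul_of_nonneg_left h2 (by positivity)
    _ = _ := by ring

end ChainFunction

/-! ### The hard function -/

section HardFunction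

variable {B K d : ℕ}

/-- The coordinates of `x` at the positions `π c` of the chain, on the scale `lam`. -/
def coords (π : Chain B K ↪ Fin d) (lam : ℝ) (x : Vec d) : Chain B K → ℝ := fun c => x (π c) / lam

/-- The vector with entries `v c` at the positions `π c`. -/
def spread (π : Chain B K ↪ Fin d) (v : Chain B K → ℝ) : Vec d :=
  ∑ c, EuclideanSpace.single (π c) (v c)

theorem spread_apply (π : Chain B K ↪ Fin d) (v : Chain B K → ℝ) (c : Chain B K) :
    spread π v (π c) = v c := by
  simp only [spread, WithLp.ofLp_sum, Finset.sum_apply, PiLp.single_apply, π.injective.eq_iff]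
  simp

theorem spread_ne_zero {π : Chain B K ↪ Fin d} {v : Chain B K → ℝ} {i : Fin d}
    (h : spread π v i ≠ 0) : ∃ c, π c = i ∧ v c ≠ 0 := by
  by_contra! hc
  refine h ?_
  simp only [spread, WithLp.ofLp_sum, Finset.sum_apply, PiLp.single_apply]
  refine Finset.sum_eq_zero fun c _ => ?_
  split_ifs with e
  · exact hc c e.symm
  · rfl

theorem spread_sub (π : Chain B K ↪ Fin d) (v w : Chain B K → ℝ) :
    spread π v - spread π w = spread π (v - w) := by
  simp only [spread, ← Finset.sum_sub_distrib]
  refine Finset.sum_congr rfl fun c _ => ?_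
  ext i
  simp only [PiLp.sub_apply, PiLp.single_apply, Pi.sub_apply]
  split_ifs <;> simp

theorem norm_spread_sq (π : Chain B K ↪ Fin d) (v : Chain B K → ℝ) :
    ‖spread π v‖ ^ 2 = ∑ c, v c ^ 2 := by
  classical
  rw [EuclideanSpace.norm_sq_eq]
  simp only [Real.norm_eq_abs, sq_abs]
  have h0 : ∀ i ∉ Finset.univ.map π, spread π v i ^ 2 = 0 := by
    intro i hi
    by_contra hne
    obtain ⟨c, hc, -⟩ := spread_ne_zero (fun h => hne (by rw [h]; ring))
    exact hi (by simp [← hc])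
  rw [← Finset.sum_subset (Finset.subset_univ (Finset.univ.map π)) fun i _ hi => h0 i hi,
    Finset.sum_map]
  exact Finset.sum_congr rfl fun c _ => by rw [spread_apply]

theorem sum_coords_sq_le (π : Chain B K ↪ Fin d) (x : Vec d) : ∑ c, x (π c) ^ 2 ≤ ‖x‖ ^ 2 := by
  classical
  rw [EuclideanSpace.norm_sq_eq]
  simp only [Real.norm_eq_abs, sq_abs]
  rw [← Finset.sum_map Finset.univ π fun i => x i ^ 2]
  exact Finset.sum_le_sum_of_subset_of_nonneg (Finset.subset_univ _) fun _ _ _ => sq_nonneg _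

/-- The hard function: the chain function on the scale `lam`, with gradients on the scale `s`. -/
def hardFun (π : Chain B K ↪ Fin d) (s lam : ℝ) (x : Vec d) : ℝ :=
  s * lam * chainFun (coords π lam x)

/-- The gradient of `hardFun`. -/
def hardGrad (π : Chain B K ↪ Fin d) (s lam : ℝ) (x : Vec d) : Vec d :=
  spread π fun c => s * chainGrad (coords π lam x) c

theorem hasGradientAt_hardFun (π : Chain B K ↪ Fin d) (s : ℝ) {lam : ℝ} (hlam : lam ≠ 0)
    (x : Vec d) : HasGradientAt (hardFun π s lam) (hardGrad π s lam x) x := by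
  rw [hasGradientAt_iff_hasFDerivAt]
  have h1 : HasFDerivAt (coords π lam) (ContinuousLinearMap.pi fun c =>
      (lam⁻¹ : ℝ) • (EuclideanSpace.proj (π c) : Vec d →L[ℝ] ℝ)) x := by
    rw [hasFDerivAt_pi']
    intro c
    have h2 : HasFDerivAt (fun x : Vec d => x (π c))
      (EuclideanSpace.proj (π c) : Vec d →L[ℝ] ℝ) x :=
      (EuclideanSpace.proj (π c) : Vec d →L[ℝ] ℝ).hasFDerivAt
    have h3 := h2.const_mul lam⁻¹
    refine (h3.congr_of_eventuallyEq (Filter.Eventually.of_forall fun y => ?_)).congr_fderiv ?_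
    · simp [coords, div_eq_inv_mul]
    · ext v; simp
  have h2 := ((hasFDerivAt_chainFun (coords π lam x)).comp x h1).const_mul (s * lam)
  refine h2.congr_fderiv (ContinuousLinearMap.ext fun v => ?_)
  simp only [smul_apply, ContinuousLinearMap.comp_apply, sum_apply, ContinuousLinearMap.proj_apply,
    ContinuousLinearMap.pi_apply, smul_eq_mul, InnerProductSpace.toDual_apply_apply, hardGrad,
    spread, sum_inner, EuclideanSpace.inner_single_left, Finset.mul_sum]
  refine Finset.sum_congr rfl fun c _ => ?_
  simp
  field_simp

theorem gradient_hardFun (π : Chain B K ↪ Fin d) (s : ℝ) {lam : ℝ} (hlam : lam ≠ 0) (x : Vec d) :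
    gradient (hardFun π s lam) x = hardGrad π s lam x :=
  (hasGradientAt_hardFun π s hlam x).gradient

theorem norm_hardGrad_sub_le (π : Chain B K ↪ Fin d) {s lam : ℝ} (hs : 0 ≤ s) (hlam : 0 < lam)
    (x x' : Vec d) :
    ‖hardGrad π s lam x - hardGrad π s lam x'‖ ≤ s * (768 * K ^ 2) / lam * ‖x - x'‖ := by
  refine abs_le_of_sq_le_sq' ?_ (by positivity) |>.2
  rw [hardGrad, hardGrad, spread_sub, norm_spread_sq]
  have h1 := sum_chainGrad_sub_sq_le (coords π lam x) (coords π lam x')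
  have h2 : ∑ c, (coords π lam x c - coords π lam x' c) ^ 2 ≤ ‖x - x'‖ ^ 2 / lam ^ 2 := by
    have := sum_coords_sq_le π (x - x')
    rw [le_div_iff₀ (by positivity), Finset.sum_mul]
    refine le_trans (le_of_eq (Finset.sum_congr rfl fun c _ => ?_)) this
    simp only [coords, PiLp.sub_apply]
    field_simp
  calc ∑ c, (((fun c => s * chainGrad (coords π lam x) c) -
        fun c => s * chainGrad (coords π lam x') c) c) ^ 2
      = s ^ 2 * ∑ c, (chainGrad (coords π lam x) c - chainGrad (coords π lam x') c) ^ 2 := by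
        rw [Finset.mul_sum]
        exact Finset.sum_congr rfl fun c _ => by simp only [Pi.sub_apply]; ring
    _ ≤ s ^ 2 * ((768 * K ^ 2) ^ 2 * (‖x - x'‖ ^ 2 / lam ^ 2)) := by gcongr; exact h1.trans (by gcongr)
    _ = _ := by field_simp

theorem smoothClass_hardFun (π : Chain B K ↪ Fin d) {s lam L Δ : ℝ} (hs : 0 < s) (hlam : 0 < lam)
    (hL : s * (768 * K ^ 2) / lam ≤ L) (hΔ : s * lam * (8 * (B * K)) ≤ Δ) :
    SmoothClass L Δ (hardFun π s lam) := by
  have hlb : ∀ x, -(s * lam * (8 * (B * K : ℝ))) ≤ hardFun π s lam x := fun x => by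
    have := mul_le_mul_of_nonneg_left (le_chainFun (coords π lam x)) (mul_pos hs hlam).le
    unfold hardFun
    linarith
  refine ⟨fun x => (hasGradientAt_hardFun π s hlam.ne' x).hasFDerivAt.differentiableAt,
    fun x y => ?_, ⟨_, by rintro _ ⟨x, rfl⟩; exact hlb x⟩, ?_⟩
  · rw [gradient_hardFun π s hlam.ne', gradient_hardFun π s hlam.ne']
    exact (norm_hardGrad_sub_le π hs.le hlam x y).trans
      (mul_le_mul_of_nonneg_right hL (norm_nonneg _))
  · have h0 : hardFun π s lam 0 ≤ 0 := by
      have : coords π lam (0 : Vec d) = 0 := by ext c; simp [coords]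
      rw [hardFun, this]
      exact mul_nonpos_of_nonneg_of_nonpos (mul_pos hs hlam).le chainFun_zero_nonpos
    have := le_ciInf hlb
    linarith

/-- The gradient is large at all points that miss a coordinate of the chain. -/
theorem le_norm_hardGrad_sq (π : Chain B K ↪ Fin d) (s lam : ℝ) {x : Vec d} {c : Chain B K}
    (h : x (π c) = 0) : 4 * s ^ 2 ≤ ‖hardGrad π s lam x‖ ^ 2 := by
  obtain ⟨e, he⟩ := exists_chainGrad_le (y := coords π lam x) ⟨c, by simp [coords, h]⟩
  rw [hardGrad, norm_spread_sq]
  calc 4 * s ^ 2 ≤ (s * chainGrad (coords π lam x) e) ^ 2 := by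
        rw [mul_pow, mul_comm]
        exact mul_le_mul_of_nonneg_left (by nlinarith) (sq_nonneg s)
    _ ≤ _ := Finset.single_le_sum (f := fun c => (s * chainGrad (coords π lam x) c) ^ 2)
        (fun _ _ => sq_nonneg _) (Finset.mem_univ e)

/-! ### The oracle -/

/-- A biased coin. -/
def coin (p : unitInterval) : Measure Bool :=
  ENNReal.ofReal p • Measure.dirac true + ENNReal.ofReal (1 - p) • Measure.dirac false

instance (p : unitInterval) : IsProbabilityMeasure (coin p) := ⟨by
  simp only [coin, Measure.coe_add, Measure.coe_smul, Pi.add_apply, Pi.smul_apply, measure_univ,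
    smul_eq_mul, mul_one]
  rw [← ENNReal.ofReal_add p.2.1 (by linarith [p.2.2])]
  simp⟩

theorem coin_true (p : unitInterval) : coin p {true} = ENNReal.ofReal p := by
  simp [coin]

theorem integral_coin (p : unitInterval) (f : Bool → ℝ) :
    ∫ v, f v ∂(coin p) = p * f true + (1 - p) * f false := by
  rw [coin, integral_add_measure (Integrable.of_finite.smul_measure ENNReal.ofReal_ne_top)
    (Integrable.of_finite.smul_measure ENNReal.ofReal_ne_top),
    integral_smul_measure, integral_smul_measure, integral_dirac, integral_dirac,
    ENNReal.toReal_ofReal p.2.1, ENNReal.toReal_ofReal (by linarith [p.2.2])]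
  rfl

/-- Independent biased coins, one for each index of the chain. -/
def coins (B K : ℕ) (p : unitInterval) : Measure (Chain B K → Bool) :=
  Measure.infinitePi fun _ => coin p

instance (p : unitInterval) : IsProbabilityMeasure (coins B K p) := by
  unfold coins; infer_instance

theorem integral_coins_eval (p : unitInterval) (c : Chain B K) (f : Bool → ℝ) :
    ∫ ξ, f (ξ c) ∂(coins B K p) = p * f true + (1 - p) * f false := by
  have h := integral_map (μ := coins B K p) (measurable_pi_apply c).aemeasurable
    (measurable_of_finite f).aestronglyMeasurable
  rw [← h, coins, Measure.infinitePi_map_eval (fun _ : Chain B K => coin p) c, integral_coin]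

/-- The coordinate `c` is unknown, and no block from its own on is completely known. If its gate is
open, then its block is the one after the last completely known block. -/
def Frontier (y : Chain B K → ℝ) (c : Chain B K) : Prop :=
  y c = 0 ∧ ∀ c' : Chain B K, (c.1 : ℕ) ≤ c'.1 → ¬ ∀ e : Chain B K, (e.1 : ℕ) = c'.1 → y e ≠ 0

open scoped Classical in
/-- The factor with which the partial derivative of index `c` is reported. -/
def noise (p : ℝ) (y : Chain B K → ℝ) (ξ : Chain B K → Bool) (c : Chain B K) : ℝ :=
  if Frontier y c then (if ξ c then 1 / p else 0) else 1

/-- The stochastic gradient: the partial derivatives at the frontier are revealed only with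
probability `p`, by the coin of the index. -/
def hardOracle (π : Chain B K ↪ Fin d) (s lam p : ℝ) (x : Vec d) (ξ : Chain B K → Bool) : Vec d :=
  spread π fun c => s * chainGrad (coords π lam x) c * noise p (coords π lam x) ξ c

theorem chainGrad_ne_zero {y : Chain B K → ℝ} {c : Chain B K} (h : chainGrad y c ≠ 0) :
    y c ≠ 0 ∨ ∀ e : Chain B K, (e.1 : ℕ) + 1 = c.1 → y e ≠ 0 := by
  by_contra! hc
  obtain ⟨h0, e, he, hy⟩ := hc
  exact h (by rw [chainGrad_of_eq_zero h0, gate_eq_zero he hy]; simp)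

/-- A stochastic gradient contains a new coordinate only if the preceding block is known, and its
coin has come up or a later block is known. -/
theorem hardOracle_ne_zero {π : Chain B K ↪ Fin d} {s lam p : ℝ} {x : Vec d}
    {ξ : Chain B K → Bool} {i : Fin d} (h : hardOracle π s lam p x ξ i ≠ 0) :
    ∃ c, π c = i ∧ (x i ≠ 0 ∨ (∀ e : Chain B K, (e.1 : ℕ) + 1 = c.1 → x (π e) ≠ 0) ∧
      (ξ c = true ∨ ∃ c' : Chain B K, (c.1 : ℕ) ≤ c'.1 ∧
        ∀ e : Chain B K, (e.1 : ℕ) = c'.1 → x (π e) ≠ 0)) := by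
  obtain ⟨c, rfl, hc⟩ := spread_ne_zero h
  have hy : ∀ e, coords π lam x e ≠ 0 → x (π e) ≠ 0 := fun e h h0 => h (by simp [coords, h0])
  refine ⟨c, rfl, ?_⟩
  by_cases hx : x (π c) = 0
  · right
    have h0 : coords π lam x c = 0 := by simp [coords, hx]
    have hg : chainGrad (coords π lam x) c ≠ 0 := fun h => hc (by simp [h])
    refine ⟨fun e he => hy e (((chainGrad_ne_zero hg).resolve_left (by simpa using h0)) e he), ?_⟩
    by_contra! hn
    refine hc ?_
    have : Frontier (coords π lam x) c := by
      refine ⟨h0, fun c' hc' hfull => ?_⟩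
      obtain ⟨e, he, he0⟩ := hn.2 c' hc'
      exact hy e (hfull e he) he0
    simp [noise, this, hn.1]
  · exact Or.inl hx

/-- If only blocks before `u` are known, then the coordinates and coins of index `c` in a block
after `u` have no influence. -/
theorem hardOracle_congr {π π' : Chain B K ↪ Fin d} {s lam p : ℝ} {x : Vec d}
    {ξ ξ' : Chain B K → Bool} {u : ℕ} (hx : ∀ i, x i ≠ 0 → ∃ e, π e = i ∧ (e.1 : ℕ) < u)
    (hπ : ∀ e : Chain B K, (e.1 : ℕ) ≤ u → π e = π' e)
    (hξ : ∀ e : Chain B K, (e.1 : ℕ) ≤ u → ξ e = ξ' e) :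
    hardOracle π s lam p x ξ = hardOracle π' s lam p x ξ' := by
  have h0 : ∀ e : Chain B K, u ≤ e.1 → x (π e) = 0 := by
    intro e he
    by_contra hne
    obtain ⟨e', h1, h2⟩ := hx _ hne
    rw [π.injective h1] at h2
    omega
  have h0' : ∀ e : Chain B K, u ≤ e.1 → x (π' e) = 0 := by
    intro e he
    by_contra hne
    obtain ⟨e', h1, h2⟩ := hx _ hne
    rw [hπ e' h2.le] at h1
    rw [π'.injective h1] at h2
    omega
  have hy : coords π lam x = coords π' lam x := by
    funext e
    rcases lt_or_ge (e.1 : ℕ) u with h | h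
    · simp [coords, hπ e h.le]
    · simp [coords, h0 e h, h0' e h]
  unfold hardOracle spread
  rw [← hy]
  refine Finset.sum_congr rfl fun c _ => ?_
  rcases le_or_gt (c.1 : ℕ) u with h | h
  · rw [hπ c h]
    simp [noise, hξ c h]
  · have hg : chainGrad (coords π lam x) c = 0 := by
      rw [chainGrad_of_eq_zero (by simp [coords, h0 c h.le]),
        gate_eq_zero (e := (⟨(c.1 : ℕ) - 1, by omega⟩, c.2))
          (by simp; omega) (by
            have := h0 (⟨(c.1 : ℕ) - 1, by omega⟩, c.2) (by simp; omega)
            simp [coords, this])]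
      simp
    simp only [hg, mul_zero, zero_mul]
    ext i
    simp [PiLp.single_apply]

theorem continuous_stepDeriv : Continuous stepDeriv := by unfold stepDeriv; fun_prop

theorem continuous_step : Continuous step :=
  continuous_iff_continuousAt.2 fun x => (hasDerivAt_step x).continuousAt

theorem continuous_reward : Continuous reward :=
  continuous_iff_continuousAt.2 fun x => (hasDerivAt_reward x).continuousAt

theorem continuous_chainGrad (c : Chain B K) : Continuous fun y => chainGrad y c := by
  have h1 := continuous_stepDeriv
  have h2 := continuous_step
  have h3 := continuous_reward
  unfold chainGrad gate rewardDeriv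
  fun_prop

theorem measurableSet_frontier (c : Chain B K) : MeasurableSet {y | Frontier y c} := by
  have h : ∀ e : Chain B K, MeasurableSet {y : Chain B K → ℝ | y e = 0} := fun e =>
    (measurableSet_singleton (0 : ℝ)).preimage (measurable_pi_apply e)
  have e : {y | Frontier y c} = {y : Chain B K → ℝ | y c = 0} ∩
      ⋂ c' : Chain B K, ⋂ (_ : (c.1 : ℕ) ≤ c'.1),
        (⋂ e : Chain B K, ⋂ (_ : (e.1 : ℕ) = c'.1), {y | y e = 0}ᶜ)ᶜ := by
    ext y
    simp [Frontier]
  rw [e]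
  exact (h c).inter (MeasurableSet.iInter fun c' => MeasurableSet.iInter fun _ =>
    (MeasurableSet.iInter fun e => MeasurableSet.iInter fun _ => (h e).compl).compl)

theorem measurable_coords (π : Chain B K ↪ Fin d) (lam : ℝ) : Measurable (coords π lam) := by
  unfold coords; fun_prop

theorem measurable_single (c : Fin d) :
    Measurable fun v : ℝ => (EuclideanSpace.single c v : Vec d) := by
  refine (WithLp.measurable_toLp 2 (Fin d → ℝ)).comp (measurable_pi_iff.2 fun i => ?_)
  by_cases h : i = c
  · subst h; simpa using measurable_id'
  · simp [h]

theorem measurable_hardOracle (π : Chain B K ↪ Fin d) (s lam p : ℝ) :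
    Measurable (Function.uncurry (hardOracle π s lam p)) := by
  refine measurable_from_prod_countable_left fun ξ => ?_
  unfold Function.uncurry hardOracle spread
  refine Finset.measurable_sum _ fun c _ => ?_
  have h1 : Measurable fun x : Vec d => noise p (coords π lam x) ξ c := by
    unfold noise
    exact Measurable.ite ((measurableSet_frontier c).preimage (measurable_coords π lam))
      measurable_const measurable_const
  have h2 : Measurable fun x : Vec d => chainGrad (coords π lam x) c :=
    (continuous_chainGrad c).measurable.comp (measurable_coords π lam)
  exact (measurable_single (π c)).comp ((measurable_const.mul h2).mul h1)

theorem integral_noise (p : unitInterval) (hp : 0 < (p : ℝ)) (y : Chain B K → ℝ) (c : Chain B K) :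
    ∫ ξ, noise p y ξ c ∂(coins B K p) = 1 := by
  unfold noise
  split_ifs
  · rw [integral_coins_eval p c fun v => if v then 1 / (p : ℝ) else 0]
    simp [hp.ne']
  · simp

open scoped Classical in
theorem integral_noise_sub_one_sq (p : unitInterval) (hp : 0 < (p : ℝ)) (y : Chain B K → ℝ)
    (c : Chain B K) :
    ∫ ξ, (noise p y ξ c - 1) ^ 2 ∂(coins B K p) = if Frontier y c then (1 - p) / (p : ℝ) else 0 := by
  unfold noise
  split_ifs
  · rw [integral_coins_eval p c fun v => ((if v then 1 / (p : ℝ) else 0) - 1) ^ 2]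
    simp
    field_simp
    ring
  · simp

open scoped Classical in
theorem card_frontier_le (y : Chain B K → ℝ) :
    (Finset.univ.filter fun c => Frontier y c ∧ chainGrad y c ≠ 0).card ≤ K := by
  rcases (Finset.univ.filter fun c => Frontier y c ∧ chainGrad y c ≠ 0).eq_empty_or_nonempty with
    h | ⟨c, hc⟩
  · rw [h]; simp
  · refine le_trans (Finset.card_le_card ?_) (card_block_le (B := B) (K := K) c.1)
    -- two indices of this kind in different blocks: the gate of the later one shows that the block
    -- before it is known, which contradicts that the earlier one is at the frontier
    have key : ∀ c c' : Chain B K, Frontier y c → Frontier y c' → chainGrad y c' ≠ 0 →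
        ¬ (c.1 : ℕ) < c'.1 := by
      intro c c' hc hc' hg hlt
      have := (chainGrad_ne_zero hg).resolve_left (by simpa using hc'.1)
      refine hc.2 (⟨(c'.1 : ℕ) - 1, by omega⟩, c.2) (by simp; omega) fun e he => this e ?_
      simp at he
      omega
    intro c' hc'
    simp only [Finset.mem_filter, Finset.mem_univ, true_and] at hc hc' ⊢
    have h1 := key c c' hc.1 hc'.1 hc'.2
    have h2 := key c' c hc'.1 hc.1 hc.2
    omega

theorem isOracle_hardOracle (π : Chain B K ↪ Fin d) {s lam σsq : ℝ} (hlam : lam ≠ 0)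
    (p : unitInterval) (hp : 0 < (p : ℝ)) (hσ : 16 * K * s ^ 2 * ((1 - p) / p) ≤ σsq) :
    IsOracle (coins B K p) (hardOracle π s lam p) (hardFun π s lam) σsq := by
  classical
  refine ⟨measurable_hardOracle π s lam p, fun x => ⟨Integrable.of_finite, ?_,
    Integrable.of_finite, ?_⟩⟩
  · rw [gradient_hardFun π s hlam]
    unfold hardOracle hardGrad spread
    rw [integral_finsetSum _ fun c _ => Integrable.of_finite]
    refine Finset.sum_congr rfl fun c _ => ?_
    have : ∀ ξ, EuclideanSpace.single (π c) (s * chainGrad (coords π lam x) c *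
        noise p (coords π lam x) ξ c) = noise p (coords π lam x) ξ c •
          (EuclideanSpace.single (π c) (s * chainGrad (coords π lam x) c) : Vec d) := by
      intro ξ
      ext i
      simp only [PiLp.single_apply, PiLp.smul_apply, smul_eq_mul]
      split_ifs <;> ring
    simp_rw [this]
    rw [integral_smul_const, integral_noise p hp, one_smul]
  · rw [gradient_hardFun π s hlam]
    have : ∀ ξ, ‖hardOracle π s lam p x ξ - hardGrad π s lam x‖ ^ 2 =
        ∑ c, (s * chainGrad (coords π lam x) c) ^ 2 * (noise p (coords π lam x) ξ c - 1) ^ 2 := by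
      intro ξ
      rw [hardOracle, hardGrad, spread_sub, norm_spread_sq]
      exact Finset.sum_congr rfl fun c _ => by simp only [Pi.sub_apply]; ring
    simp_rw [this]
    rw [integral_finsetSum _ fun c _ => Integrable.of_finite]
    simp_rw [integral_const_mul, integral_noise_sub_one_sq p hp]
    refine le_trans ?_ hσ
    have hp1 : 0 ≤ (1 - p) / (p : ℝ) := div_nonneg (by linarith [p.2.2]) hp.le
    set y := coords π lam x
    have hterm : ∀ c, (s * chainGrad y c) ^ 2 * (if Frontier y c then (1 - p) / (p : ℝ) else 0) ≤
        if Frontier y c ∧ chainGrad y c ≠ 0 then 16 * s ^ 2 * ((1 - p) / (p : ℝ)) else 0 := by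
      intro c
      by_cases hF : Frontier y c
      · by_cases hg : chainGrad y c = 0
        · simp [hg]
        · rw [if_pos hF, if_pos ⟨hF, hg⟩]
          refine mul_le_mul_of_nonneg_right ?_ hp1
          rw [chainGrad_of_eq_zero hF.1]
          have h1 := gate_nonneg c.1 y
          have h2 := gate_le_one c.1 y
          have h3 : gate c.1 y ^ 2 ≤ 1 := pow_le_one₀ h1 h2
          nlinarith [sq_nonneg s]
      · simp [hF]
    refine (Finset.sum_le_sum fun c _ => hterm c).trans ?_
    rw [← Finset.sum_filter, Finset.sum_const, nsmul_eq_mul]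
    have hc : ((Finset.univ.filter fun c => Frontier y c ∧ chainGrad y c ≠ 0).card : ℝ) ≤ K := by
      exact_mod_cast card_frontier_le y
    calc _ ≤ (K : ℝ) * (16 * s ^ 2 * ((1 - p) / (p : ℝ))) :=
          mul_le_mul_of_nonneg_right hc (by positivity)
      _ = _ := by ring

end HardFunction

/-! ### Measurability of the local information -/

section Measurability

variable {n d : ℕ} {N : Network n} {Z : Type*} [MeasurableSpace Z] {Ξ : Type*}
  (A : Algorithm N d Z) {g : Vec d → Ξ → Vec d}

/-- The contents of the messages, computed by recursion of depth `q`. -/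
def contentApprox (g : Vec d → Ξ → Vec d) (z : Z) (ξ : Fin n × ℕ → Ξ) : ℕ → Fin n → ℕ → Vec d
  | 0 => 0
  | q + 1 => fun i k => (A.plan z).decode i k (A.message i k (z,
      A.infoOf g z ξ (contentApprox g z ξ q) i ((A.plan z).sendTime i k)))

theorem Network.totalBw_nonneg (N : Network n) : 0 ≤ N.totalBw :=
  Finset.sum_nonneg fun v _ => Finset.sum_nonneg fun u _ => CommPlan.bw_nonneg N u v

theorem CommPlan.Delivered.floor_lt_floor {P : CommPlan N d} {j : Fin n} {l : ℕ} {t : ℝ}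
    (h : P.Delivered j l t) : ⌊P.sendTime j l * N.totalBw⌋₊ < ⌊t * N.totalBw⌋₊ := by
  have h1 := Nat.floor_le_floor (CommPlan.Delivered.delay P h)
  rw [Nat.floor_add_one (mul_nonneg (P.sendTime_nonneg j l) N.totalBw_nonneg)] at h1
  omega

theorem content_eq_contentApprox (z : Z) (ξ : Fin n × ℕ → Ξ) (q : ℕ) (i : Fin n) (k : ℕ)
    (h : ⌊(A.plan z).sendTime i k * N.totalBw⌋₊ < q) :
    A.content g z ξ i k = contentApprox A g z ξ q i k := by
  induction q generalizing i k with
  | zero => omega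
  | succ q ih =>
    rw [A.content_eq, contentApprox, Algorithm.info,
      A.infoOf_congr g z ξ (M' := contentApprox A g z ξ q)]
    intro j l hd
    have := hd.floor_lt_floor
    exact ih j l (by omega)

variable [MeasurableSpace Ξ]
  {Ω : Type*} [MeasurableSpace Ω] {z : Ω → Z} {ξ : Ω → Fin n × ℕ → Ξ}
  {M : Ω → Fin n → ℕ → Vec d} {τ : Ω → ℝ}

theorem measurable_comp_nat {E : Type*} [MeasurableSpace E] {q : Ω → ℕ} (hq : Measurable q)
    {G : ℕ → Ω → E} (hG : ∀ m, Measurable (G m)) : Measurable fun ω => G (q ω) ω := by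
  have : Measurable fun a : ℕ × Ω => G a.1 a.2 := measurable_from_prod_countable_right fun m => hG m
  exact this.comp (hq.prodMk measurable_id)

theorem CommPlan.flow_sub_le (P : CommPlan N d) (i : Fin n) (k : ℕ) (u v : Fin n) {s t : ℝ}
    (h : s ≤ t) : P.flow i k u v t - P.flow i k u v s ≤ N.bw u v * (t - s) := by
  simpa using P.flow_capacity u v s t h {(i, k)}

theorem CommPlan.continuous_flow (P : CommPlan N d) (i : Fin n) (k : ℕ) (u v : Fin n) :
    Continuous (P.flow i k u v) := by
  have h0 := CommPlan.bw_nonneg N u v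
  refine (LipschitzWith.of_dist_le_mul (K := ⟨N.bw u v, h0⟩) fun s t => ?_).continuous
  rw [Real.dist_eq, Real.dist_eq]
  change _ ≤ N.bw u v * _
  rcases le_total s t with h | h
  · rw [abs_sub_comm, abs_of_nonneg (sub_nonneg.2 (P.flow_mono i k u v h)), abs_sub_comm,
      abs_of_nonneg (sub_nonneg.2 h)]
    exact P.flow_sub_le i k u v h
  · rw [abs_of_nonneg (sub_nonneg.2 (P.flow_mono i k u v h)), abs_of_nonneg (sub_nonneg.2 h)]
    exact P.flow_sub_le i k u v h

theorem measurable_flow_comp (hz : Measurable z) (hτ : Measurable τ) (i : Fin n) (k : ℕ)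
    (u v : Fin n) : Measurable fun ω => (A.plan (z ω)).flow i k u v (τ ω) := by
  have h : Measurable (Function.uncurry fun (t : ℝ) (z : Z) => (A.plan z).flow i k u v t) :=
    measurable_uncurry_of_continuous_of_measurable
      (fun z => (A.plan z).continuous_flow i k u v) fun t => A.measurable_flow i k u v t
  exact h.comp (hτ.prodMk hz)

theorem measurableSet_delivered (hz : Measurable z) (hτ : Measurable τ) (i : Fin n) (k : ℕ)
    (v : Fin n) :
    MeasurableSet {ω | (A.plan (z ω)).dest i k = v ∧ (A.plan (z ω)).Delivered i k (τ ω)} := by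
  have hd : MeasurableSet {ω | (A.plan (z ω)).dest i k = v} :=
    ((A.measurable_dest i k).comp hz) (measurableSet_singleton v)
  have hs : Measurable fun ω => ((A.plan (z ω)).size i k : ℝ) :=
    measurable_from_nat.comp ((A.measurable_size i k).comp hz)
  have hf : MeasurableSet {ω | ((A.plan (z ω)).size i k : ℝ) ≤
      ∑ u, (A.plan (z ω)).flow i k u v (τ ω)} :=
    measurableSet_le hs (Finset.measurable_sum _ fun u _ => measurable_flow_comp A hz hτ i k u v)
  by_cases hv : v = i
  · convert MeasurableSet.empty
    ext ω
    simp only [Set.mem_ofPred_eq, Set.mem_empty_iff_false, iff_false]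
    rintro ⟨h1, h2, -⟩
    exact h2 (h1.trans hv)
  · convert hd.inter hf using 1
    ext ω
    simp only [Set.mem_ofPred_eq, Set.mem_inter_iff, CommPlan.Delivered]
    constructor
    · rintro ⟨rfl, -, h⟩; exact ⟨rfl, h⟩
    · rintro ⟨rfl, h⟩; exact ⟨rfl, hv, h⟩

theorem measurable_received (hz : Measurable z) (hM : Measurable M) (hτ : Measurable τ)
    (i : Fin n) : Measurable fun ω => A.received (z ω) (M ω) i (τ ω) := by
  refine measurable_pi_iff.2 fun j => measurable_pi_iff.2 fun k => ?_
  unfold Algorithm.received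
  refine Measurable.ite (measurableSet_delivered A hz hτ j k i) ?_ measurable_const
  exact measurable_pi_iff.1 (measurable_pi_iff.1 hM j) k

theorem measurable_update_comp {f : Ω → ℕ → Vec d} (hf : Measurable f) {v : Ω → Vec d}
    (hv : Measurable v) (m : ℕ) : Measurable fun ω => Function.update (f ω) m (v ω) := by
  refine measurable_pi_iff.2 fun l => ?_
  by_cases h : l = m
  · subst h; simpa using hv
  · simpa [h] using measurable_pi_iff.1 hf l

theorem measurable_loopState (hg : Measurable (Function.uncurry g)) (hz : Measurable z)
    (hξ : Measurable ξ) (hM : Measurable M) (i : Fin n) (m : ℕ) :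
    Measurable fun ω => A.loopState g (z ω) (ξ ω) (M ω) i m := by
  induction m with
  | zero => exact measurable_const
  | succ m ih =>
    have ha : Measurable fun ω => (z ω, (A.loopState g (z ω) (ξ ω) (M ω) i m).1,
        ((A.loopState g (z ω) (ξ ω) (M ω) i m).2,
          A.received (z ω) (M ω) i (A.loopState g (z ω) (ξ ω) (M ω) i m).1)) :=
      hz.prodMk (ih.fst.prodMk (ih.snd.prodMk (measurable_received A hz hM ih.fst i)))
    simp only [Algorithm.loopState]
    refine Measurable.ite ?_ ?_ ?_
    · exact ((A.measurable_compute i m).comp ha) (measurableSet_singleton true)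
    · refine (ih.fst.add_const _).prodMk (measurable_update_comp ih.snd ?_ m)
      exact hg.comp (((A.measurable_query i m).comp ha).prodMk (measurable_pi_iff.1 hξ (i, m)))
    · exact (ih.fst.add ((A.measurable_pause i m).comp ha)).prodMk ih.snd

theorem measurable_infoOf (hg : Measurable (Function.uncurry g)) (hz : Measurable z)
    (hξ : Measurable ξ) (hM : Measurable M) (hτ : Measurable τ) (i : Fin n) :
    Measurable fun ω => A.infoOf g (z ω) (ξ ω) (M ω) i (τ ω) := by
  unfold Algorithm.infoOf
  refine Measurable.prodMk (measurable_pi_iff.2 fun m => ?_) (measurable_received A hz hM hτ i)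
  have h := measurable_loopState A hg hz hξ hM i (m + 1)
  exact Measurable.ite (measurableSet_le h.fst hτ) (measurable_pi_iff.1 h.snd m) measurable_const

theorem measurable_decode {s : Ω → Vec d} (hz : Measurable z) (hs : Measurable s) (i : Fin n)
    (k : ℕ) : Measurable fun ω => (A.plan (z ω)).decode i k (s ω) := by
  unfold CommPlan.decode
  refine measurable_comp_nat (q := fun ω => (A.plan (z ω)).size i k)
    (G := fun m ω => ∑ r ∈ Finset.range m, EuclideanSpace.single ((A.plan (z ω)).idx i k r)
      ((A.plan (z ω)).coef i k r * s ω ((A.plan (z ω)).idx i k r)))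
    ((A.measurable_size i k).comp hz) fun m => Finset.measurable_sum _ fun r _ => ?_
  have e : (fun ω => (EuclideanSpace.single ((A.plan (z ω)).idx i k r)
      ((A.plan (z ω)).coef i k r * s ω ((A.plan (z ω)).idx i k r)) : Vec d)) =
      fun ω => ∑ c : Fin d, if (A.plan (z ω)).idx i k r = c then
        (EuclideanSpace.single c ((A.plan (z ω)).coef i k r * s ω c) : Vec d) else 0 := by
    funext ω
    rw [Finset.sum_ite_eq]
    simp
  rw [e]
  refine Finset.measurable_sum _ fun c _ => Measurable.ite ?_ ?_ measurable_const
  · exact ((A.measurable_idx i k r).comp hz) (measurableSet_singleton c)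
  · refine (measurable_single c).comp (((A.measurable_coef i k r).comp hz).mul ?_)
    fun_prop

theorem measurable_contentApprox (hg : Measurable (Function.uncurry g)) (hz : Measurable z)
    (hξ : Measurable ξ) (q : ℕ) : Measurable fun ω => contentApprox A g (z ω) (ξ ω) q := by
  induction q with
  | zero => exact measurable_const
  | succ q ih =>
    refine measurable_pi_iff.2 fun i => measurable_pi_iff.2 fun k => ?_
    simp only [contentApprox]
    exact measurable_decode A hz ((A.measurable_message i k).comp (hz.prodMk
      (measurable_infoOf A hg hz hξ ih ((A.measurable_sendTime i k).comp hz) i))) i k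

theorem measurable_content (hg : Measurable (Function.uncurry g)) (hz : Measurable z)
    (hξ : Measurable ξ) : Measurable fun ω => A.content g (z ω) (ξ ω) := by
  refine measurable_pi_iff.2 fun i => measurable_pi_iff.2 fun k => ?_
  simp_rw [fun ω => content_eq_contentApprox A (g := g) (z ω) (ξ ω)
    (⌊(A.plan (z ω)).sendTime i k * N.totalBw⌋₊ + 1) i k (Nat.lt_succ_self _)]
  refine measurable_comp_nat
    (q := fun ω => ⌊(A.plan (z ω)).sendTime i k * N.totalBw⌋₊ + 1)
    (G := fun q ω => contentApprox A g (z ω) (ξ ω) q i k) ?_ fun q => ?_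
  · exact (Nat.measurable_floor.comp
      (((A.measurable_sendTime i k).comp hz).mul_const _)).add_const 1
  · exact measurable_pi_iff.1 (measurable_pi_iff.1 (measurable_contentApprox A hg hz hξ q) i) k

theorem measurable_info (hg : Measurable (Function.uncurry g)) (hz : Measurable z)
    (hξ : Measurable ξ) (i : Fin n) (t : ℝ) : Measurable fun ω => A.info g (z ω) (ξ ω) i t :=
  measurable_infoOf A hg hz hξ (measurable_content A hg hz hξ) measurable_const i

theorem measurableSet_mem_support (c : Fin d) :
    MeasurableSet {I : LocalInfo n d | c ∈ I.support} := by
  have e : {I : LocalInfo n d | c ∈ I.support} =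
      (⋃ m, {I : LocalInfo n d | I.1 m c = 0}ᶜ) ∪ ⋃ j, ⋃ k, {I : LocalInfo n d | I.2 j k c = 0}ᶜ := by
    ext I
    simp [LocalInfo.support]
  rw [e]
  refine (MeasurableSet.iUnion fun m => MeasurableSet.compl ?_).union
    (MeasurableSet.iUnion fun j => MeasurableSet.iUnion fun k => MeasurableSet.compl ?_)
  · exact measurableSet_eq_fun (by fun_prop) measurable_const
  · exact measurableSet_eq_fun (by fun_prop) measurable_const

theorem measurableSet_mem_info_support (hg : Measurable (Function.uncurry g)) (hz : Measurable z)
    (hξ : Measurable ξ) (i : Fin n) (t : ℝ) (c : Fin d) :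
    MeasurableSet {ω | c ∈ (A.info g (z ω) (ξ ω) i t).support} :=
  measurable_info A hg hz hξ i t (measurableSet_mem_support c)

end Measurability

/-! ### Causality -/

section Causality

variable {n d : ℕ} {N : Network n} {Z : Type*} [MeasurableSpace Z] {Ξ : Type*}

namespace Algorithm

variable (A : Algorithm N d Z) (g g' : Vec d → Ξ → Vec d) (z : Z) (ξ ξ' : Fin n × ℕ → Ξ)

/-- What worker `i` looks at in iteration `m` of its computation loop, when message `(j, k)`
carries `M j k`. -/
def inputOf (M : Fin n → ℕ → Vec d) (i : Fin n) (m : ℕ) : Z × ℝ × LocalInfo n d :=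
  (z, (A.loopState g z ξ M i m).1,
    ((A.loopState g z ξ M i m).2, A.received z M i (A.loopState g z ξ M i m).1))

/-- What worker `i` looks at in iteration `m` of its computation loop. -/
abbrev input (i : Fin n) (m : ℕ) : Z × ℝ × LocalInfo n d := A.inputOf g z ξ (A.content g z ξ) i m

/-- The starting time of iteration `m` of the computation loop of worker `i`. -/
def start (i : Fin n) (m : ℕ) : ℝ := (A.loopState g z ξ (A.content g z ξ) i m).1

/-- Worker `i` computes a stochastic gradient in iteration `m`. -/
def Computes (i : Fin n) (m : ℕ) : Prop := A.compute i m (A.input g z ξ i m) = true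

/-- The point at which worker `i` would compute a stochastic gradient in iteration `m`. -/
def point (i : Fin n) (m : ℕ) : Vec d := A.query i m (A.input g z ξ i m)

variable {g g' z ξ ξ'} {M M' : Fin n → ℕ → Vec d}

theorem loopState_succ_of_compute {i : Fin n} {m : ℕ}
    (h : A.compute i m (A.inputOf g z ξ M i m) = true) :
    A.loopState g z ξ M i (m + 1) = ((A.loopState g z ξ M i m).1 + N.time i,
      Function.update (A.loopState g z ξ M i m).2 m
        (g (A.query i m (A.inputOf g z ξ M i m)) (ξ (i, m)))) := by
  rw [loopState]
  exact if_pos h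

theorem loopState_succ_of_not_compute {i : Fin n} {m : ℕ}
    (h : ¬ A.compute i m (A.inputOf g z ξ M i m) = true) :
    A.loopState g z ξ M i (m + 1) =
      ((A.loopState g z ξ M i m).1 + A.pause i m (A.inputOf g z ξ M i m),
        (A.loopState g z ξ M i m).2) := by
  rw [loopState]
  exact if_neg h

theorem loopState_le_succ (i : Fin n) (m : ℕ) :
    (A.loopState g z ξ M i m).1 ≤ (A.loopState g z ξ M i (m + 1)).1 := by
  by_cases h : A.compute i m (A.inputOf g z ξ M i m) = true
  · rw [A.loopState_succ_of_compute h]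
    exact le_add_of_nonneg_right (N.time_pos i).le
  · rw [A.loopState_succ_of_not_compute h]
    exact le_add_of_nonneg_right (A.pause_nonneg i m _)

theorem monotone_loopState (i : Fin n) : Monotone fun m => (A.loopState g z ξ M i m).1 :=
  monotone_nat_of_le_succ fun m => A.loopState_le_succ i m

theorem monotone_start (i : Fin n) : Monotone (A.start g z ξ i) := A.monotone_loopState i

theorem start_nonneg (i : Fin n) (m : ℕ) : 0 ≤ A.start g z ξ i m :=
  A.monotone_start i (Nat.zero_le m)

theorem start_succ {i : Fin n} {m : ℕ} (h : A.Computes g z ξ i m) :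
    A.start g z ξ i (m + 1) = A.start g z ξ i m + N.time i := by
  rw [start, A.loopState_succ_of_compute h]
  rfl

/-- Two runs (of different worlds) in which the delivered messages are the same, and the stochastic
gradients computed by time `t` are the same, agree up to time `t`. -/
theorem loopState_congr {i : Fin n} {t : ℝ}
    (hrec : ∀ s ≤ t, A.received z M i s = A.received z M' i s)
    (h : ∀ m, A.inputOf g z ξ M i m = A.inputOf g' z ξ' M' i m →
      A.compute i m (A.inputOf g z ξ M i m) = true →
      (A.loopState g z ξ M i m).1 + N.time i ≤ t →
      g (A.query i m (A.inputOf g z ξ M i m)) (ξ (i, m)) =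
        g' (A.query i m (A.inputOf g z ξ M i m)) (ξ' (i, m))) (m : ℕ) :
    A.loopState g z ξ M i m = A.loopState g' z ξ' M' i m ∨
      (t < (A.loopState g z ξ M i m).1 ∧ t < (A.loopState g' z ξ' M' i m).1) := by
  induction m with
  | zero => exact Or.inl rfl
  | succ m ih =>
    rcases ih with e | ⟨h1, h2⟩
    · rcases le_or_gt (A.loopState g z ξ M i m).1 t with ht | ht
      · have ei : A.inputOf g z ξ M i m = A.inputOf g' z ξ' M' i m := by
          unfold inputOf
          rw [← e, hrec _ ht]
        by_cases hc : A.compute i m (A.inputOf g z ξ M i m) = true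
        · rw [A.loopState_succ_of_compute hc, A.loopState_succ_of_compute (ei ▸ hc), ← e, ← ei]
          rcases le_or_gt ((A.loopState g z ξ M i m).1 + N.time i) t with ht' | ht'
          · left; rw [h m ei hc ht']
          · exact Or.inr ⟨ht', ht'⟩
        · left
          rw [A.loopState_succ_of_not_compute hc, A.loopState_succ_of_not_compute (ei ▸ hc), ← e,
            ← ei]
      · exact Or.inr ⟨ht.trans_le (A.loopState_le_succ i m),
          (e ▸ ht).trans_le (A.loopState_le_succ i m)⟩
    · exact Or.inr ⟨h1.trans_le (A.loopState_le_succ i m), h2.trans_le (A.loopState_le_succ i m)⟩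

theorem received_congr {i : Fin n} {t : ℝ}
    (hM : ∀ j l, (A.plan z).Delivered j l t → M j l = M' j l) {s : ℝ} (hs : s ≤ t) :
    A.received z M i s = A.received z M' i s := by
  funext j l
  unfold received
  split_ifs with hd
  · exact hM j l ⟨hd.2.1, hd.2.2.trans
      (Finset.sum_le_sum fun u _ => (A.plan z).flow_mono j l u _ hs)⟩
  · rfl

theorem infoOf_congr_world {i : Fin n} {t : ℝ}
    (hM : ∀ j l, (A.plan z).Delivered j l t → M j l = M' j l)
    (h : ∀ m, A.inputOf g z ξ M i m = A.inputOf g' z ξ' M' i m →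
      A.compute i m (A.inputOf g z ξ M i m) = true →
      (A.loopState g z ξ M i m).1 + N.time i ≤ t →
      g (A.query i m (A.inputOf g z ξ M i m)) (ξ (i, m)) =
        g' (A.query i m (A.inputOf g z ξ M i m)) (ξ' (i, m))) :
    A.infoOf g z ξ M i t = A.infoOf g' z ξ' M' i t := by
  unfold infoOf
  rw [A.received_congr hM le_rfl]
  congr 1
  funext m
  rcases A.loopState_congr (fun s hs => A.received_congr hM hs) h (m + 1) with e | ⟨h1, h2⟩
  · rw [e]
  · rw [if_neg h1.not_ge, if_neg h2.not_ge]

/-- Two worlds are indistinguishable at the times in `Q`, if the computations that are completed at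
times in `Q` have the same results. -/
structure SameUpTo (A : Algorithm N d Z) (g g' : Vec d → Ξ → Vec d) (z : Z)
    (ξ ξ' : Fin n × ℕ → Ξ) (Q : Set ℝ) : Prop where
  isLowerSet : IsLowerSet Q
  result : ∀ i m, A.input g z ξ i m = A.input g' z ξ' i m → A.Computes g z ξ i m →
    A.start g z ξ i m + N.time i ∈ Q →
    g (A.point g z ξ i m) (ξ (i, m)) = g' (A.point g z ξ i m) (ξ' (i, m))

variable {A} {Q : Set ℝ}

theorem _root_.Decentralized.CommPlan.Delivered.sendTime_le {P : CommPlan N d} {j : Fin n} {l : ℕ} {t : ℝ}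
    (h : P.Delivered j l t) : P.sendTime j l ≤ t := by
  by_contra! hlt
  have h0 : ∑ u, P.flow j l u (P.dest j l) t = 0 :=
    Finset.sum_eq_zero fun u _ => P.flow_start j l u _ t hlt.le
  have h1 : (1 : ℝ) ≤ P.size j l := by exact_mod_cast P.one_le_size j l
  have := h.2
  linarith

theorem SameUpTo.content_eq (h : SameUpTo A g g' z ξ ξ' Q) {i : Fin n} {k : ℕ}
    (hk : (A.plan z).sendTime i k ∈ Q) : A.content g z ξ i k = A.content g' z ξ' i k := by
  induction hq : ⌊(A.plan z).sendTime i k * N.totalBw⌋₊ using Nat.strong_induction_on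
    generalizing i k with
  | _ q ih =>
    rw [A.content_eq, A.content_eq, Algorithm.info, Algorithm.info, A.infoOf_congr_world]
    · intro j l hd
      have := hd.floor_lt_floor
      exact ih _ (by omega) (h.isLowerSet (CommPlan.Delivered.sendTime_le hd) hk) rfl
    · exact fun m e hc ht => h.result i m e hc (h.isLowerSet ht hk)

theorem SameUpTo.info_eq (h : SameUpTo A g g' z ξ ξ' Q) {t : ℝ} (ht : t ∈ Q) (i : Fin n) :
    A.info g z ξ i t = A.info g' z ξ' i t :=
  A.infoOf_congr_world (fun _ _ hd => h.content_eq (h.isLowerSet (CommPlan.Delivered.sendTime_le hd) ht))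
    fun m e hc ht' => h.result i m e hc (h.isLowerSet ht' ht)

theorem SameUpTo.loopState_eq (h : SameUpTo A g g' z ξ ξ' Q) {i : Fin n} {m : ℕ}
    (hm : A.start g z ξ i m ∈ Q) : A.loopState g z ξ (A.content g z ξ) i m =
      A.loopState g' z ξ' (A.content g' z ξ') i m := by
  refine (A.loopState_congr (t := A.start g z ξ i m) (fun s hs => A.received_congr
    (fun _ _ hd => h.content_eq (h.isLowerSet (CommPlan.Delivered.sendTime_le hd) hm)) hs)
    (fun m e hc ht' => h.result i m e hc (h.isLowerSet ht' hm)) m).resolve_right ?_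
  exact fun hlt => lt_irrefl _ hlt.1

theorem SameUpTo.start_eq (h : SameUpTo A g g' z ξ ξ' Q) {i : Fin n} {m : ℕ}
    (hm : A.start g z ξ i m ∈ Q) : A.start g z ξ i m = A.start g' z ξ' i m :=
  congrArg Prod.fst (h.loopState_eq hm)

theorem SameUpTo.input_eq (h : SameUpTo A g g' z ξ ξ' Q) {i : Fin n} {m : ℕ}
    (hm : A.start g z ξ i m ∈ Q) : A.input g z ξ i m = A.input g' z ξ' i m := by
  unfold input inputOf
  rw [← h.loopState_eq hm]
  have e : A.received z (A.content g z ξ) i (A.start g z ξ i m) =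
      A.received z (A.content g' z ξ') i (A.start g z ξ i m) := A.received_congr
    (fun j l hd => h.content_eq (h.isLowerSet (CommPlan.Delivered.sendTime_le hd) hm)) le_rfl
  exact congrArg (fun r => (z, A.start g z ξ i m,
    ((A.loopState g z ξ (A.content g z ξ) i m).2, r))) e

theorem SameUpTo.computes_iff (h : SameUpTo A g g' z ξ ξ' Q) {i : Fin n} {m : ℕ}
    (hm : A.start g z ξ i m ∈ Q) : A.Computes g z ξ i m ↔ A.Computes g' z ξ' i m := by
  unfold Computes
  rw [h.input_eq hm]

/-! ### Where knowledge comes from -/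

variable (A)

theorem loopState_snd_of_le {i : Fin n} {m l : ℕ} (h : m ≤ l) :
    (A.loopState g z ξ M i m).2 l = 0 := by
  induction m with
  | zero => rfl
  | succ m ih =>
    by_cases hc : A.compute i m (A.inputOf g z ξ M i m) = true
    · rw [A.loopState_succ_of_compute hc]
      simp only
      rw [Function.update_of_ne (by omega)]
      exact ih (by omega)
    · rw [A.loopState_succ_of_not_compute hc]
      exact ih (by omega)

theorem loopState_snd_of_lt {i : Fin n} {m l : ℕ} (h : l < m) :
    (A.loopState g z ξ M i m).2 l = (A.loopState g z ξ M i (l + 1)).2 l := by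
  induction m with
  | zero => omega
  | succ m ih =>
    rcases Nat.lt_succ_iff_lt_or_eq.1 h with hl | rfl
    · rw [← ih hl]
      by_cases hc : A.compute i m (A.inputOf g z ξ M i m) = true
      · rw [A.loopState_succ_of_compute hc]
        simp only
        rw [Function.update_of_ne (by omega)]
      · rw [A.loopState_succ_of_not_compute hc]
    · rfl

theorem mem_support_of_point_ne_zero {i : Fin n} {m : ℕ} {c : Fin d}
    (h : A.point g z ξ i m c ≠ 0) :
    c ∈ (A.info g z ξ i (A.start g z ξ i m)).support := by
  rcases A.query_support i m z _ _ c h with ⟨l, hl⟩ | h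
  · left
    have hlm : l < m := by
      by_contra! hle
      refine hl ?_
      simp only
      rw [A.loopState_snd_of_le hle]
      rfl
    refine ⟨l, ?_⟩
    have : (A.loopState g z ξ (A.content g z ξ) i (l + 1)).1 ≤ A.start g z ξ i m :=
      A.monotone_start i hlm
    simp only [info, infoOf]
    rw [if_pos this, ← A.loopState_snd_of_lt hlm]
    exact hl
  · exact Or.inr h

/-- A coordinate in the local information comes from a stochastic gradient that the worker has
computed, or from a message. -/
theorem mem_info_support {i : Fin n} {t : ℝ} {c : Fin d} (h : c ∈ (A.info g z ξ i t).support) :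
    (∃ m, A.Computes g z ξ i m ∧ A.start g z ξ i m + N.time i ≤ t ∧
      g (A.point g z ξ i m) (ξ (i, m)) c ≠ 0) ∨
    ∃ j k, (A.plan z).dest j k = i ∧ (A.plan z).Delivered j k t ∧
      (∃ r < (A.plan z).size j k, (A.plan z).idx j k r = c) ∧
      c ∈ (A.info g z ξ j ((A.plan z).sendTime j k)).support := by
  rcases h with ⟨m, hm⟩ | ⟨j, k, hjk⟩
  · left
    refine ⟨m, ?_⟩
    simp only [info, infoOf] at hm
    split_ifs at hm with ht
    · by_cases hc : A.Computes g z ξ i m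
      · refine ⟨hc, ?_, ?_⟩
        · rw [← A.start_succ hc]; exact ht
        · rw [A.loopState_succ_of_compute hc] at hm
          simpa [point] using hm
      · rw [A.loopState_succ_of_not_compute hc] at hm
        rw [A.loopState_snd_of_le le_rfl] at hm
        exact absurd rfl hm
    · exact absurd rfl hm
  · right
    simp only [info, infoOf, received] at hjk
    split_ifs at hjk with hd
    · refine ⟨j, k, hd.1, hd.2, ?_⟩
      rw [A.content_eq, CommPlan.decode] at hjk
      simp only [WithLp.ofLp_sum, Finset.sum_apply, PiLp.single_apply] at hjk
      obtain ⟨r, hr, hne⟩ := Finset.exists_ne_zero_of_sum_ne_zero hjk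
      split_ifs at hne with e
      · refine ⟨⟨r, Finset.mem_range.1 hr, e.symm⟩, ?_⟩
        rw [e]
        exact A.message_support j k z _ _ (right_ne_zero_of_mul hne)
      · exact absurd rfl hne
    · exact absurd rfl hjk

theorem info_support_mono {i : Fin n} {s t : ℝ} (h : s ≤ t) :
    (A.info g z ξ i s).support ⊆ (A.info g z ξ i t).support := by
  rintro c (⟨m, hm⟩ | ⟨j, k, hjk⟩)
  · left
    refine ⟨m, ?_⟩
    simp only [info, infoOf] at hm ⊢
    split_ifs at hm with hs
    · rwa [if_pos (hs.trans h)]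
    · exact absurd rfl hm
  · right
    refine ⟨j, k, ?_⟩
    simp only [info, infoOf, received] at hjk ⊢
    split_ifs at hjk with hs
    · rwa [if_pos]
      exact ⟨hs.1, hs.2.1, hs.2.2.trans
        (Finset.sum_le_sum fun u _ => (A.plan z).flow_mono j k u _ h)⟩
    · exact absurd rfl hjk

end Algorithm

/-- Induction along causality: since computing and sending take time, a property of the local
information of all workers may be assumed at all sufficiently earlier times. -/
theorem causal_induction (N : Network n) (P : Fin n → ℝ → Prop)
    (h : ∀ i t, (∀ s, 0 ≤ s → s + N.time i ≤ t → P i s) →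
      (∀ j s, 0 ≤ s → s * N.totalBw + 1 ≤ t * N.totalBw → P j s) → P i t) (i : Fin n) (t : ℝ) :
    P i t := by
  have hB := N.totalBw_nonneg
  obtain ⟨δ, hδ, hδi, hδB⟩ : ∃ δ : ℝ, 0 < δ ∧ (∀ i, δ ≤ N.time i) ∧ δ * N.totalBw ≤ 1 := by
    have : Nonempty (Fin n) := ⟨i⟩
    obtain ⟨i₀, hi₀⟩ := Finite.exists_min N.time
    refine ⟨min (N.time i₀) (N.totalBw + 1)⁻¹, lt_min (N.time_pos _) (by positivity),
      fun i => (min_le_left _ _).trans (hi₀ i), ?_⟩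
    calc _ ≤ (N.totalBw + 1)⁻¹ * N.totalBw := mul_le_mul_of_nonneg_right (min_le_right _ _) hB
      _ ≤ (N.totalBw + 1)⁻¹ * (N.totalBw + 1) := by gcongr; linarith
      _ = 1 := inv_mul_cancel₀ (by positivity)
  have key : ∀ q : ℕ, ∀ i t, t < q * δ → P i t := by
    intro q
    induction q with
    | zero =>
      intro i t ht
      have ht0 : t < 0 := by simpa using ht
      refine h i t (fun s h0 hs => ?_) fun j s h0 hs => ?_
      · have := N.time_pos i; linarith
      · nlinarith
    | succ q ih =>
      intro i t ht
      push_cast at ht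
      refine h i t (fun s h0 hs => ih i s ?_) fun j s h0 hs => ih j s ?_
      · have := hδi i; linarith
      · by_contra! hc
        have h1 : t - s < δ := by linarith
        have h2 : (t - s) * N.totalBw ≤ δ * N.totalBw := mul_le_mul_of_nonneg_right h1.le hB
        have h3 : 0 < N.totalBw := by
          rcases hB.eq_or_lt with e | e
          · rw [← e] at hs; linarith
          · exact e
        nlinarith
  obtain ⟨q, hq⟩ := exists_nat_gt (t / δ)
  exact key q i t ((div_lt_iff₀ hδ).1 hq)

end Causality

/-! ### Messages that cross a cut -/

section Cut

variable {n d : ℕ} {N : Network n}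

theorem cutValue_nonneg (N : Network n) (U : Set (Fin n)) : 0 ≤ cutValue N U := by
  classical
  refine Finset.sum_nonneg fun x _ => Finset.sum_nonneg fun y _ => ?_
  split_ifs
  exacts [CommPlan.bw_nonneg N x y, le_rfl]

namespace CommPlan

variable (P : CommPlan N d)

/-- Message `(j, k)` is sent from outside `G` to a node of `G`, at time `t₀` or later, and arrives
by time `t₁`. -/
def Enters (G : Set (Fin n)) (t₀ t₁ : ℝ) (j : Fin n) (k : ℕ) : Prop :=
  j ∉ G ∧ P.dest j k ∈ G ∧ t₀ ≤ P.sendTime j k ∧ P.Delivered j k t₁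

/-- The coordinates contained in the messages that enter `G` between `t₀` and `t₁`. -/
def enteringCoords (G : Set (Fin n)) (t₀ t₁ : ℝ) : Set (Fin d) :=
  {c | ∃ j k, P.Enters G t₀ t₁ j k ∧ ∃ r < P.size j k, P.idx j k r = c}

open scoped Classical in
/-- A message that enters `G` flows through the cut. -/
theorem Enters.size_le {G : Set (Fin n)} {t₀ t₁ : ℝ} {j : Fin n} {k : ℕ}
    (h : P.Enters G t₀ t₁ j k) :
    (P.size j k : ℝ) ≤ ∑ v, ∑ u, if v ∈ G ∧ u ∉ G then P.flow j k u v t₁ else 0 := by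
  obtain ⟨hj, hG, -, hd⟩ := h
  set f : Fin n → Fin n → ℝ := fun u v => P.flow j k u v t₁ with hf
  have hf0 : ∀ u v, 0 ≤ f u v := fun u v => by
    rcases le_total t₁ (P.sendTime j k) with h | h
    · exact (P.flow_start j k u v t₁ h).ge
    · rw [← P.flow_start j k u v _ le_rfl]; exact P.flow_mono j k u v h
  -- the conservation law, summed over the nodes of `G`
  have h1 : (P.size j k : ℝ) + ∑ v, (if v ∈ G then ∑ w, f v w else 0) ≤
      ∑ v, (if v ∈ G then ∑ u, f u v else 0) := by
    have : (P.size j k : ℝ) = ∑ v, if v = P.dest j k then (P.size j k : ℝ) else 0 := by simp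
    rw [this, ← Finset.sum_add_distrib]
    refine Finset.sum_le_sum fun v _ => ?_
    by_cases hv : v ∈ G
    · rw [if_pos hv, if_pos hv]
      by_cases hvd : v = P.dest j k
      · have h0 : ∑ w, f v w = 0 := Finset.sum_eq_zero fun w _ => by
          rw [hvd]; exact P.flow_dest j k hd.1 w t₁
        rw [if_pos hvd, h0, add_zero, hvd]
        exact hd.2
      · rw [if_neg hvd, zero_add]
        have := P.flow_conservation j k v t₁
        rw [if_neg (fun e : v = j => hj (e ▸ hv)), zero_add] at this
        exact this
    · rw [if_neg hv, if_neg hv, if_neg (fun e : v = P.dest j k => hv (e ▸ hG)), zero_add]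
  -- the flow inside of `G` cancels
  have h2 : ∑ v, (if v ∈ G then ∑ u, f u v else 0) =
      (∑ v, ∑ u, if v ∈ G ∧ u ∉ G then f u v else 0) +
        ∑ v, ∑ u, if v ∈ G ∧ u ∈ G then f u v else 0 := by
    rw [← Finset.sum_add_distrib]
    refine Finset.sum_congr rfl fun v _ => ?_
    rw [← Finset.sum_add_distrib]
    by_cases hv : v ∈ G
    · rw [if_pos hv]
      refine Finset.sum_congr rfl fun u _ => ?_
      by_cases hu : u ∈ G <;> simp [hv, hu]
    · simp [hv]
  have h3 : ∑ v, ∑ u, (if v ∈ G ∧ u ∈ G then f u v else 0) ≤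
      ∑ v, (if v ∈ G then ∑ w, f v w else 0) := by
    rw [Finset.sum_comm]
    refine Finset.sum_le_sum fun u _ => ?_
    by_cases hu : u ∈ G
    · rw [if_pos hu]
      refine Finset.sum_le_sum fun v _ => ?_
      by_cases hv : v ∈ G <;> simp [hv, hu, hf0]
    · simp [hu]
  linarith

theorem sum_size_le {G : Set (Fin n)} {t₀ t₁ : ℝ} (ht : t₀ ≤ t₁) (M : Finset (Fin n × ℕ))
    (hM : ∀ m ∈ M, P.Enters G t₀ t₁ m.1 m.2) :
    ∑ m ∈ M, (P.size m.1 m.2 : ℝ) ≤ cutValue N G * (t₁ - t₀) := by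
  classical
  refine (Finset.sum_le_sum fun m hm => Enters.size_le P (hM m hm)).trans ?_
  rw [Finset.sum_comm, cutValue, Finset.sum_mul]
  refine Finset.sum_le_sum fun v _ => ?_
  rw [Finset.sum_comm, Finset.sum_mul]
  refine Finset.sum_le_sum fun u _ => ?_
  split_ifs with h
  · have h1 := P.flow_capacity u v t₀ t₁ ht M
    rw [N.bw_symm u v] at h1
    refine le_trans (Finset.sum_le_sum fun m hm => ?_) h1
    rw [P.flow_start m.1 m.2 u v t₀ (hM m hm).2.2.1, sub_zero]
  · simp

/-- The capacity of the cut bounds the number of coordinates that enter `G`. -/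
theorem ncard_enteringCoords_le (G : Set (Fin n)) {t₀ t₁ : ℝ} (ht : t₀ ≤ t₁) :
    ((P.enteringCoords G t₀ t₁).ncard : ℝ) ≤ cutValue N G * (t₁ - t₀) := by
  classical
  have hch : ∀ c : Fin d, ∃ m : Fin n × ℕ, c ∈ P.enteringCoords G t₀ t₁ →
      P.Enters G t₀ t₁ m.1 m.2 ∧ ∃ r < P.size m.1 m.2, P.idx m.1 m.2 r = c := by
    intro c
    by_cases hc : c ∈ P.enteringCoords G t₀ t₁
    · obtain ⟨j, k, h⟩ := hc
      exact ⟨(j, k), fun _ => h⟩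
    · by_cases hd : Nonempty (Fin n × ℕ)
      · exact ⟨hd.some, fun h => absurd h hc⟩
      · have hn : IsEmpty (Fin n) := ⟨fun i => hd ⟨(i, 0)⟩⟩
        obtain ⟨i⟩ := N.connected.nonempty
        exact (hn.false i).elim
  choose m hm using hch
  have hfin := (Set.toFinite (P.enteringCoords G t₀ t₁))
  set S := hfin.toFinset with hS
  rw [Set.ncard_eq_toFinset_card _ hfin, ← hS]
  have hmem : ∀ c ∈ S, c ∈ P.enteringCoords G t₀ t₁ := fun c hc => hfin.mem_toFinset.1 hc
  have hsub : S ⊆ (S.image m).biUnion fun m =>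
      (Finset.range (P.size m.1 m.2)).image (P.idx m.1 m.2) := by
    intro c hc
    obtain ⟨-, r, hr, he⟩ := hm c (hmem c hc)
    exact Finset.mem_biUnion.2 ⟨m c, Finset.mem_image_of_mem _ hc,
      Finset.mem_image.2 ⟨r, Finset.mem_range.2 hr, he⟩⟩
  have hcard : S.card ≤ ∑ m ∈ S.image m, P.size m.1 m.2 := by
    refine (Finset.card_le_card hsub).trans (Finset.card_biUnion_le.trans ?_)
    exact Finset.sum_le_sum fun m _ => Finset.card_image_le.trans (by simp)
  calc (S.card : ℝ) ≤ ∑ m ∈ S.image m, (P.size m.1 m.2 : ℝ) := by exact_mod_cast hcard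
    _ ≤ _ := P.sum_size_le ht _ fun a ha => by
      obtain ⟨c, hc, rfl⟩ := Finset.mem_image.1 ha
      exact (hm c (hmem c hc)).1

end CommPlan

/-! ### Levels of a laminar family -/

theorem cutValue_diff_le (N : Network n) (D S : Set (Fin n)) :
    cutValue N (D \ S) ≤ cutValue N D + cutValue N S := by
  classical
  have h : cutValue N S = ∑ x, ∑ y, if y ∈ S ∧ x ∉ S then N.bw x y else 0 := by
    unfold cutValue
    rw [Finset.sum_comm]
    exact Finset.sum_congr rfl fun x _ => Finset.sum_congr rfl fun y _ => by rw [N.bw_symm]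
  rw [h]
  unfold cutValue
  rw [← Finset.sum_add_distrib]
  refine Finset.sum_le_sum fun x _ => ?_
  rw [← Finset.sum_add_distrib]
  refine Finset.sum_le_sum fun y _ => ?_
  have := CommPlan.bw_nonneg N x y
  by_cases h1 : x ∈ D <;> by_cases h2 : y ∈ D <;> by_cases h3 : x ∈ S <;> by_cases h4 : y ∈ S <;>
    simp [h1, h2, h3, h4, this]

/-- Let `D i` be the smallest member of a laminar family that contains `i`, and let the level of `i`
be `log₂ |D i|`. Without the proper subsets of the same level, which form a chain, `D i` is
separated from the rest by two cuts of the family, and apart from the nodes that no member of the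
family separates from `i`, it contains nodes of lower levels only. -/
theorem exists_levels (N : Network n) (F : Finset (Finset (Fin n))) (huniv : Finset.univ ∈ F)
    (hlam : ∀ S ∈ F, ∀ S' ∈ F, S ⊆ S' ∨ S' ⊆ S ∨ Disjoint S S') {w : ℝ}
    (hw : ∀ S ∈ F, cutValue N (S : Set (Fin n)) ≤ w) :
    ∃ (lev : Fin n → ℕ) (G : Fin n → Set (Fin n)), (∀ i, lev i ≤ Nat.log 2 n) ∧ (∀ i, i ∈ G i) ∧
      (∀ i, cutValue N (G i) ≤ 2 * w) ∧
      ∀ i j, j ∈ G i → (∀ S ∈ F, i ∈ S ↔ j ∈ S) ∨ lev j < lev i := by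
  classical
  have hw0 : 0 ≤ w := (cutValue_nonneg N _).trans (hw _ huniv)
  have hex : ∀ i : Fin n, ∃ D ∈ F, i ∈ D ∧ ∀ S ∈ F, i ∈ S → D ⊆ S := by
    intro i
    obtain ⟨D, hD, hmin⟩ := Finset.exists_min_image (F.filter (i ∈ ·)) Finset.card
      ⟨_, Finset.mem_filter.2 ⟨huniv, Finset.mem_univ i⟩⟩
    rw [Finset.mem_filter] at hD
    refine ⟨D, hD.1, hD.2, fun S hS hi => ?_⟩
    rcases hlam D hD.1 S hS with h | h | h
    · exact h
    · exact (Finset.eq_of_subset_of_card_le h (hmin S (Finset.mem_filter.2 ⟨hS, hi⟩))).ge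
    · exact absurd hi (Finset.disjoint_left.1 h hD.2)
  choose D hDF hiD hDmin using hex
  set H : Fin n → Finset (Finset (Fin n)) := fun i =>
    F.filter fun S => S ⊂ D i ∧ Nat.log 2 S.card = Nat.log 2 (D i).card with hH
  refine ⟨fun i => Nat.log 2 (D i).card, fun i => {j | j ∈ D i ∧ ∀ S ∈ H i, j ∉ S}, fun i => ?_,
    fun i => ⟨hiD i, fun S hS hiS => ?_⟩, fun i => ?_, fun i j hj => ?_⟩
  · exact Nat.log_mono_right ((Finset.card_le_univ _).trans (by simp))
  · rw [hH, Finset.mem_filter] at hS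
    exact hS.2.1.2 (hDmin i S hS.1 hiS)
  · rcases (H i).eq_empty_or_nonempty with he | hne
    · have : {j | j ∈ D i ∧ ∀ S ∈ H i, j ∉ S} = (D i : Set (Fin n)) := by ext; simp [he]
      simp only [this]
      have := hw _ (hDF i)
      linarith
    · obtain ⟨S₀, hS₀, hmax⟩ := Finset.exists_max_image (H i) Finset.card hne
      have hS₀' := hS₀
      rw [hH, Finset.mem_filter] at hS₀'
      have hsub : ∀ S ∈ H i, S ⊆ S₀ := by
        intro S hS
        have hS' := hS
        rw [hH, Finset.mem_filter] at hS'
        rcases hlam S hS'.1 S₀ hS₀'.1 with h | h | h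
        · exact h
        · exact (Finset.eq_of_subset_of_card_le h (hmax S hS)).ge
        · -- two disjoint subsets of this size do not fit into `D i`
          rcases S.eq_empty_or_nonempty with rfl | hSne
          · exact Finset.empty_subset _
          rcases S₀.eq_empty_or_nonempty with rfl | hSne₀
          · have := hmax S hS
            rw [Finset.card_empty, Nat.le_zero, Finset.card_eq_zero] at this
            exact this.le
          have h1 := Nat.pow_log_le_self 2 hSne.card_ne_zero
          have h2 := Nat.pow_log_le_self 2 hSne₀.card_ne_zero
          rw [hS'.2.2] at h1
          rw [hS₀'.2.2] at h2
          have h3 : S.card + S₀.card ≤ (D i).card := by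
            rw [← Finset.card_union_of_disjoint h]
            exact Finset.card_le_card (Finset.union_subset hS'.2.1.1 hS₀'.2.1.1)
          have h4 := Nat.lt_pow_succ_log_self (b := 2) (by norm_num) (D i).card
          rw [pow_succ] at h4
          omega
      have : {j | j ∈ D i ∧ ∀ S ∈ H i, j ∉ S} = (D i : Set (Fin n)) \ S₀ := by
        ext j
        simp only [Set.mem_ofPred_eq, Set.mem_sdiff, Finset.mem_coe]
        exact ⟨fun h => ⟨h.1, h.2 S₀ hS₀⟩, fun h => ⟨h.1, fun S hS hj => h.2 (hsub S hS hj)⟩⟩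
      simp only [this]
      have h1 := hw _ (hDF i)
      have h2 := hw _ hS₀'.1
      have h3 := cutValue_diff_le N (D i : Set (Fin n)) S₀
      linarith
  · have hsub := hDmin j (D i) (hDF i) hj.1
    rcases hsub.eq_or_ssubset with e | hlt
    · left
      intro S hS
      exact ⟨fun hi => (hDmin i S hS hi) hj.1, fun h => hDmin j S hS h (e ▸ hiD i)⟩
    · right
      refine lt_of_le_of_ne (Nat.log_mono_right (Finset.card_le_card hsub)) fun e => ?_
      exact hj.2 (D j) (Finset.mem_filter.2 ⟨hDF j, hlt, e⟩) (hiD j)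

end Cut

/-! ### The sides of the edges of a tree -/

section Tree

variable {V : Type*} {G : SimpleGraph V}

theorem reachable_deleteEdges_or (hG : G.Connected) (a b v : V) :
    (G.deleteEdges {s(a, b)}).Reachable a v ∨ (G.deleteEdges {s(a, b)}).Reachable b v := by
  obtain ⟨p⟩ := hG.preconnected v a
  induction p with
  | nil => exact Or.inl (SimpleGraph.Reachable.refl _)
  | @cons u v w h p ih =>
    by_cases he : s(u, v) = s(w, b)
    · rcases Sym2.eq_iff.1 he with ⟨rfl, rfl⟩ | ⟨rfl, rfl⟩
      · exact Or.inl (SimpleGraph.Reachable.refl _)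
      · exact Or.inr (SimpleGraph.Reachable.refl _)
    · have : (G.deleteEdges {s(w, b)}).Adj u v := by
        rw [SimpleGraph.deleteEdges_adj]; exact ⟨h, he⟩
      exact ih.imp (fun h => h.trans this.symm.reachable) fun h => h.trans this.symm.reachable

/-- The nodes that the edge `e` separates from `ρ`. -/
def farSide (G : SimpleGraph V) (ρ : V) (e : Sym2 V) : Set V :=
  {v | ¬ (G.deleteEdges {e}).Reachable ρ v}

theorem exists_farSide_eq (hG : G.IsTree) (ρ : V) {e : Sym2 V} (he : e ∈ G.edgeSet) :
    ∃ a b, G.Adj a b ∧ e = s(a, b) ∧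
      farSide G ρ e = {v | (G.deleteEdges {s(a, b)}).Reachable a v} := by
  induction e using Sym2.ind with
  | _ a b =>
  have hab : G.Adj a b := he
  have hbr : ¬ (G.deleteEdges {s(a, b)}).Reachable a b :=
    SimpleGraph.isBridge_iff.1 (SimpleGraph.isAcyclic_iff_forall_adj_isBridge.1 hG.isAcyclic hab)
  rcases reachable_deleteEdges_or hG.connected a b ρ with h | h
  · refine ⟨b, a, hab.symm, Sym2.eq_swap, ?_⟩
    rw [Sym2.eq_swap (a := b)]
    ext v
    simp only [farSide, Set.mem_ofPred_eq]
    refine ⟨fun hv => (reachable_deleteEdges_or hG.connected a b v).resolve_left fun h' =>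
      hv (h.symm.trans h'), fun hv hρ => hbr (h.trans (hρ.trans hv.symm))⟩
  · refine ⟨a, b, hab, rfl, ?_⟩
    ext v
    simp only [farSide, Set.mem_ofPred_eq]
    refine ⟨fun hv => (reachable_deleteEdges_or hG.connected a b v).resolve_right fun h' =>
      hv (h.symm.trans h'), fun hv hρ => hbr (hv.trans (hρ.symm.trans h.symm))⟩

theorem farSide_connected (hG : G.IsTree) (ρ : V) {e : Sym2 V} (he : e ∈ G.edgeSet) {x y : V}
    (hx : x ∈ farSide G ρ e) (hy : y ∈ farSide G ρ e) : (G.deleteEdges {e}).Reachable x y := by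
  obtain ⟨a, b, -, rfl, h⟩ := exists_farSide_eq hG ρ he
  rw [h] at hx hy
  exact SimpleGraph.Reachable.trans (SimpleGraph.Reachable.symm hx) hy

theorem reachable_deleteEdges_of_closed {e e' : Sym2 V} {U : Set V}
    (hU : ∀ u v, (G.deleteEdges {e'}).Adj u v → u ∈ U → v ∈ U) (he : ∃ a ∈ e, a ∉ U) {x y : V}
    (hx : x ∈ U) (h : (G.deleteEdges {e'}).Reachable x y) : (G.deleteEdges {e}).Reachable x y := by
  obtain ⟨p⟩ := h
  induction p with
  | nil => exact SimpleGraph.Reachable.refl _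
  | @cons u v w h p ih =>
    have hv := hU u v h hx
    refine SimpleGraph.Reachable.trans (SimpleGraph.Adj.reachable ?_) (ih hv)
    rw [SimpleGraph.deleteEdges_adj] at h ⊢
    refine ⟨h.1, ?_⟩
    rintro rfl
    obtain ⟨a, ha, haU⟩ := he
    rcases Sym2.mem_iff.1 ha with rfl | rfl
    · exact haU hx
    · exact haU hv

theorem farSide_laminar (hG : G.IsTree) (ρ : V) {e e' : Sym2 V} (he : e ∈ G.edgeSet)
    (he' : e' ∈ G.edgeSet) :
    farSide G ρ e ⊆ farSide G ρ e' ∨ farSide G ρ e' ⊆ farSide G ρ e ∨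
      Disjoint (farSide G ρ e) (farSide G ρ e') := by
  by_cases hee : e = e'
  · exact Or.inl (hee ▸ subset_rfl)
  have hcl : ∀ u v, (G.deleteEdges {e'}).Adj u v → (u ∈ farSide G ρ e' ↔ v ∈ farSide G ρ e') :=
    fun u v huv => not_congr ⟨fun h => h.trans huv.reachable, fun h => h.trans huv.symm.reachable⟩
  induction e using Sym2.ind with
  | _ a b =>
  have hab : (G.deleteEdges {e'}).Adj a b := by
    rw [SimpleGraph.deleteEdges_adj]; exact ⟨he, hee⟩
  by_cases ha : a ∈ farSide G ρ e'
  · left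
    intro v hv hv'
    refine hv (reachable_deleteEdges_of_closed (e' := e') (U := (farSide G ρ e')ᶜ)
      (fun u v h hu hv => hu ((hcl u v h).2 hv)) ⟨a, Sym2.mem_mk_left a b, fun h => h ha⟩
      (fun h => h (SimpleGraph.Reachable.refl _)) hv')
  · right
    by_cases hd : Disjoint (farSide G ρ s(a, b)) (farSide G ρ e')
    · exact Or.inr hd
    · left
      obtain ⟨x, hx, hx'⟩ := Set.not_disjoint_iff.1 hd
      intro y hy hρ
      exact hx (hρ.trans (reachable_deleteEdges_of_closed (U := farSide G ρ e')
        (fun u v h hu => (hcl u v h).1 hu) ⟨a, Sym2.mem_mk_left a b, ha⟩ hy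
        (farSide_connected hG ρ he' hy hx')))

/-- Nodes that no removed edge separates are connected by the remaining ones. -/
theorem reachable_of_farSide (hG : G.IsTree) (ρ : V) (R : Set (Sym2 V)) {x y : V}
    (h : ∀ e ∈ R, e ∈ G.edgeSet → (x ∈ farSide G ρ e ↔ y ∈ farSide G ρ e)) :
    (G.deleteEdges R).Reachable x y := by
  classical
  obtain ⟨p⟩ := hG.connected.preconnected x y
  refine ⟨p.toPath.1.toDeleteEdges R fun e hep heR => ?_⟩
  have heG := p.toPath.1.edges_subset_edgeSet hep
  have hr : (G.deleteEdges {e}).Reachable x y := by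
    by_cases hx : x ∈ farSide G ρ e
    · exact farSide_connected hG ρ heG hx ((h e heR heG).1 hx)
    · have hy : y ∉ farSide G ρ e := fun hy => hx ((h e heR heG).2 hy)
      exact (not_not.1 hx).symm.trans (not_not.1 hy)
  obtain ⟨q⟩ := hr
  have hle := G.deleteEdges_le {e}
  have e1 := (hG.isAcyclic.subsingleton_path x y).elim p.toPath
    ⟨q.toPath.1.mapLe hle, q.toPath.2.mapLe hle⟩
  rw [e1] at hep
  rw [SimpleGraph.Walk.edges_mapLe_eq_edges] at hep
  have := q.toPath.1.edges_subset_edgeSet hep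
  rw [SimpleGraph.edgeSet_deleteEdges] at this
  exact this.2 rfl

end Tree

/-! ### The time complexity -/

theorem take_countP_of_sorted {x : ℝ} {l : List ℝ} (h : l.Pairwise (· ≤ ·)) :
    l.take (l.countP (· ≤ x)) = l.filter (· ≤ x) := by
  induction l with
  | nil => rfl
  | cons a l ih =>
    rw [List.pairwise_cons] at h
    by_cases ha : a ≤ x
    · rw [List.countP_cons_of_pos (by simpa using ha), List.filter_cons_of_pos (by simpa using ha),
        List.take_succ_cons, ih h.2]
    · have : ∀ b ∈ l, ¬ b ≤ x := fun b hb hbx => ha ((h.1 b hb).trans hbx)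
      rw [List.countP_cons_of_neg (by simpa using ha), List.filter_cons_of_neg (by simpa using ha),
        ← ih h.2]
      rw [List.countP_eq_zero.2 (by simpa using this)]
      rfl

section TimeComplexity

variable {n : ℕ}

theorem sum_take_sortedTimes (h : Fin n → ℝ) (S : Finset (Fin n)) (x : ℝ) :
    (((sortedTimes h S).take (S.filter fun i => h i ≤ x).card).map fun a => 1 / a).sum =
      ∑ i ∈ S with h i ≤ x, 1 / h i := by
  have h1 : (sortedTimes h S : Multiset ℝ) = S.val.map h := Multiset.sort_eq _ _
  have h2 : (sortedTimes h S).countP (· ≤ x) = (S.filter fun i => h i ≤ x).card := by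
    rw [← Multiset.coe_countP, h1, Multiset.countP_map]
    rfl
  rw [← h2, take_countP_of_sorted (l := sortedTimes h S) (Multiset.pairwise_sort _ _), ← Multiset.sum_coe,
    ← Multiset.map_coe, ← Multiset.filter_coe, h1, Multiset.filter_map, Multiset.map_map]
  rfl

theorem length_sortedTimes (h : Fin n → ℝ) (S : Finset (Fin n)) :
    (sortedTimes h S).length = S.card := by
  simp [sortedTimes]

theorem batchTime_pos {h : Fin n → ℝ} (hh : ∀ i, 0 < h i) {r : ℝ} (hr : 0 < r)
    {S : Finset (Fin n)} (hS : S.Nonempty) : 0 < batchTime h r S := by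
  have : Nonempty (Fin S.card) := ⟨⟨0, hS.card_pos⟩⟩
  obtain ⟨l, hl⟩ := exists_eq_ciInf_of_finite (f := fun l : Fin S.card =>
    (1 / ((l : ℝ) + 1) * (((sortedTimes h S).take (l + 1)).map fun a => 1 / a).sum)⁻¹ *
      (1 + r / ((l : ℝ) + 1)))
  rw [batchTime, ← hl]
  have hpos : ∀ a ∈ sortedTimes h S, 0 < a := by
    intro a ha
    rw [sortedTimes, Multiset.mem_sort, Multiset.mem_map] at ha
    obtain ⟨i, -, rfl⟩ := ha
    exact hh i
  have hsum : 0 < (((sortedTimes h S).take (l + 1)).map fun a => 1 / a).sum := by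
    refine List.sum_pos _ (fun a ha => ?_) ?_
    · obtain ⟨b, hb, rfl⟩ := List.mem_map.1 ha
      exact one_div_pos.2 (hpos b (List.mem_of_mem_take hb))
    · rw [Ne, List.map_eq_nil_iff, List.take_eq_nil_iff, ← List.length_eq_zero_iff,
        length_sortedTimes]
      simp [hS.ne_empty]
  positivity

/-- Within less than the batch time, the workers of `S` cannot compute a number of stochastic
gradients that is comparable to the relative variance `r`. -/
theorem sum_floor_le {h : Fin n → ℝ} (hh : ∀ i, 0 < h i) {r c θ : ℝ} (hr : 0 < r) (hθ : 0 < θ)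
    (hc : c ≤ 1 / 4) (hc0 : 0 ≤ c) {S : Finset (Fin n)} (hθb : θ ≤ c * batchTime h r S)
    {C : Finset (Fin n)} (hC : C ⊆ S) :
    ∑ i ∈ C, (⌊2 * θ / h i⌋₊ : ℝ) ≤ 4 * c * r := by
  set m := (S.filter fun i => h i ≤ 2 * θ).card with hm
  set H := ∑ i ∈ S with h i ≤ 2 * θ, 1 / h i with hH
  have hfl : ∀ i, ¬ h i ≤ 2 * θ → ⌊2 * θ / h i⌋₊ = 0 := fun i hi => by
    rw [Nat.floor_eq_zero, div_lt_one (hh i)]; exact not_le.1 hi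
  have h1 : ∑ i ∈ C, (⌊2 * θ / h i⌋₊ : ℝ) ≤ 2 * θ * H := by
    calc ∑ i ∈ C, (⌊2 * θ / h i⌋₊ : ℝ) ≤ ∑ i ∈ S, (⌊2 * θ / h i⌋₊ : ℝ) :=
          Finset.sum_le_sum_of_subset_of_nonneg hC fun _ _ _ => Nat.cast_nonneg _
      _ = ∑ i ∈ S with h i ≤ 2 * θ, (⌊2 * θ / h i⌋₊ : ℝ) := by
          rw [Finset.sum_filter]
          refine Finset.sum_congr rfl fun i _ => ?_
          split_ifs with hi
          · rfl
          · simp [hfl i hi]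
      _ ≤ ∑ i ∈ S with h i ≤ 2 * θ, 2 * θ * (1 / h i) := by
          refine Finset.sum_le_sum fun i _ => ?_
          rw [mul_one_div]
          exact Nat.floor_le (by have := hh i; positivity)
      _ = 2 * θ * H := by rw [Finset.mul_sum]
  rcases Nat.eq_zero_or_pos m with h0 | hpos
  · have : H = 0 := by
      rw [hH, Finset.card_eq_zero.1 h0]; simp
    rw [this, mul_zero] at h1
    exact h1.trans (by positivity)
  have hmS : m ≤ S.card := Finset.card_filter_le _ _
  have hm0 : (0 : ℝ) < m := by exact_mod_cast hpos
  have hHm : (m : ℝ) ≤ 2 * θ * H := by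
    rw [hH, Finset.mul_sum, hm, ← nsmul_one, ← Finset.sum_const]
    refine Finset.sum_le_sum fun i hi => ?_
    rw [mul_one_div, one_le_div (hh i)]
    exact (Finset.mem_filter.1 hi).2
  have hHpos : 0 < H := by
    by_contra! hneg
    have := mul_nonpos_of_nonneg_of_nonpos (show 0 ≤ 2 * θ by positivity) hneg
    linarith
  have hb : batchTime h r S ≤ (m + r) / H := by
    have hbd : BddBelow (Set.range fun l : Fin S.card =>
      (1 / ((l : ℝ) + 1) * (((sortedTimes h S).take (l + 1)).map fun a => 1 / a).sum)⁻¹ *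
        (1 + r / ((l : ℝ) + 1))) := (Set.finite_range _).bddBelow
    refine (ciInf_le hbd ⟨m - 1, by omega⟩).trans (le_of_eq ?_)
    have e1 : m - 1 + 1 = m := by omega
    have e2 : ((m - 1 : ℕ) : ℝ) + 1 = m := by exact_mod_cast e1
    simp only [e1, e2]
    rw [sum_take_sortedTimes h S (2 * θ)]
    change (1 / (m : ℝ) * H)⁻¹ * (1 + r / m) = (m + r) / H
    field_simp
  have h2 : θ * H ≤ c * (m + r) := by
    have h3 : θ ≤ c * ((m + r) / H) := hθb.trans (mul_le_mul_of_nonneg_left hb hc0)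
    calc θ * H ≤ c * ((m + r) / H) * H := mul_le_mul_of_nonneg_right h3 hHpos.le
      _ = _ := by field_simp
  have h4 : c * m ≤ 1 / 4 * m := mul_le_mul_of_nonneg_right hc hm0.le
  have h5 : (m : ℝ) ≤ 4 * c * r := by nlinarith
  have h6 : c * r ≤ 1 / 4 * r := mul_le_mul_of_nonneg_right hc hr.le
  have h7 : (m : ℝ) ≤ r := by linarith
  have h8 : c * m ≤ c * r := mul_le_mul_of_nonneg_left h7 hc0
  nlinarith

variable {N : Network n} (T : SortedGomoryHuTree N)

theorem weight_edge_eq_cutValue (ρ : Fin n) (j : Fin (n - 1)) :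
    cutValue N (farSide T.tree ρ (T.edge j)) = T.weight (T.edge j) := by
  obtain ⟨a, b, hab, he, h⟩ := exists_farSide_eq T.isTree ρ (T.edge j).2
  rw [h, he, T.weight_eq a b hab]

open scoped Classical in
/-- At the index where the communication term `d / w̄ₖ` falls below the computation term, the grace
time is at most twice the communication term of each removed edge, and at most twice the batch time
of each component. -/
theorem exists_critical_index (hn : 0 < n) {d r : ℝ} (hd : 0 < d) (hr : 0 < r) :
    0 < T.graceTime d r ∧ ∃ k : ℕ,
      (∀ j : Fin (n - 1), (j : ℕ) < k → T.weight (T.edge j) * T.graceTime d r ≤ 2 * d) ∧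
      ∀ C : (T.forest k).ConnectedComponent,
        T.graceTime d r ≤ 2 * batchTime N.time r C.supp.toFinset := by
  have hne : Nonempty (Fin n) := ⟨⟨0, hn⟩⟩
  have hcomp : ∀ k, Nonempty (T.forest k).ConnectedComponent := fun k =>
    ⟨(T.forest k).connectedComponentMk ⟨0, hn⟩⟩
  have hfin : ∀ k, Finite (T.forest k).ConnectedComponent := fun k => inferInstance
  set a : Fin n → ℝ := fun k =>
    if hk : (k : ℕ) < n - 1 then d / T.weight (T.edge ⟨k, hk⟩) else 0 with ha
  set b : Fin n → ℝ := fun k =>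
    ⨅ C : (T.forest k).ConnectedComponent, batchTime N.time r C.supp.toFinset with hb
  have hg : T.graceTime d r = ⨅ k, (a k + b k) := by
    unfold SortedGomoryHuTree.graceTime
    refine iInf_congr fun k => ?_
    congr!
  have hbt : ∀ k, ∀ C : (T.forest k).ConnectedComponent,
      0 < batchTime N.time r C.supp.toFinset := fun k C =>
    batchTime_pos N.time_pos hr (by
      obtain ⟨v, hv⟩ := C.nonempty_supp
      exact ⟨v, by simpa using hv⟩)
  have hw0 : ∀ j, 0 ≤ T.weight (T.edge j) := fun j => by
    rw [← weight_edge_eq_cutValue T ⟨0, hn⟩ j]; exact cutValue_nonneg _ _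
  have ha0 : ∀ k, 0 ≤ a k := fun k => by
    simp only [ha]
    split_ifs with hk
    · exact div_nonneg hd.le (hw0 _)
    · exact le_rfl
  have hb0 : ∀ k, 0 < b k := fun k => by
    obtain ⟨C, hC⟩ := exists_eq_ciInf_of_finite (f := fun C : (T.forest k).ConnectedComponent =>
      batchTime N.time r C.supp.toFinset)
    simp only [hb]
    rw [← hC]
    exact hbt k C
  have hgk : ∀ k, T.graceTime d r ≤ a k + b k := fun k => by
    rw [hg]; exact ciInf_le (Set.finite_range _).bddBelow k
  have hbC : ∀ k : Fin n, ∀ C : (T.forest k).ConnectedComponent,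
      b k ≤ batchTime N.time r C.supp.toFinset := fun k C =>
    ciInf_le (Set.finite_range _).bddBelow C
  have hgpos : 0 < T.graceTime d r := by
    obtain ⟨k, hk⟩ := exists_eq_ciInf_of_finite (f := fun k => a k + b k)
    rw [hg, ← hk]
    exact add_pos_of_nonneg_of_pos (ha0 k) (hb0 k)
  refine ⟨hgpos, ?_⟩
  have hex : ∃ k : ℕ, ∃ hk : k < n, a ⟨k, hk⟩ ≤ b ⟨k, hk⟩ :=
    ⟨n - 1, by omega, by simp only [ha]; rw [dif_neg (by simp)]; exact (hb0 _).le⟩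
  obtain ⟨hkn, hkab⟩ := Nat.find_spec hex
  refine ⟨Nat.find hex, fun j hj => ?_, fun C => ?_⟩
  · -- the weight of the last removed edge
    set k := Nat.find hex with hk
    have hk1 : k - 1 < n := by omega
    have hk2 : k - 1 < n - 1 := by omega
    have hlt : b ⟨k - 1, hk1⟩ < a ⟨k - 1, hk1⟩ := by
      have := Nat.find_min hex (m := k - 1) (by omega)
      by_contra! hle
      exact this ⟨hk1, hle⟩
    have h1 := hgk ⟨k - 1, hk1⟩
    have hae : a ⟨k - 1, hk1⟩ = d / T.weight (T.edge ⟨k - 1, hk2⟩) := by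
      simp only [ha]; rw [dif_pos hk2]
    have hwpos : 0 < T.weight (T.edge ⟨k - 1, hk2⟩) := by
      refine lt_of_le_of_ne (hw0 _) fun e => ?_
      rw [hae, ← e, div_zero] at hlt
      exact absurd hlt (hb0 _).not_gt
    have hwj : T.weight (T.edge j) ≤ T.weight (T.edge ⟨k - 1, hk2⟩) :=
      T.sorted (by rw [Fin.le_def]; simp only; omega)
    have h2 : T.graceTime d r ≤ 2 * (d / T.weight (T.edge ⟨k - 1, hk2⟩)) := by
      rw [hae] at h1 hlt; linarith
    calc T.weight (T.edge j) * T.graceTime d r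
        ≤ T.weight (T.edge ⟨k - 1, hk2⟩) * (2 * (d / T.weight (T.edge ⟨k - 1, hk2⟩))) :=
          mul_le_mul hwj h2 hgpos.le hwpos.le
      _ = 2 * d := by field_simp
  · have h1 := hgk ⟨_, hkn⟩
    have h2 := hbC ⟨_, hkn⟩ C
    linarith

/-- The structure of the network at the scale of the grace time: with the edges of small weight
removed, every worker `i` has a level and a group that is separated from the rest by cuts of small
value. The workers of its group either are of lower level, or belong with it to one component, which
computes slowly. -/
theorem exists_groups (hn : 0 < n) {d r : ℝ} (hd : 0 < d) (hr : 0 < r) :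
    0 < T.graceTime d r ∧ ∃ (lev : Fin n → ℕ) (G : Fin n → Set (Fin n))
      (C : Fin n → Finset (Fin n)), (∀ i, lev i ≤ Nat.log 2 n) ∧ (∀ i, i ∈ G i) ∧
      (∀ i, cutValue N (G i) * T.graceTime d r ≤ 4 * d) ∧
      (∀ i j, j ∈ G i → j ∈ C i ∨ lev j < lev i) ∧
      ∀ i, ∃ S : Finset (Fin n), C i ⊆ S ∧ T.graceTime d r ≤ 2 * batchTime N.time r S := by
  classical
  obtain ⟨hg, k, hk, hC⟩ := exists_critical_index T hn hd hr
  refine ⟨hg, ?_⟩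
  set ρ : Fin n := ⟨0, hn⟩
  set F : Finset (Finset (Fin n)) := insert Finset.univ
    ((Finset.univ.filter fun j : Fin (n - 1) => (j : ℕ) < k).image
      fun j => (farSide T.tree ρ (T.edge j)).toFinset) with hF
  have hmem : ∀ S ∈ F, S = Finset.univ ∨ ∃ j : Fin (n - 1), (j : ℕ) < k ∧
      (S : Set (Fin n)) = farSide T.tree ρ (T.edge j) := by
    intro S hS
    rcases Finset.mem_insert.1 hS with h | h
    · exact Or.inl h
    · obtain ⟨j, hj, rfl⟩ := Finset.mem_image.1 h
      exact Or.inr ⟨j, (Finset.mem_filter.1 hj).2, by simp⟩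
  obtain ⟨lev, G, h1, h2, h3, h4⟩ := exists_levels N F (Finset.mem_insert_self _ _)
    (by
      intro S hS S' hS'
      rcases hmem S hS with rfl | ⟨j, -, hj⟩
      · exact Or.inr (Or.inl (Finset.subset_univ _))
      rcases hmem S' hS' with rfl | ⟨j', -, hj'⟩
      · exact Or.inl (Finset.subset_univ _)
      rw [← Finset.coe_subset, ← Finset.coe_subset, ← Finset.disjoint_coe, hj, hj']
      exact farSide_laminar T.isTree ρ (T.edge j).2 (T.edge j').2)
    (w := 2 * d / T.graceTime d r)
    (by
      intro S hS
      rcases hmem S hS with rfl | ⟨j, hjk, hj⟩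
      · have : cutValue N ((Finset.univ : Finset (Fin n)) : Set (Fin n)) = 0 := by
          simp [cutValue]
        rw [this]
        positivity
      · rw [hj, weight_edge_eq_cutValue, le_div_iff₀ hg]
        exact hk j hjk)
  refine ⟨lev, G, fun i => Finset.univ.filter fun j => ∀ S ∈ F, i ∈ S ↔ j ∈ S, h1, h2,
    fun i => ?_, fun i j hj => (h4 i j hj).imp (fun h => by simpa using h) id, fun i =>
    ⟨((T.forest k).connectedComponentMk i).supp.toFinset, fun j hj => ?_, hC _⟩⟩
  · calc _ ≤ 2 * (2 * d / T.graceTime d r) * T.graceTime d r :=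
          mul_le_mul_of_nonneg_right (h3 i) hg.le
      _ = 4 * d := by field_simp; ring
  · rw [Set.mem_toFinset, SimpleGraph.ConnectedComponent.mem_supp_iff,
      SimpleGraph.ConnectedComponent.eq]
    refine (reachable_of_farSide T.isTree ρ _ fun e he _ => ?_).symm
    obtain ⟨j', hj', rfl⟩ := he
    have := (Finset.mem_filter.1 hj).2 _ (Finset.mem_insert_of_mem (Finset.mem_image_of_mem _
      (Finset.mem_filter.2 ⟨Finset.mem_univ j', hj'⟩)))
    simpa using this

end TimeComplexity

/-! ### Progress along the chain -/

section Progress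

variable {n d B K : ℕ} {N : Network n} {Z : Type*} [MeasurableSpace Z] (A : Algorithm N d Z)
  (s lam p : ℝ) (z : Z) (π π' : Chain B K ↪ Fin d) (ξ ξ' : Fin n × ℕ → Chain B K → Bool)

/-- Worker `i` knows the coordinate of index `c` at time `t`. -/
def Knows (i : Fin n) (t : ℝ) (c : Chain B K) : Prop :=
  π c ∈ (A.info (hardOracle π s lam p) z ξ i t).support

/-- At time `t`, some worker knows a coordinate of block `u` or of a later one. -/
def Reached (u : ℕ) (t : ℝ) : Prop :=
  ∃ (i : Fin n) (c : Chain B K), u ≤ c.1 ∧ Knows A s lam p z π ξ i t c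

/-- In iteration `m` of its computation loop, worker `j` computes a stochastic gradient, all within
the time window from `t₀` to `t₁`. -/
def Trial (t₀ t₁ : ℝ) (j : Fin n) (m : ℕ) : Prop :=
  A.Computes (hardOracle π s lam p) z ξ j m ∧ t₀ ≤ A.start (hardOracle π s lam p) z ξ j m ∧
    A.start (hardOracle π s lam p) z ξ j m + N.time j ≤ t₁

/-- Within the time window, the coin of index `c` has come up for a worker of `C`, or the coordinate
of index `c` has been sent into the group `G`. -/
def Got (C : Finset (Fin n)) (G : Set (Fin n)) (t₀ t₁ : ℝ) (c : Chain B K) : Prop :=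
  (∃ j ∈ C, ∃ m, Trial A s lam p z π ξ t₀ t₁ j m ∧ ξ (j, m) c = true) ∨
    π c ∈ (A.plan z).enteringCoords G t₀ t₁

variable {A s lam p z π π' ξ ξ'}

theorem Knows.mono {i : Fin n} {t t' : ℝ} {c : Chain B K} (h : Knows A s lam p z π ξ i t c)
    (ht : t ≤ t') : Knows A s lam p z π ξ i t' c :=
  A.info_support_mono ht h

theorem Reached.mono {u u' : ℕ} {t t' : ℝ} (h : Reached A s lam p z π ξ u t) (hu : u' ≤ u)
    (ht : t ≤ t') : Reached A s lam p z π ξ u' t' := by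
  obtain ⟨i, c, hc, hk⟩ := h
  exact ⟨i, c, hu.trans hc, hk.mono ht⟩

theorem knows_of_point_ne_zero {i : Fin n} {m : ℕ} {c : Chain B K}
    (h : A.point (hardOracle π s lam p) z ξ i m (π c) ≠ 0) :
    Knows A s lam p z π ξ i (A.start (hardOracle π s lam p) z ξ i m) c :=
  A.mem_support_of_point_ne_zero h

theorem not_mem_info_support_zero {Ξ : Type*} (g : Vec d → Ξ → Vec d) (ξ : Fin n × ℕ → Ξ)
    (i : Fin n) (c : Fin d) : c ∉ (A.info g z ξ i 0).support := by
  intro h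
  rcases A.mem_info_support h with ⟨m, -, hm, -⟩ | ⟨j, k, -, hd, -⟩
  · have := A.start_nonneg (g := g) (z := z) (ξ := ξ) i m
    have := N.time_pos i
    linarith
  · have h1 := CommPlan.Delivered.delay _ hd
    have h2 := mul_nonneg ((A.plan z).sendTime_nonneg j k) N.totalBw_nonneg
    linarith

theorem not_reached_zero (u : ℕ) : ¬ Reached A s lam p z π ξ u 0 := by
  rintro ⟨i, c, -, h⟩
  exact not_mem_info_support_zero _ _ i _ h

/-- All coordinates in the local information belong to the chain. -/
theorem exists_eq_of_mem_support {i : Fin n} {t : ℝ} {c : Fin d}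
    (h : c ∈ (A.info (hardOracle π s lam p) z ξ i t).support) : ∃ e, π e = c := by
  revert h
  refine causal_induction N (fun i t => c ∈ (A.info (hardOracle π s lam p) z ξ i t).support →
    ∃ e, π e = c) (fun i t _ ih h => ?_) i t
  rcases A.mem_info_support h with ⟨m, -, -, hm⟩ | ⟨j, k, -, hd, -, hj⟩
  · obtain ⟨e, he, -⟩ := hardOracle_ne_zero hm
    exact ⟨e, he⟩
  · exact ih j _ ((A.plan z).sendTime_nonneg j k) (CommPlan.Delivered.delay _ hd) hj

theorem lt_of_not_reached {u : ℕ} {t : ℝ} (h : ¬ Reached A s lam p z π ξ u t) {i : Fin n}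
    {t' : ℝ} (ht : t' ≤ t) {c : Fin d}
    (hc : c ∈ (A.info (hardOracle π s lam p) z ξ i t').support) : ∃ e, π e = c ∧ (e.1 : ℕ) < u := by
  obtain ⟨e, rfl⟩ := exists_eq_of_mem_support hc
  refine ⟨e, rfl, ?_⟩
  by_contra! hle
  exact h ⟨i, e, hle, Knows.mono hc ht⟩

/-- Before block `u` is reached, the positions and coins of the later blocks have no influence. -/
theorem not_reached_congr {u : ℕ} {t : ℝ} (hπ : ∀ e : Chain B K, (e.1 : ℕ) ≤ u → π e = π' e)
    (hξ : ∀ a, ∀ e : Chain B K, (e.1 : ℕ) ≤ u → ξ a e = ξ' a e)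
    (h : ¬ Reached A s lam p z π ξ u t) : ¬ Reached A s lam p z π' ξ' u t := by
  have hs : A.SameUpTo (hardOracle π s lam p) (hardOracle π' s lam p) z ξ ξ' (Set.Iic t) := by
    refine ⟨isLowerSet_Iic t, fun i m _ _ hm => ?_⟩
    refine hardOracle_congr (u := u) (fun c hc => ?_) hπ (hξ (i, m))
    refine lt_of_not_reached h ?_ (A.mem_support_of_point_ne_zero hc)
    have := N.time_pos i
    have := Set.mem_Iic.1 hm
    linarith
  rintro ⟨i, c, hc, hk⟩
  rw [Knows, ← hs.info_eq Set.self_mem_Iic i] at hk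
  obtain ⟨e, he, heu⟩ := lt_of_not_reached h le_rfl hk
  rw [hπ e heu.le] at he
  have := π'.injective he
  subst this
  omega

/-- If block `u` is not reached at time `t₀`, and within the window no worker `i` has got a complete
block from number `u + 1 + lev i` to number `u + 1 + ℓ`, then no later block is reached.

A worker of level `lev i` can extend its knowledge only after it has got a complete block, and the
other workers of its group are of lower levels, so that they are stuck earlier. -/
theorem not_reached_of_not_got {u ℓ : ℕ} {t₀ t₁ : ℝ} {lev : Fin n → ℕ} {G : Fin n → Set (Fin n)}
    {C : Fin n → Finset (Fin n)} (hlev : ∀ i, lev i ≤ ℓ) (hG : ∀ i, i ∈ G i)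
    (hC : ∀ i j, j ∈ G i → j ∈ C i ∨ lev j < lev i)
    (h₀ : ¬ Reached A s lam p z π ξ u t₀)
    (hgot : ∀ i, ∀ b : Fin B, u + 1 + lev i ≤ b → (b : ℕ) ≤ u + 1 + ℓ →
      ∃ r, ¬ Got A s lam p z π ξ (C i) (G i) t₀ t₁ (b, r)) :
    ¬ Reached A s lam p z π ξ (u + 2 + ℓ) t₁ := by
  have key : ∀ i t, t ≤ t₁ → ∀ c, Knows A s lam p z π ξ i t c → (c.1 : ℕ) ≤ u + 1 + ℓ ∧
      ∀ i₀, i ∈ G i₀ → u + 1 + lev i₀ ≤ c.1 → Got A s lam p z π ξ (C i₀) (G i₀) t₀ t₁ c := by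
    refine causal_induction N _ fun i t ihc ihm ht c hc => ?_
    rcases A.mem_info_support hc with ⟨m, hcomp, hm, hne⟩ | ⟨j, k, hdest, hd, ⟨r, hr, hidx⟩, hj⟩
    · set S := A.start (hardOracle π s lam p) z ξ i m with hS
      have hSt : S ≤ t₁ := by have := N.time_pos i; linarith
      have ih := ihc S (A.start_nonneg i m) hm hSt
      -- at the start of the computation, no block of the critical range is complete
      have stuck : ∀ i₀, i ∈ G i₀ → ∀ b : Fin B, u + 1 + lev i₀ ≤ b →
          ¬ ∀ e : Chain B K, (e.1 : ℕ) = b → Knows A s lam p z π ξ i S e := by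
        intro i₀ hi₀ b hb hall
        have hle : (b : ℕ) ≤ u + 1 + ℓ := (ih (b, c.2) (hall _ rfl)).1
        obtain ⟨r, hr⟩ := hgot i₀ b hb hle
        exact hr ((ih (b, r) (hall _ rfl)).2 i₀ hi₀ hb)
      obtain ⟨c', hc', hcase⟩ := hardOracle_ne_zero hne
      have hcc : c' = c := π.injective hc'
      subst hcc
      rcases hcase with hx | ⟨hprev, hcoin⟩
      · exact ih c' (knows_of_point_ne_zero hx)
      have hprev' : ∀ i₀, i ∈ G i₀ → u + 1 + lev i₀ + 1 ≤ c'.1 → False := fun i₀ hi₀ hle =>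
        stuck i₀ hi₀ ⟨(c'.1 : ℕ) - 1, by omega⟩ (by simp only; omega) fun e he =>
          knows_of_point_ne_zero (hprev e (by simp only at he; omega))
      refine ⟨?_, fun i₀ hi₀ hle => ?_⟩
      · by_contra! hlt
        have := hlev i
        exact hprev' i (hG i) (by omega)
      · rcases hC i₀ i hi₀ with hiC | hlt
        · rcases hcoin with hcoin | ⟨c'', hle', hfull⟩
          · left
            refine ⟨i, hiC, m, ⟨hcomp, ?_, hm.trans ht⟩, hcoin⟩
            -- the block before is known, hence the computation has started after `t₀`
            by_contra! hlt
            refine h₀ ⟨i, (⟨(c'.1 : ℕ) - 1, by omega⟩, c'.2), by simp only; omega, Knows.mono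
              (knows_of_point_ne_zero (hprev _ (by simp only; omega))) hlt.le⟩
          · exact (stuck i₀ hi₀ c''.1 (hle.trans hle') fun e he =>
              knows_of_point_ne_zero (hfull e he)).elim
        · exact (hprev' i (hG i) (by omega)).elim
    · have hst : (A.plan z).sendTime j k ≤ t := hd.sendTime_le
      have ih := ihm j _ ((A.plan z).sendTime_nonneg j k) (CommPlan.Delivered.delay _ hd)
        (hst.trans ht) c hj
      refine ⟨ih.1, fun i₀ hi₀ hle => ?_⟩
      by_cases hjG : j ∈ G i₀
      · exact ih.2 i₀ hjG hle
      · right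
        refine ⟨j, k, ⟨hjG, hdest ▸ hi₀, ?_, hd.1, hd.2.trans
          (Finset.sum_le_sum fun u _ => (A.plan z).flow_mono j k u _ ht)⟩, r, hr, hidx⟩
        by_contra! hlt
        exact h₀ ⟨j, c, by omega, Knows.mono hj hlt.le⟩
  rintro ⟨i, c, hc, hk⟩
  have := (key i t₁ le_rfl c hk).1
  omega

end Progress

/-! ### Independent coins and random positions -/

section Coins

variable {ι κ : Type*}

theorem measure_inter_coin_eq (p : unitInterval) (q : ι × κ) {E : Set (ι → κ → Bool)}
    (hE : MeasurableSet E)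
    (hinv : ∀ ξ ξ', (∀ q', q' ≠ q → ξ q'.1 q'.2 = ξ' q'.1 q'.2) → ξ ∈ E → ξ' ∈ E) :
    (Measure.infinitePi fun _ : ι => Measure.infinitePi fun _ : κ => coin p)
        (E ∩ {ξ | ξ q.1 q.2 = true}) =
      ENNReal.ofReal p *
        (Measure.infinitePi fun _ : ι => Measure.infinitePi fun _ : κ => coin p) E := by
  classical
  set μ := Measure.infinitePi fun _ : ι => Measure.infinitePi fun _ : κ => coin p with hμ
  have hind : ProbabilityTheory.iIndepFun (fun (p : ι × κ) (ξ : ι → κ → Bool) => ξ p.1 p.2) μ :=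
    ProbabilityTheory.iIndepFun_uncurry_infinitePi' (X := fun _ _ => id)
      (fun _ _ => coin p) fun _ _ => measurable_id
  have hmeas : ∀ q : ι × κ, Measurable fun ξ : ι → κ → Bool => ξ q.1 q.2 := fun q =>
    (measurable_pi_apply q.2).comp (measurable_pi_apply q.1)
  set m : ι × κ → MeasurableSpace (ι → κ → Bool) := fun q =>
    MeasurableSpace.comap (fun ξ => ξ q.1 q.2) ⊤ with hm
  have hle : ∀ q, m q ≤ MeasurableSpace.pi := fun q => (hmeas q).comap_le
  have hindep := ProbabilityTheory.indep_iSup_of_disjoint hle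
    ((ProbabilityTheory.iIndepFun_iff_iIndep _ _ _).1 hind) (S := {q}ᶜ) (T := {q})
    disjoint_compl_left
  -- the event can be recovered from the other coins
  set h : (ι → κ → Bool) → ι → κ → Bool := fun ξ a c => if (a, c) = q then false else ξ a c
    with hh
  have hpre : E = h ⁻¹' E := by
    ext ξ
    refine ⟨hinv ξ (h ξ) fun q' hq' => ?_, hinv (h ξ) ξ fun q' hq' => ?_⟩ <;> simp [hh, hq']
  have hE' : MeasurableSet[⨆ q' ∈ ({q}ᶜ : Set (ι × κ)), m q'] E := by
    rw [hpre]
    have hmh : @Measurable _ _ (⨆ q' ∈ ({q}ᶜ : Set (ι × κ)), m q') _ h := by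
      refine @measurable_pi_lambda _ _ _ (⨆ q' ∈ ({q}ᶜ : Set (ι × κ)), m q') _ _ fun a =>
        @measurable_pi_lambda _ _ _ (⨆ q' ∈ ({q}ᶜ : Set (ι × κ)), m q') _ _ fun c => ?_
      by_cases hq : (a, c) = q
      · simp only [hh, hq, if_true]
        exact @measurable_const _ _ _ (⨆ q' ∈ ({q}ᶜ : Set (ι × κ)), m q') _
      · simp only [hh, hq, if_false]
        have h1 : m (a, c) ≤ ⨆ q' ∈ ({q}ᶜ : Set (ι × κ)), m q' :=
          le_iSup₂_of_le (f := fun q' (_ : q' ∈ ({q}ᶜ : Set (ι × κ))) => m q') (a, c) hq le_rfl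
        exact Measurable.mono (comap_measurable _) h1 le_rfl
    exact hmh hE
  have hq' : MeasurableSet[⨆ q' ∈ ({q} : Set (ι × κ)), m q'] {ξ | ξ q.1 q.2 = true} := by
    have h1 : m q ≤ ⨆ q' ∈ ({q} : Set (ι × κ)), m q' :=
      le_iSup₂_of_le (f := fun q' (_ : q' ∈ ({q} : Set (ι × κ))) => m q') q rfl le_rfl
    exact h1 _ ⟨{true}, trivial, by ext; simp⟩
  rw [(ProbabilityTheory.Indep_iff _ _ _).1 hindep _ _ hE' hq', mul_comm]
  congr 1
  have h1 : {ξ : ι → κ → Bool | ξ q.1 q.2 = true} =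
      (fun ξ : ι → κ → Bool => ξ q.1) ⁻¹' ((fun v : κ → Bool => v q.2) ⁻¹' {true}) := by
    ext; simp
  rw [h1, ← Measure.map_apply (measurable_pi_apply q.1)
      ((measurableSet_singleton true).preimage (measurable_pi_apply q.2)),
    Measure.infinitePi_map_eval, ← Measure.map_apply (measurable_pi_apply q.2)
      (measurableSet_singleton true), Measure.infinitePi_map_eval, coin_true]

/-- Finitely many coins come up independently of an event that does not depend on them. -/
theorem measure_inter_coins_eq (p : unitInterval) (Q : Finset (ι × κ)) {E : Set (ι → κ → Bool)}
    (hE : MeasurableSet E)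
    (hinv : ∀ ξ ξ', (∀ q ∉ Q, ξ q.1 q.2 = ξ' q.1 q.2) → ξ ∈ E → ξ' ∈ E) :
    (Measure.infinitePi fun _ : ι => Measure.infinitePi fun _ : κ => coin p)
        (E ∩ {ξ | ∀ q ∈ Q, ξ q.1 q.2 = true}) =
      ENNReal.ofReal p ^ Q.card *
        (Measure.infinitePi fun _ : ι => Measure.infinitePi fun _ : κ => coin p) E := by
  classical
  induction Q using Finset.induction_on with
  | empty => simp
  | insert q Q hq ih =>
    have hcoins : MeasurableSet {ξ : ι → κ → Bool | ∀ q ∈ Q, ξ q.1 q.2 = true} := by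
      have : {ξ : ι → κ → Bool | ∀ q ∈ Q, ξ q.1 q.2 = true} =
          ⋂ q ∈ Q, (fun ξ : ι → κ → Bool => ξ q.1 q.2) ⁻¹' {true} := by ext; simp
      rw [this]
      exact Finset.measurableSet_biInter _ fun q _ => (measurableSet_singleton true).preimage
        ((measurable_pi_apply q.2).comp (measurable_pi_apply q.1))
    have e : E ∩ {ξ | ∀ q' ∈ insert q Q, ξ q'.1 q'.2 = true} =
        (E ∩ {ξ | ∀ q ∈ Q, ξ q.1 q.2 = true}) ∩ {ξ | ξ q.1 q.2 = true} := by
      ext ξ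
      simp only [Finset.forall_mem_insert, Set.mem_inter_iff, Set.mem_ofPred_eq]
      tauto
    rw [e, measure_inter_coin_eq p q (hE.inter hcoins), ih, Finset.card_insert_of_notMem hq,
      pow_succ', mul_assoc]
    · exact fun ξ ξ' h => hinv ξ ξ' fun q' hq' => h q' fun hQ => hq' (Finset.mem_insert_of_mem hQ)
    · intro ξ ξ' h hξ
      refine ⟨hinv ξ ξ' (fun q' hq' => h q' fun e => hq' (e ▸ Finset.mem_insert_self _ _)) hξ.1,
        fun q' hq' => ?_⟩
      rw [← h q' fun e => hq (e ▸ hq')]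
      exact hξ.2 q' hq'

end Coins

section Positions

open scoped Classical

variable {J : Type*} [Fintype J] [DecidableEq J] {d : ℕ}

/-- Given all other positions, one position of a random injection is nearly uniform. -/
theorem sum_position_mem_le {ρ : ENNReal} (S : Set (Fin d))
    (hS : (S.ncard : ENNReal) ≤ ρ * (d - Fintype.card J : ℕ)) (c : J) (Φ : (J ↪ Fin d) → ENNReal)
    (hΦ : ∀ π π' : J ↪ Fin d, (∀ e, e ≠ c → π e = π' e) → Φ π = Φ π') :
    ∑ π : J ↪ Fin d, (if π c ∈ S then Φ π else 0) ≤ ρ * ∑ π, Φ π := by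
  set R : (J ↪ Fin d) → ({e // e ≠ c} → Fin d) := fun π e => π e with hR
  rw [← Finset.sum_fiberwise Finset.univ R, ← Finset.sum_fiberwise Finset.univ R Φ, Finset.mul_sum]
  refine Finset.sum_le_sum fun σ _ => ?_
  rcases (Finset.univ.filter fun π => R π = σ).eq_empty_or_nonempty with h | ⟨π₀, hπ₀⟩
  · rw [h]; simp
  have hcon : ∀ π ∈ Finset.univ.filter fun π => R π = σ, Φ π = Φ π₀ := by
    intro π hπ
    simp only [Finset.mem_filter, Finset.mem_univ, true_and] at hπ hπ₀
    exact hΦ π π₀ fun e he => congrFun (hπ.trans hπ₀.symm) ⟨e, he⟩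
  rw [Finset.sum_congr rfl hcon, Finset.sum_const, ← Finset.sum_filter]
  rw [Finset.sum_congr rfl fun π hπ => hcon π (Finset.mem_filter.1 hπ).1, Finset.sum_const,
    nsmul_eq_mul, nsmul_eq_mul, ← mul_assoc]
  refine mul_le_mul_left ?_ _
  -- the injections with the given other positions are determined by the position of `c`
  have h1 : ((Finset.univ.filter fun π => R π = σ).filter fun π => π c ∈ S).card ≤ S.ncard := by
    rw [Set.ncard_eq_toFinset_card' S]
    refine Finset.card_le_card_of_injOn (fun π => π c) (fun π hπ => ?_) fun π hπ π' hπ' h => ?_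
    · simpa using (Finset.mem_filter.1 hπ).2
    · simp only [Finset.coe_filter, Finset.mem_filter, Finset.mem_univ, true_and,
        Set.mem_ofPred_eq] at hπ hπ'
      ext e
      by_cases he : e = c
      · subst he; exact congrArg Fin.val h
      · exact congrArg Fin.val (congrFun (hπ.1.trans hπ'.1.symm) ⟨e, he⟩)
  have h2 : d - Fintype.card J ≤ (Finset.univ.filter fun π => R π = σ).card := by
    have h3 : (Finset.univ \ Finset.univ.map π₀).card = d - Fintype.card J := by
      rw [Finset.card_sdiff_of_subset (Finset.subset_univ _)]; simp
    rw [← h3]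
    have hinj : ∀ v, v ∉ Finset.univ.map π₀ → Function.Injective (Function.update π₀ c v) := by
      intro v hv a b hab
      have hv' : ∀ e, π₀ e ≠ v := fun e h => hv (by simp [← h])
      by_cases ha : a = c <;> by_cases hb : b = c
      · rw [ha, hb]
      · subst ha; rw [Function.update_self, Function.update_of_ne hb] at hab
        exact absurd hab.symm (hv' b)
      · subst hb; rw [Function.update_self, Function.update_of_ne ha] at hab
        exact absurd hab (hv' a)
      · rw [Function.update_of_ne ha, Function.update_of_ne hb] at hab
        exact π₀.injective hab
    refine Finset.card_le_card_of_injOn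
      (fun v => if hv : v ∉ Finset.univ.map π₀ then ⟨Function.update π₀ c v, hinj v hv⟩ else π₀)
      (fun v hv => ?_) fun v hv v' hv' h => ?_
    · simp only [Finset.coe_sdiff, Set.mem_sdiff, Finset.mem_coe] at hv
      rw [Finset.mem_coe, Finset.mem_filter]
      refine ⟨Finset.mem_univ _, ?_⟩
      rw [← (Finset.mem_filter.1 hπ₀).2]
      dsimp only
      rw [dif_pos hv.2]
      funext e
      simp [hR, Function.update_of_ne e.2]
    · simp only [Finset.coe_sdiff, Set.mem_sdiff, Finset.mem_coe] at hv hv'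
      simp only [dif_pos hv.2, dif_pos hv'.2] at h
      have := DFunLike.congr_fun h c
      simpa using this
  calc (((Finset.univ.filter fun π => R π = σ).filter fun π => π c ∈ S).card : ENNReal)
      ≤ S.ncard := by exact_mod_cast h1
    _ ≤ ρ * (d - Fintype.card J : ℕ) := hS
    _ ≤ _ := by gcongr

/-- Several positions of a random injection lie in a small set with small probability. -/
theorem sum_positions_mem_le {ρ : ENNReal} (S : Set (Fin d))
    (hS : (S.ncard : ENNReal) ≤ ρ * (d - Fintype.card J : ℕ)) (Q : Finset J)
    (Φ : (J ↪ Fin d) → ENNReal)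
    (hΦ : ∀ π π' : J ↪ Fin d, (∀ e ∉ Q, π e = π' e) → Φ π = Φ π') :
    ∑ π : J ↪ Fin d, (if ∀ c ∈ Q, π c ∈ S then Φ π else 0) ≤ ρ ^ Q.card * ∑ π, Φ π := by
  induction Q using Finset.induction_on with
  | empty => simp
  | insert c Q hc ih =>
    have e : ∀ π : J ↪ Fin d, (if ∀ c' ∈ insert c Q, π c' ∈ S then Φ π else 0) =
        if π c ∈ S then (if ∀ c ∈ Q, π c ∈ S then Φ π else 0) else 0 := by
      intro π
      by_cases h : π c ∈ S <;> simp [h]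
    simp_rw [e]
    refine (sum_position_mem_le S hS c _ fun π π' h => ?_).trans ?_
    · have h1 : Φ π = Φ π' := hΦ π π' fun e he => h e fun hec => he (hec ▸ Finset.mem_insert_self _ _)
      have h2 : (∀ c ∈ Q, π c ∈ S) ↔ ∀ c ∈ Q, π' c ∈ S :=
        forall₂_congr fun a ha => by rw [h a fun hac => hc (hac ▸ ha)]
      rw [h1]
      exact if_congr h2 rfl rfl
    · rw [Finset.card_insert_of_notMem hc, pow_succ', mul_assoc]
      exact mul_le_mul_right (ih fun π π' h => hΦ π π' fun e he => h e fun hQ =>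
        he (Finset.mem_insert_of_mem hQ)) _

end Positions

/-! ### The number of trials -/

section Trials

variable {n d B K : ℕ} {N : Network n} {Z : Type*} [MeasurableSpace Z] (A : Algorithm N d Z)
  (s lam p : ℝ) (z : Z) (π : Chain B K ↪ Fin d)

theorem measurable_input {Ξ Ω : Type*} [MeasurableSpace Ξ] [MeasurableSpace Ω]
    {g : Vec d → Ξ → Vec d} {z : Ω → Z} {ξ : Ω → Fin n × ℕ → Ξ}
    (hg : Measurable (Function.uncurry g)) (hz : Measurable z) (hξ : Measurable ξ) (i : Fin n)
    (m : ℕ) : Measurable fun ω => A.input g (z ω) (ξ ω) i m := by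
  have h := measurable_loopState A hg hz hξ (measurable_content A hg hz hξ) i m
  exact hz.prodMk (h.fst.prodMk (h.snd.prodMk
    (measurable_received A hz (measurable_content A hg hz hξ) h.fst i)))

theorem measurableSet_trial (t₀ t₁ : ℝ) (j : Fin n) (m : ℕ) :
    MeasurableSet {ξ | Trial A s lam p z π ξ t₀ t₁ j m} := by
  have hi := measurable_input A (measurable_hardOracle π s lam p) (z := fun _ => z)
    (ξ := fun ξ : Fin n × ℕ → Chain B K → Bool => ξ) measurable_const measurable_id j m
  have hs : Measurable fun ξ => A.start (hardOracle π s lam p) z ξ j m := hi.snd.fst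
  refine MeasurableSet.inter ?_ (MeasurableSet.inter ?_ ?_)
  · exact ((A.measurable_compute j m).comp hi) (measurableSet_singleton true)
  · exact measurableSet_le measurable_const hs
  · exact measurableSet_le (hs.add_const _) measurable_const

theorem measurableSet_reached {Ω : Type*} [MeasurableSpace Ω] {z : Ω → Z}
    {ξ : Ω → Fin n × ℕ → Chain B K → Bool} (hz : Measurable z) (hξ : Measurable ξ) (u : ℕ)
    (t : ℝ) : MeasurableSet {ω | Reached A s lam p (z ω) π (ξ ω) u t} := by
  have : {ω | Reached A s lam p (z ω) π (ξ ω) u t} = ⋃ (i : Fin n) (c : Chain B K) (_ : u ≤ c.1),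
      {ω | π c ∈ (A.info (hardOracle π s lam p) (z ω) (ξ ω) i t).support} := by
    ext ω
    simp [Reached, Knows]
  rw [this]
  exact MeasurableSet.iUnion fun i => MeasurableSet.iUnion fun c => MeasurableSet.iUnion fun _ =>
    measurableSet_mem_info_support A (measurable_hardOracle π s lam p) hz hξ i t (π c)

variable {s lam p z π} {ξ : Fin n × ℕ → Chain B K → Bool} {t₀ t₁ : ℝ}

open scoped Classical in
/-- The number of trials of worker `j` before iteration `m`. -/
def ordinal (s lam p : ℝ) (z : Z) (π : Chain B K ↪ Fin d) (ξ : Fin n × ℕ → Chain B K → Bool)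
    (t₀ t₁ : ℝ) (j : Fin n) (m : ℕ) : ℕ :=
  ((Finset.range m).filter fun m' => Trial A s lam p z π ξ t₀ t₁ j m').card

theorem ordinal_lt_ordinal {j : Fin n} {m m' : ℕ} (h : m < m')
    (hm : Trial A s lam p z π ξ t₀ t₁ j m) :
    ordinal A s lam p z π ξ t₀ t₁ j m < ordinal A s lam p z π ξ t₀ t₁ j m' := by
  classical
  refine Finset.card_lt_card (Finset.ssubset_iff_of_subset ?_ |>.2 ⟨m, ?_, ?_⟩)
  · exact Finset.filter_subset_filter _ (Finset.range_mono h.le)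
  · simp [h, hm]
  · simp

/-- The computations of one worker follow one another. -/
theorem ordinal_lt_floor {j : Fin n} {m : ℕ} (hm : Trial A s lam p z π ξ t₀ t₁ j m) :
    ordinal A s lam p z π ξ t₀ t₁ j m < ⌊(t₁ - t₀) / N.time j⌋₊ := by
  classical
  have hpos := N.time_pos j
  have key : ∀ m, t₀ ≤ A.start (hardOracle π s lam p) z ξ j m →
      t₀ + ordinal A s lam p z π ξ t₀ t₁ j m * N.time j ≤
        A.start (hardOracle π s lam p) z ξ j m := by
    intro m
    induction m with
    | zero => intro h; simpa [ordinal] using h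
    | succ m ih =>
      intro h
      have hmono := A.monotone_start (g := hardOracle π s lam p) (z := z) (ξ := ξ) j (Nat.le_succ m)
      by_cases ht : Trial A s lam p z π ξ t₀ t₁ j m
      · have h1 : ordinal A s lam p z π ξ t₀ t₁ j (m + 1) =
            ordinal A s lam p z π ξ t₀ t₁ j m + 1 := by
          unfold ordinal
          rw [Finset.range_add_one, Finset.filter_insert, if_pos ht,
            Finset.card_insert_of_notMem (by simp)]
        rw [h1, A.start_succ ht.1]
        have := ih ht.2.1
        push_cast
        linarith
      · have h1 : ordinal A s lam p z π ξ t₀ t₁ j (m + 1) = ordinal A s lam p z π ξ t₀ t₁ j m := by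
          unfold ordinal
          rw [Finset.range_add_one, Finset.filter_insert, if_neg ht]
        rw [h1]
        rcases le_or_gt t₀ (A.start (hardOracle π s lam p) z ξ j m) with h2 | h2
        · exact (ih h2).trans hmono
        · have h3 : ordinal A s lam p z π ξ t₀ t₁ j m = 0 := by
            unfold ordinal
            rw [Finset.card_eq_zero, Finset.filter_eq_empty_iff]
            intro m' hm' ht'
            have := A.monotone_start (g := hardOracle π s lam p) (z := z) (ξ := ξ) j
              (Finset.mem_range.1 hm').le
            exact absurd (ht'.2.1.trans this) h2.not_ge
          rw [h3]
          simpa using h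
  have h1 := key m hm.2.1
  have h2 := hm.2.2
  rw [← Nat.add_one_le_iff, Nat.le_floor_iff', le_div_iff₀ hpos]
  · push_cast
    linarith
  · omega

variable {β : Fin B} {R : Finset (Fin K)}

open scoped Classical in
/-- The world in which, for all `r ∈ R`, the coin of index `(β, r)` is made to come up in the
iteration `e r`. -/
def force (β : Fin B) (e : R → Fin n × ℕ) (ξ : Fin n × ℕ → Chain B K → Bool) :
    Fin n × ℕ → Chain B K → Bool :=
  fun a c => if ∃ r : R, c = (β, (r : Fin K)) ∧ e r = a then true else ξ a c

/-- In the world in which the coins are made to come up in the iterations `e r`, these are trials of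
workers in `C`. -/
def Valid (s lam p : ℝ) (z : Z) (π : Chain B K ↪ Fin d) (t₀ t₁ : ℝ) (C : Finset (Fin n))
    (β : Fin B) (e : R → Fin n × ℕ) (ξ : Fin n × ℕ → Chain B K → Bool) : Prop :=
  ∀ r, (e r).1 ∈ C ∧ Trial A s lam p z π (force β e ξ) t₀ t₁ (e r).1 (e r).2

variable {C : Finset (Fin n)}

/-- Two assignments of trials with the same ordinals cannot differ first at `r₀`: until the trial
`e r₀` is completed, the two forced worlds are indistinguishable. -/
theorem Valid.eq_of_first {e e' : R → Fin n × ℕ} (he : Valid A s lam p z π t₀ t₁ C β e ξ)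
    (he' : Valid A s lam p z π t₀ t₁ C β e' ξ) (hw : ∀ r, (e r).1 = (e' r).1)
    (ho : ∀ r, ordinal A s lam p z π (force β e ξ) t₀ t₁ (e r).1 (e r).2 =
      ordinal A s lam p z π (force β e' ξ) t₀ t₁ (e' r).1 (e' r).2) (r₀ : R)
    (hmin : ∀ r, e r ≠ e' r →
      A.start (hardOracle π s lam p) z (force β e ξ) (e r₀).1 (e r₀).2 + N.time (e r₀).1 ≤
        A.start (hardOracle π s lam p) z (force β e ξ) (e r).1 (e r).2 + N.time (e r).1)
    (hmin' : ∀ r, e r ≠ e' r →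
      A.start (hardOracle π s lam p) z (force β e ξ) (e r₀).1 (e r₀).2 + N.time (e r₀).1 ≤
        A.start (hardOracle π s lam p) z (force β e' ξ) (e' r).1 (e' r).2 + N.time (e' r).1) :
    e r₀ = e' r₀ := by
  set τ := A.start (hardOracle π s lam p) z (force β e ξ) (e r₀).1 (e r₀).2 + N.time (e r₀).1
    with hτ
  have hs : A.SameUpTo (hardOracle π s lam p) (hardOracle π s lam p) z (force β e ξ) (force β e' ξ)
      (Set.Iio τ) := by
    refine ⟨isLowerSet_Iio τ, fun i m hin _ hm => ?_⟩
    have hst : A.start (hardOracle π s lam p) z (force β e ξ) i m =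
        A.start (hardOracle π s lam p) z (force β e' ξ) i m := congrArg (fun a => a.2.1) hin
    have hm' := Set.mem_Iio.1 hm
    congr 1
    funext c
    unfold force
    refine if_congr ⟨?_, ?_⟩ rfl rfl
    · rintro ⟨r, hc, hr⟩
      by_cases h : e r = e' r
      · exact ⟨r, hc, h ▸ hr⟩
      · have := hmin r h
        rw [hr] at this
        exact absurd hm' this.not_gt
    · rintro ⟨r, hc, hr⟩
      by_cases h : e r = e' r
      · exact ⟨r, hc, h ▸ hr⟩
      · have := hmin' r h
        rw [hr, ← hst] at this
        exact absurd hm' this.not_gt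
  have hmem : ∀ m ≤ (e r₀).2,
      A.start (hardOracle π s lam p) z (force β e ξ) (e r₀).1 m ∈ Set.Iio τ := fun m hm => by
    have h1 := A.monotone_start (g := hardOracle π s lam p) (z := z) (ξ := force β e ξ) (e r₀).1 hm
    have h2 := N.time_pos (e r₀).1
    rw [Set.mem_Iio]
    linarith
  have htrial : ∀ m ≤ (e r₀).2, Trial A s lam p z π (force β e ξ) t₀ t₁ (e r₀).1 m ↔
      Trial A s lam p z π (force β e' ξ) t₀ t₁ (e r₀).1 m := fun m hm => by
    unfold Trial
    rw [hs.computes_iff (hmem m hm), hs.start_eq (hmem m hm)]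
  have hord : ordinal A s lam p z π (force β e ξ) t₀ t₁ (e r₀).1 (e r₀).2 =
      ordinal A s lam p z π (force β e' ξ) t₀ t₁ (e r₀).1 (e r₀).2 := by
    classical
    unfold ordinal
    congr 1
    exact Finset.filter_congr fun m hm => htrial m (Finset.mem_range.1 hm).le
  have h1 := (htrial _ le_rfl).1 (he r₀).2
  have h2 := (he' r₀).2
  have h3 := ho r₀
  rw [hord] at h3
  rw [← hw r₀] at h2 h3
  refine Prod.ext (hw r₀) ?_
  rcases lt_trichotomy (e r₀).2 (e' r₀).2 with h | h | h
  · exact absurd h3 (ordinal_lt_ordinal A h h1).ne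
  · exact h
  · exact absurd h3.symm (ordinal_lt_ordinal A h h2).ne

theorem Valid.eq {e e' : R → Fin n × ℕ} (he : Valid A s lam p z π t₀ t₁ C β e ξ)
    (he' : Valid A s lam p z π t₀ t₁ C β e' ξ) (hw : ∀ r, (e r).1 = (e' r).1)
    (ho : ∀ r, ordinal A s lam p z π (force β e ξ) t₀ t₁ (e r).1 (e r).2 =
      ordinal A s lam p z π (force β e' ξ) t₀ t₁ (e' r).1 (e' r).2) : e = e' := by
  classical
  by_contra hne
  set D : Finset R := Finset.univ.filter fun r => e r ≠ e' r with hD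
  have hDne : D.Nonempty := by
    obtain ⟨r, hr⟩ := Function.ne_iff.1 hne
    exact ⟨r, by simpa [hD] using hr⟩
  have hmem : ∀ r, r ∈ D ↔ e r ≠ e' r := fun r => by simp [hD]
  obtain ⟨r₁, h₁, hmin₁⟩ := Finset.exists_min_image D (fun r =>
    A.start (hardOracle π s lam p) z (force β e ξ) (e r).1 (e r).2 + N.time (e r).1) hDne
  obtain ⟨r₂, h₂, hmin₂⟩ := Finset.exists_min_image D (fun r =>
    A.start (hardOracle π s lam p) z (force β e' ξ) (e' r).1 (e' r).2 + N.time (e' r).1) hDne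
  rcases le_total (A.start (hardOracle π s lam p) z (force β e ξ) (e r₁).1 (e r₁).2 +
      N.time (e r₁).1) (A.start (hardOracle π s lam p) z (force β e' ξ) (e' r₂).1 (e' r₂).2 +
      N.time (e' r₂).1) with h | h
  · exact (hmem r₁).1 h₁ (Valid.eq_of_first A he he' hw ho r₁
      (fun r hr => hmin₁ r ((hmem r).2 hr)) fun r hr => h.trans (hmin₂ r ((hmem r).2 hr)))
  · exact (hmem r₂).1 h₂ (Valid.eq_of_first A he' he (fun r => (hw r).symm) (fun r => (ho r).symm)
      r₂ (fun r hr => hmin₂ r ((hmem r).2 hr.symm))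
      fun r hr => h.trans (hmin₁ r ((hmem r).2 hr.symm))).symm

/-- The number of valid assignments of trials is bounded as if the trials were not adaptive. -/
theorem encard_valid_le (ξ : Fin n × ℕ → Chain B K → Bool) :
    {e : R → Fin n × ℕ | Valid A s lam p z π t₀ t₁ C β e ξ}.encard ≤
      ((∑ j ∈ C, ⌊(t₁ - t₀) / N.time j⌋₊) ^ R.card : ℕ) := by
  classical
  set T := C.sigma fun j => Finset.range ⌊(t₁ - t₀) / N.time j⌋₊ with hT
  set F : (R → Fin n × ℕ) → R → (Σ _ : Fin n, ℕ) := fun e r =>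
    ⟨(e r).1, ordinal A s lam p z π (force β e ξ) t₀ t₁ (e r).1 (e r).2⟩ with hF
  have hmaps : Set.MapsTo F {e | Valid A s lam p z π t₀ t₁ C β e ξ}
      (Fintype.piFinset fun _ : R => T : Finset (R → (Σ _ : Fin n, ℕ))) := by
    intro e he
    rw [Finset.mem_coe, Fintype.mem_piFinset]
    intro r
    rw [hT, Finset.mem_sigma]
    exact ⟨(he r).1, Finset.mem_range.2 (ordinal_lt_floor A (he r).2)⟩
  have hinj : Set.InjOn F {e | Valid A s lam p z π t₀ t₁ C β e ξ} := by
    intro e he e' he' h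
    have h1 : ∀ r, (e r).1 = (e' r).1 ∧
        ordinal A s lam p z π (force β e ξ) t₀ t₁ (e r).1 (e r).2 =
          ordinal A s lam p z π (force β e' ξ) t₀ t₁ (e' r).1 (e' r).2 := fun r => by
      have := congrFun h r
      simp only [hF, Sigma.mk.injEq, heq_eq_eq] at this
      exact this
    exact Valid.eq A he he' (fun r => (h1 r).1) fun r => (h1 r).2
  refine (Set.encard_le_encard_of_injOn hmaps hinj).trans ?_
  rw [Set.encard_coe_eq_coe_finsetCard, Fintype.card_piFinset, Finset.prod_const, Finset.card_univ,
    Fintype.card_coe, hT, Finset.card_sigma]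
  simp

theorem measurable_force (e : R → Fin n × ℕ) : Measurable (force (K := K) β e) := by
  classical
  refine measurable_pi_iff.2 fun a => measurable_pi_iff.2 fun c => ?_
  unfold force
  split_ifs
  · exact measurable_const
  · exact (measurable_pi_apply c).comp (measurable_pi_apply a)

theorem measurableSet_valid (e : R → Fin n × ℕ) :
    MeasurableSet {ξ | Valid A s lam p z π t₀ t₁ C β e ξ} := by
  have : {ξ | Valid A s lam p z π t₀ t₁ C β e ξ} = ⋂ r, {ξ | (e r).1 ∈ C} ∩
      force β e ⁻¹' {ξ | Trial A s lam p z π ξ t₀ t₁ (e r).1 (e r).2} := by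
    ext ξ
    simp [Valid]
  rw [this]
  exact MeasurableSet.iInter fun r => (MeasurableSet.const _).inter
    ((measurableSet_trial A s lam p z π t₀ t₁ _ _).preimage (measurable_force e))

/-- The coins of the indices `(β, r)`, `r ∈ R`, all come up within the window with a probability
that is bounded as if the trials were not adaptive. Here `E` is an event that does not depend on the
coins of block `β`. -/
theorem measure_hit_le (P : unitInterval) {E : Set (Fin n × ℕ → Chain B K → Bool)}
    (hE : MeasurableSet E)
    (hinv : ∀ ξ ξ', (∀ a, ∀ c : Chain B K, c.1 ≠ β → ξ a c = ξ' a c) → ξ ∈ E → ξ' ∈ E) :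
    (Measure.infinitePi fun _ : Fin n × ℕ => coins B K P)
      (E ∩ {ξ | ∀ r ∈ R, ∃ j ∈ C, ∃ m, Trial A s lam p z π ξ t₀ t₁ j m ∧ ξ (j, m) (β, r) = true}) ≤
    (ENNReal.ofReal P * (∑ j ∈ C, ⌊(t₁ - t₀) / N.time j⌋₊ : ℕ)) ^ R.card *
      (Measure.infinitePi fun _ : Fin n × ℕ => coins B K P) E := by
  classical
  set μ := Measure.infinitePi fun _ : Fin n × ℕ => coins B K P with hμ
  set V : (R → Fin n × ℕ) → Set (Fin n × ℕ → Chain B K → Bool) := fun e =>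
    E ∩ {ξ | Valid A s lam p z π t₀ t₁ C β e ξ} with hV
  have hVm : ∀ e, MeasurableSet (V e) := fun e => hE.inter (measurableSet_valid A e)
  set Q : (R → Fin n × ℕ) → Finset ((Fin n × ℕ) × Chain B K) := fun e =>
    Finset.univ.image fun r : R => (e r, (β, (r : Fin K))) with hQ
  have hQmem : ∀ e q, q ∈ Q e ↔ ∃ r : R, q.2 = (β, (r : Fin K)) ∧ e r = q.1 := by
    intro e q
    simp only [hQ, Finset.mem_image, Finset.mem_univ, true_and]
    constructor
    · rintro ⟨r, rfl⟩; exact ⟨r, rfl, rfl⟩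
    · rintro ⟨r, h1, h2⟩; exact ⟨r, Prod.ext h2 h1.symm⟩
  have hQcard : ∀ e, (Q e).card = R.card := fun e => by
    rw [hQ, Finset.card_image_of_injective, Finset.card_univ, Fintype.card_coe]
    intro r r' h
    exact Subtype.ext (congrArg (fun q => q.2.2) h)
  have hsub : E ∩ {ξ | ∀ r ∈ R, ∃ j ∈ C, ∃ m, Trial A s lam p z π ξ t₀ t₁ j m ∧
      ξ (j, m) (β, r) = true} ⊆ ⋃ e, V e ∩ {ξ | ∀ q ∈ Q e, ξ q.1 q.2 = true} := by
    rintro ξ ⟨hξE, hξ⟩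
    have hξ' : ∀ r : R, ∃ a : Fin n × ℕ, a.1 ∈ C ∧ Trial A s lam p z π ξ t₀ t₁ a.1 a.2 ∧
        ξ a (β, (r : Fin K)) = true := fun r => by
      obtain ⟨j, hj, m, h⟩ := hξ r r.2
      exact ⟨(j, m), hj, h⟩
    choose e he1 he2 he3 using hξ'
    have hforce : force β e ξ = ξ := by
      funext a c
      unfold force
      split_ifs with h
      · obtain ⟨r, rfl, rfl⟩ := h
        exact (he3 r).symm
      · rfl
    refine Set.mem_iUnion.2 ⟨e, ⟨hξE, fun r => ⟨he1 r, ?_⟩⟩, fun q hq => ?_⟩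
    · rw [hforce]; exact he2 r
    · obtain ⟨r, h1, h2⟩ := (hQmem e q).1 hq
      rw [h1, ← h2]
      exact he3 r
  have hprob : ∀ e, μ (V e ∩ {ξ | ∀ q ∈ Q e, ξ q.1 q.2 = true}) =
      ENNReal.ofReal P ^ R.card * μ (V e) := by
    intro e
    rw [← hQcard e]
    refine measure_inter_coins_eq P (Q e) (hVm e) fun ξ ξ' h hξ => ⟨hinv ξ ξ' ?_ hξ.1, ?_⟩
    · intro a c hc
      refine h (a, c) fun hq => ?_
      obtain ⟨r, h1, -⟩ := (hQmem e _).1 hq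
      exact hc (congrArg Prod.fst h1)
    · have hforce : force β e ξ = force β e ξ' := by
        funext a c
        unfold force
        split_ifs with hr
        · rfl
        · exact h (a, c) fun hq => hr ((hQmem e (a, c)).1 hq)
      intro r
      rw [← hforce]
      exact hξ.2 r
  have hsum : ∑' e, μ (V e) ≤ ((∑ j ∈ C, ⌊(t₁ - t₀) / N.time j⌋₊ : ℕ) : ENNReal) ^ R.card * μ E := by
    calc ∑' e, μ (V e) = ∑' e, ∫⁻ ξ, (V e).indicator 1 ξ ∂μ :=
          tsum_congr fun e => (lintegral_indicator_one (hVm e)).symm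
      _ = ∫⁻ ξ, ∑' e, (V e).indicator 1 ξ ∂μ :=
          (lintegral_tsum fun e => (measurable_one.indicator (hVm e)).aemeasurable).symm
      _ ≤ ∫⁻ ξ, E.indicator (fun _ =>
            ((∑ j ∈ C, ⌊(t₁ - t₀) / N.time j⌋₊ : ℕ) : ENNReal) ^ R.card) ξ ∂μ := by
          refine lintegral_mono fun ξ => ?_
          by_cases hξ : ξ ∈ E
          · rw [Set.indicator_of_mem hξ]
            have h1 : ∑' e, (V e).indicator (1 : (Fin n × ℕ → Chain B K → Bool) → ENNReal) ξ =
                ∑' e, {e : R → Fin n × ℕ | Valid A s lam p z π t₀ t₁ C β e ξ}.indicator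
                  (fun _ => (1 : ENNReal)) e := by
              refine tsum_congr fun e => ?_
              simp [hV, Set.indicator_apply, hξ]
            rw [h1, ← tsum_subtype, ENNReal.tsum_set_one]
            have h2 := encard_valid_le A (s := s) (lam := lam) (p := p) (z := z) (π := π) (t₀ := t₀)
              (t₁ := t₁) (C := C) (β := β) (R := R) ξ
            have h3 := ENat.toENNReal_mono h2
            refine h3.trans (le_of_eq ?_)
            rw [ENat.toENNReal_coe]
            push_cast
            rfl
          · rw [Set.indicator_of_notMem hξ]
            simp [hV, hξ]
      _ = _ := by rw [lintegral_indicator_const hE]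
  calc _ ≤ μ (⋃ e, V e ∩ {ξ | ∀ q ∈ Q e, ξ q.1 q.2 = true}) := measure_mono hsub
    _ ≤ ∑' e, μ (V e ∩ {ξ | ∀ q ∈ Q e, ξ q.1 q.2 = true}) := measure_iUnion_le _
    _ = ENNReal.ofReal P ^ R.card * ∑' e, μ (V e) := by
        simp_rw [hprob]; rw [ENNReal.tsum_mul_left]
    _ ≤ _ := by
        rw [mul_pow, mul_assoc]
        exact mul_le_mul_right hsum _

end Trials

/-! ### The probability of fast progress -/

section FastProgress

open scoped Classical

variable {n d B K : ℕ} {N : Network n} {Z : Type*} [MeasurableSpace Z] (A : Algorithm N d Z)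
  {s lam p : ℝ} {z : Z} {t₀ t₁ : ℝ}

/-- Over random coins and random positions, a complete block `β` is got within a window with
probability at most `(q + ρ) ^ K`, where `q` bounds the expected number of times that one coin comes
up and `ρ` the fraction of the coordinates that can be sent. Each of the `K` coordinates is either
hit or sent, and the binomial theorem sums over the set `R` of those which are hit. -/
theorem sum_measure_got_le (P : unitInterval) (C : Finset (Fin n)) (G : Set (Fin n)) (β : Fin B)
    {q ρ : ENNReal} (hq : ENNReal.ofReal P * (∑ j ∈ C, ⌊(t₁ - t₀) / N.time j⌋₊ : ℕ) ≤ q)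
    (hρ : (((A.plan z).enteringCoords G t₀ t₁).ncard : ENNReal) ≤
      ρ * (d - Fintype.card (Chain B K) : ℕ))
    {E : (Chain B K ↪ Fin d) → Set (Fin n × ℕ → Chain B K → Bool)}
    (hE : ∀ π, MeasurableSet (E π))
    (hEξ : ∀ π ξ ξ', (∀ a, ∀ c : Chain B K, c.1 ≠ β → ξ a c = ξ' a c) → ξ ∈ E π → ξ' ∈ E π)
    (hEπ : ∀ π π' : Chain B K ↪ Fin d, (∀ c : Chain B K, c.1 ≠ β → π c = π' c) → E π = E π') :
    ∑ π, (Measure.infinitePi fun _ : Fin n × ℕ => coins B K P)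
        (E π ∩ {ξ | ∀ r, Got A s lam p z π ξ C G t₀ t₁ (β, r)}) ≤
      (q + ρ) ^ K * ∑ π, (Measure.infinitePi fun _ : Fin n × ℕ => coins B K P) (E π) := by
  set μ := Measure.infinitePi fun _ : Fin n × ℕ => coins B K P with hμ
  set S := (A.plan z).enteringCoords G t₀ t₁ with hS
  set Q : Finset (Fin K) → Finset (Chain B K) := fun R => Rᶜ.image (Prod.mk β) with hQ
  have hQcard : ∀ R, (Q R).card = K - R.card := fun R => by
    rw [hQ, Finset.card_image_of_injective _ (Prod.mk_right_injective β), Finset.card_compl,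
      Fintype.card_fin]
  set H : (Chain B K ↪ Fin d) → Finset (Fin K) → Set (Fin n × ℕ → Chain B K → Bool) := fun π R =>
    {ξ | ∀ r ∈ R, ∃ j ∈ C, ∃ m, Trial A s lam p z π ξ t₀ t₁ j m ∧ ξ (j, m) (β, r) = true} with hH
  have hcover : ∀ π, μ (E π ∩ {ξ | ∀ r, Got A s lam p z π ξ C G t₀ t₁ (β, r)}) ≤
      ∑ R, q ^ R.card * (if ∀ c ∈ Q R, π c ∈ S then μ (E π) else 0) := by
    intro π
    have hsub : E π ∩ {ξ | ∀ r, Got A s lam p z π ξ C G t₀ t₁ (β, r)} ⊆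
        ⋃ R ∈ Finset.univ.filter fun R => ∀ c ∈ Q R, π c ∈ S, E π ∩ H π R := by
      rintro ξ ⟨hξE, hξ⟩
      refine Set.mem_iUnion₂.2 ⟨Finset.univ.filter fun r => ∃ j ∈ C, ∃ m,
        Trial A s lam p z π ξ t₀ t₁ j m ∧ ξ (j, m) (β, r) = true, ?_, hξE, fun r hr =>
          (Finset.mem_filter.1 hr).2⟩
      rw [Finset.mem_filter]
      refine ⟨Finset.mem_univ _, fun c hc => ?_⟩
      obtain ⟨r, hr, rfl⟩ := Finset.mem_image.1 hc
      rw [Finset.mem_compl, Finset.mem_filter, not_and] at hr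
      exact (hξ r).resolve_left (hr (Finset.mem_univ _))
    refine (measure_mono hsub).trans ((measure_biUnion_finset_le _ _).trans ?_)
    rw [Finset.sum_filter]
    refine Finset.sum_le_sum fun R _ => ?_
    split_ifs
    · refine (measure_hit_le A P (hE π) (hEξ π)).trans ?_
      gcongr
    · exact zero_le
  have hpos : ∀ R, ∑ π, (if ∀ c ∈ Q R, π c ∈ S then μ (E π) else 0) ≤
      ρ ^ (K - R.card) * ∑ π, μ (E π) := by
    intro R
    rw [← hQcard]
    refine sum_positions_mem_le S hρ (Q R) _ fun π π' h => ?_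
    rw [hEπ π π' fun c hc => h c fun hcQ => hc ?_]
    obtain ⟨r, -, rfl⟩ := Finset.mem_image.1 hcQ
    rfl
  have hbin := Fintype.sum_pow_mul_eq_add_pow (Fin K) q ρ
  rw [Fintype.card_fin] at hbin
  refine (Finset.sum_le_sum fun π _ => hcover π).trans ?_
  rw [Finset.sum_comm, ← hbin, Finset.sum_mul]
  refine Finset.sum_le_sum fun R _ => ?_
  rw [← Finset.mul_sum, mul_assoc]
  exact mul_le_mul_right (hpos R) _

/-- Time is divided into slots of length `θ`. Progress from block `u` is fast if block `u + 2 + ℓ` is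
reached at the latest one slot after the slot in which block `u` is reached. -/
def Fast (A : Algorithm N d Z) (s lam p : ℝ) (z : Z) (π : Chain B K ↪ Fin d)
    (ξ : Fin n × ℕ → Chain B K → Bool) (θ : ℝ) (W u v : ℕ) : Prop :=
  ∃ k < W, ¬ Reached A s lam p z π ξ u (k * θ) ∧ Reached A s lam p z π ξ u ((k + 1) * θ) ∧
    Reached A s lam p z π ξ v ((k + 2) * θ)

variable {P : unitInterval}

/-- Fast progress is improbable: a worker has to get a complete block within the two slots. -/
theorem sum_measure_fast_le (z : Z) {ℓ u W : ℕ} {θ : ℝ} (hθ : 0 ≤ θ)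
    {lev : Fin n → ℕ} {G : Fin n → Set (Fin n)} {C : Fin n → Finset (Fin n)}
    (hlev : ∀ i, lev i ≤ ℓ) (hG : ∀ i, i ∈ G i) (hC : ∀ i j, j ∈ G i → j ∈ C i ∨ lev j < lev i)
    {q ρ : ENNReal}
    (hq : ∀ i, ENNReal.ofReal P * (∑ j ∈ C i, ⌊2 * θ / N.time j⌋₊ : ℕ) ≤ q)
    (hρ : ∀ i, ∀ t, (((A.plan z).enteringCoords (G i) t (t + 2 * θ)).ncard : ENNReal) ≤
      ρ * (d - Fintype.card (Chain B K) : ℕ)) :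
    ∑ π : Chain B K ↪ Fin d, (Measure.infinitePi fun _ : Fin n × ℕ => coins B K P)
        {ξ | Fast A s lam p z π ξ θ W u (u + 2 + ℓ)} ≤
      n * (ℓ + 1) * (q + ρ) ^ K * Fintype.card (Chain B K ↪ Fin d) := by
  set μ := Measure.infinitePi fun _ : Fin n × ℕ => coins B K P with hμ
  set E : ℕ → (Chain B K ↪ Fin d) → Set (Fin n × ℕ → Chain B K → Bool) := fun k π =>
    {ξ | ¬ Reached A s lam p z π ξ u (k * θ) ∧ Reached A s lam p z π ξ u ((k + 1) * θ)} with hE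
  set bs : Finset (Fin B) := Finset.univ.filter fun b => u + 1 ≤ (b : ℕ) ∧ (b : ℕ) ≤ u + 1 + ℓ
    with hbs
  have hbs_card : bs.card ≤ ℓ + 1 := by
    have : (bs.image Fin.val).card ≤ (Finset.Icc (u + 1) (u + 1 + ℓ)).card := by
      refine Finset.card_le_card fun b hb => ?_
      obtain ⟨b, hb', rfl⟩ := Finset.mem_image.1 hb
      exact Finset.mem_Icc.2 (Finset.mem_filter.1 hb').2
    rw [Finset.card_image_of_injective _ Fin.val_injective, Nat.card_Icc] at this
    omega
  have hmeas : ∀ k π, MeasurableSet (E k π) := fun k π => by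
    have h : ∀ t, MeasurableSet {ξ | Reached A s lam p z π ξ u t} := fun t =>
      measurableSet_reached A s lam p π measurable_const measurable_id u t
    exact (h _).compl.inter (h _)
  have hone : ∀ π, ∑ k ∈ Finset.range W, μ (E k π) ≤ 1 := by
    intro π
    rw [← measure_biUnion_finset _ fun k _ => hmeas k π]
    · exact prob_le_one
    · intro k _ k' _ hkk
      rw [Function.onFun, Set.disjoint_left]
      rintro ξ ⟨h1, h2⟩ ⟨h3, h4⟩
      rcases lt_or_gt_of_ne hkk with h | h
      · refine h3 (h2.mono le_rfl (mul_le_mul_of_nonneg_right ?_ hθ))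
        exact_mod_cast h
      · refine h1 (h4.mono le_rfl (mul_le_mul_of_nonneg_right ?_ hθ))
        exact_mod_cast h
  have hcover : ∀ π, μ {ξ | Fast A s lam p z π ξ θ W u (u + 2 + ℓ)} ≤
      ∑ k ∈ Finset.range W, ∑ i, ∑ b ∈ bs, μ (E k π ∩
        {ξ | ∀ r, Got A s lam p z π ξ (C i) (G i) (k * θ) (k * θ + 2 * θ) (b, r)}) := by
    intro π
    have hsub : {ξ | Fast A s lam p z π ξ θ W u (u + 2 + ℓ)} ⊆
        ⋃ k ∈ Finset.range W, ⋃ i ∈ (Finset.univ : Finset (Fin n)), ⋃ b ∈ bs, (E k π ∩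
        {ξ | ∀ r, Got A s lam p z π ξ (C i) (G i) (k * θ) (k * θ + 2 * θ) (b, r)}) := by
      rintro ξ ⟨k, hk, h1, h2, h3⟩
      by_contra hcon
      simp only [Set.mem_iUnion, not_exists] at hcon
      rw [add_mul] at h3
      refine not_reached_of_not_got (A := A) (C := C) hlev hG hC h1 (fun i b hb hb' => ?_) h3
      by_contra! hall
      exact hcon k (Finset.mem_range.2 hk) i (Finset.mem_univ _) b
        (Finset.mem_filter.2 ⟨Finset.mem_univ _, by omega, hb'⟩) ⟨⟨h1, h2⟩, hall⟩
    refine (measure_mono hsub).trans ((measure_biUnion_finset_le _ _).trans ?_)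
    refine Finset.sum_le_sum fun k _ => (measure_biUnion_finset_le _ _).trans ?_
    exact Finset.sum_le_sum fun i _ => measure_biUnion_finset_le _ _
  have hgot : ∀ k i, ∀ b ∈ bs, ∑ π, μ (E k π ∩
        {ξ | ∀ r, Got A s lam p z π ξ (C i) (G i) (k * θ) (k * θ + 2 * θ) (b, r)}) ≤
      (q + ρ) ^ K * ∑ π, μ (E k π) := by
    intro k i b hb
    have hub : u < b := (Finset.mem_filter.1 hb).2.1
    have hne : ∀ c : Chain B K, (c.1 : ℕ) ≤ u → c.1 ≠ b := fun c hc h => by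
      rw [h] at hc
      omega
    refine sum_measure_got_le A P (C i) (G i) b ?_ (hρ i _) (hmeas k) ?_ ?_
    · simpa using hq i
    · rintro π ξ ξ' h ⟨h1, h2⟩
      refine ⟨not_reached_congr (fun _ _ => rfl) (fun a e he => h a e (hne e he)) h1, ?_⟩
      by_contra h3
      exact not_reached_congr (fun _ _ => rfl) (fun a e he => (h a e (hne e he)).symm) h3 h2
    · have key : ∀ π π' : Chain B K ↪ Fin d, (∀ c : Chain B K, c.1 ≠ b → π c = π' c) →
          E k π ⊆ E k π' := by
        rintro π π' h ξ ⟨h1, h2⟩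
        refine ⟨not_reached_congr (fun e he => h e (hne e he)) (fun _ _ _ => rfl) h1, ?_⟩
        by_contra h3
        exact not_reached_congr (fun e he => (h e (hne e he)).symm) (fun _ _ _ => rfl) h3 h2
      exact fun π π' h => (key π π' h).antisymm (key π' π fun c hc => (h c hc).symm)
  calc ∑ π, μ {ξ | Fast A s lam p z π ξ θ W u (u + 2 + ℓ)}
      ≤ ∑ π, ∑ k ∈ Finset.range W, ∑ i, ∑ b ∈ bs, μ (E k π ∩
        {ξ | ∀ r, Got A s lam p z π ξ (C i) (G i) (k * θ) (k * θ + 2 * θ) (b, r)}) :=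
        Finset.sum_le_sum fun π _ => hcover π
    _ = ∑ k ∈ Finset.range W, ∑ i, ∑ b ∈ bs, ∑ π, μ (E k π ∩
        {ξ | ∀ r, Got A s lam p z π ξ (C i) (G i) (k * θ) (k * θ + 2 * θ) (b, r)}) := by
        rw [Finset.sum_comm]
        refine Finset.sum_congr rfl fun k _ => ?_
        rw [Finset.sum_comm]
        refine Finset.sum_congr rfl fun i _ => ?_
        rw [Finset.sum_comm]
    _ ≤ ∑ k ∈ Finset.range W, ∑ _i : Fin n, ∑ _b ∈ bs, (q + ρ) ^ K * ∑ π, μ (E k π) :=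
        Finset.sum_le_sum fun k _ => Finset.sum_le_sum fun i _ => Finset.sum_le_sum fun b hb =>
          hgot k i b hb
    _ = n * bs.card * (q + ρ) ^ K * ∑ π, ∑ k ∈ Finset.range W, μ (E k π) := by
        simp only [Finset.sum_const, Finset.card_univ, Fintype.card_fin, nsmul_eq_mul]
        rw [Finset.sum_comm, ← Finset.mul_sum, ← Finset.mul_sum, ← Finset.mul_sum]
        simp only [mul_assoc]
    _ ≤ n * (ℓ + 1) * (q + ρ) ^ K * ∑ _π : Chain B K ↪ Fin d, 1 := by
        gcongr with π
        · exact_mod_cast hbs_card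
        · exact hone π
    _ = _ := by simp

end FastProgress

/-! ### Stages and slots -/

section Slots

open scoped Classical

variable {n d B K : ℕ} {N : Network n} {Z : Type*} [MeasurableSpace Z] {A : Algorithm N d Z}
  {s lam p : ℝ} {z : Z} {π : Chain B K ↪ Fin d} {ξ : Fin n × ℕ → Chain B K → Bool} {θ : ℝ}

/-- If block `W * K` is reached within `W` slots, then more than half of the stages of `K` blocks
each are begun with fast progress, since the other stages take two slots each. -/
theorem lt_two_mul_card_fast {W ℓ : ℕ} (hK : ℓ + 2 ≤ K) (hθ : 0 ≤ θ)
    (h : Reached A s lam p z π ξ (W * K) (W * θ)) :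
    W < 2 * ((Finset.range W).filter fun j =>
      Fast A s lam p z π ξ θ W (j * K) (j * K + 2 + ℓ)).card := by
  have hex : ∀ j, ∃ k : ℕ, j ≤ W → Reached A s lam p z π ξ (j * K) (k * θ) := fun j =>
    ⟨W, fun hj => h.mono (Nat.mul_le_mul_right K hj) le_rfl⟩
  -- the number of slots until stage `j` begins
  set σ : ℕ → ℕ := fun j => Nat.find (hex j) with hσ
  have hσ_spec : ∀ j ≤ W, Reached A s lam p z π ξ (j * K) (σ j * θ) := fun j =>
    Nat.find_spec (hex j)
  have hσ_min : ∀ j k, k < σ j → ¬ Reached A s lam p z π ξ (j * K) (k * θ) := fun j k hk hr =>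
    Nat.find_min (hex j) hk fun _ => hr
  have hσ_le : ∀ j k : ℕ, (j ≤ W → Reached A s lam p z π ξ (j * K) (k * θ)) → σ j ≤ k := fun j k =>
    Nat.find_min' (hex j)
  have hσ_pos : ∀ j ≤ W, 0 < σ j := fun j hj => by
    by_contra! h0
    have := hσ_spec j hj
    rw [Nat.le_zero.1 h0, Nat.cast_zero, zero_mul] at this
    exact not_reached_zero _ this
  have hσ_W : ∀ j, σ j ≤ W := fun j => hσ_le j W fun hj =>
    h.mono (Nat.mul_le_mul_right K hj) le_rfl
  have key : ∀ j ≤ W, 1 + 2 * ((Finset.range j).filter fun j =>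
      ¬ Fast A s lam p z π ξ θ W (j * K) (j * K + 2 + ℓ)).card ≤ σ j := by
    intro j
    induction j with
    | zero => intro _; simpa [Nat.one_le_iff_ne_zero, Nat.pos_iff_ne_zero] using hσ_pos 0 (Nat.zero_le _)
    | succ j ih =>
      intro hj
      have ih := ih (by omega)
      have hmono : σ j ≤ σ (j + 1) := hσ_le j _ fun _ =>
        (hσ_spec (j + 1) hj).mono (Nat.mul_le_mul_right K (Nat.le_succ j)) le_rfl
      rw [Finset.range_add_one, Finset.filter_insert]
      by_cases hf : Fast A s lam p z π ξ θ W (j * K) (j * K + 2 + ℓ)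
      · rw [if_neg (not_not.2 hf)]
        omega
      · rw [if_pos hf, Finset.card_insert_of_notMem (by simp)]
        have hp := hσ_pos j (by omega)
        have hW := hσ_W j
        have : σ j + 1 < σ (j + 1) := by
          by_contra! hlt
          have hk : ((σ j - 1 : ℕ) : ℝ) + 1 = σ j := by exact_mod_cast Nat.sub_add_cancel hp
          refine hf ⟨σ j - 1, by omega, hσ_min j _ (by omega), ?_, ?_⟩
          · rw [hk]
            exact hσ_spec j (by omega)
          · have hk2 : ((σ j - 1 : ℕ) : ℝ) + 2 = (σ j + 1 : ℕ) := by push_cast; linarith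
            rw [hk2]
            refine (hσ_spec (j + 1) hj).mono ?_ (mul_le_mul_of_nonneg_right ?_ hθ)
            · rw [add_mul]
              omega
            · exact_mod_cast hlt
        omega
  have h1 := (key W le_rfl).trans (hσ_W W)
  have h2 := Finset.card_filter_add_card_filter_not (s := Finset.range W)
    (fun j => Fast A s lam p z π ξ θ W (j * K) (j * K + 2 + ℓ))
  rw [Finset.card_range] at h2
  omega

variable (A) {P : unitInterval}

theorem measurableSet_fast (W u v : ℕ) :
    MeasurableSet {ξ | Fast A s lam p z π ξ θ W u v} := by
  have h : ∀ u t, MeasurableSet {ξ | Reached A s lam p z π ξ u t} := fun u t =>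
    measurableSet_reached A s lam p π measurable_const measurable_id u t
  have : {ξ | Fast A s lam p z π ξ θ W u v} = ⋃ k ∈ Finset.range W,
      {ξ | ¬ Reached A s lam p z π ξ u (k * θ)} ∩ ({ξ | Reached A s lam p z π ξ u ((k + 1) * θ)} ∩
        {ξ | Reached A s lam p z π ξ v ((k + 2) * θ)}) := by
    ext ξ
    simp only [Fast, Set.mem_ofPred_eq, Set.mem_iUnion, Finset.mem_range, exists_prop]
    rfl
  rw [this]
  exact Finset.measurableSet_biUnion _ fun k _ => (h _ _).compl.inter ((h _ _).inter (h _ _))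

/-- By Markov's inequality for the number of stages with fast progress, the algorithm is unlikely to
reach block `W * K` within `W` slots. -/
theorem sum_measure_reached_le (z : Z) {ℓ W : ℕ} (hK : ℓ + 2 ≤ K) (hW : 0 < W) (hθ : 0 ≤ θ)
    {lev : Fin n → ℕ} {G : Fin n → Set (Fin n)} {C : Fin n → Finset (Fin n)}
    (hlev : ∀ i, lev i ≤ ℓ) (hG : ∀ i, i ∈ G i) (hC : ∀ i j, j ∈ G i → j ∈ C i ∨ lev j < lev i)
    {q ρ η : ENNReal}
    (hq : ∀ i, ENNReal.ofReal P * (∑ j ∈ C i, ⌊2 * θ / N.time j⌋₊ : ℕ) ≤ q)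
    (hρ : ∀ i, ∀ t, (((A.plan z).enteringCoords (G i) t (t + 2 * θ)).ncard : ENNReal) ≤
      ρ * (d - Fintype.card (Chain B K) : ℕ))
    (hη : n * (ℓ + 1) * (q + ρ) ^ K ≤ η) :
    ∑ π : Chain B K ↪ Fin d, (Measure.infinitePi fun _ : Fin n × ℕ => coins B K P)
        {ξ | Reached A s lam p z π ξ (W * K) (W * θ)} ≤
      2 * η * Fintype.card (Chain B K ↪ Fin d) := by
  set μ := Measure.infinitePi fun _ : Fin n × ℕ => coins B K P with hμ
  have hmarkov : ∀ π : Chain B K ↪ Fin d, W * μ {ξ | Reached A s lam p z π ξ (W * K) (W * θ)} ≤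
      2 * ∑ j ∈ Finset.range W, μ {ξ | Fast A s lam p z π ξ θ W (j * K) (j * K + 2 + ℓ)} := by
    intro π
    have hF := fun j => measurableSet_fast A (s := s) (lam := lam) (p := p) (z := z) (π := π)
      (θ := θ) W (j * K) (j * K + 2 + ℓ)
    have hR := measurableSet_reached A s lam p π (z := fun _ => z) measurable_const
      (ξ := id) measurable_id (W * K) (W * θ)
    simp only [id] at hR
    rw [← lintegral_indicator_one hR, ← lintegral_const_mul _ (measurable_one.indicator hR)]
    have : ∀ j ∈ Finset.range W, μ {ξ | Fast A s lam p z π ξ θ W (j * K) (j * K + 2 + ℓ)} =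
        ∫⁻ ξ, {ξ | Fast A s lam p z π ξ θ W (j * K) (j * K + 2 + ℓ)}.indicator 1 ξ ∂μ := fun j _ =>
      (lintegral_indicator_one (hF j)).symm
    rw [Finset.sum_congr rfl this, ← lintegral_finsetSum _ fun j _ =>
      measurable_one.indicator (hF j), ← lintegral_const_mul _ (Finset.measurable_sum _ fun j _ =>
        measurable_one.indicator (hF j))]
    refine lintegral_mono fun ξ => ?_
    by_cases h : Reached A s lam p z π ξ (W * K) (W * θ)
    · have h1 := lt_two_mul_card_fast hK hθ h
      simp only [Set.indicator_apply, Set.mem_ofPred_eq, h, if_true, Pi.one_apply, mul_one]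
      rw [Finset.sum_boole]
      exact_mod_cast h1.le
    · simp [Set.indicator_apply, h]
  have hsum : W * ∑ π : Chain B K ↪ Fin d, μ {ξ | Reached A s lam p z π ξ (W * K) (W * θ)} ≤
      W * (2 * η * Fintype.card (Chain B K ↪ Fin d)) := by
    calc W * ∑ π : Chain B K ↪ Fin d, μ {ξ | Reached A s lam p z π ξ (W * K) (W * θ)}
        ≤ ∑ π : Chain B K ↪ Fin d, 2 * ∑ j ∈ Finset.range W,
          μ {ξ | Fast A s lam p z π ξ θ W (j * K) (j * K + 2 + ℓ)} := by
          rw [Finset.mul_sum]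
          exact Finset.sum_le_sum fun π _ => hmarkov π
      _ = 2 * ∑ j ∈ Finset.range W, ∑ π : Chain B K ↪ Fin d,
          μ {ξ | Fast A s lam p z π ξ θ W (j * K) (j * K + 2 + ℓ)} := by
          rw [← Finset.mul_sum, Finset.sum_comm]
      _ ≤ 2 * ∑ _j ∈ Finset.range W, η * Fintype.card (Chain B K ↪ Fin d) := by
          gcongr with j
          exact (sum_measure_fast_le A z hθ hlev hG hC hq hρ).trans (mul_le_mul_left hη _)
      _ = W * (2 * η * Fintype.card (Chain B K ↪ Fin d)) := by
          rw [Finset.sum_const, Finset.card_range, nsmul_eq_mul]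
          ring
  exact (ENNReal.mul_le_mul_iff_right (by exact_mod_cast hW.ne') (ENNReal.natCast_ne_top W)).1 hsum

end Slots

/-! ### From the stages to the expected gradient norm -/

section Expectation

variable {n d B K : ℕ} {N : Network n} {Z : Type*} [MeasurableSpace Z] (A : Algorithm N d Z)

/-- The smallest value of `φ` on the reachable points is a measurable function of the randomness,
as it depends only on the finitely many supports. -/
theorem measurable_iInf_reachable {Ξ : Type*} [MeasurableSpace Ξ] {g : Vec d → Ξ → Vec d}
    (hg : Measurable (Function.uncurry g)) (t : ℝ) (φ : Vec d → ℝ) :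
    Measurable fun ω : Z × (Fin n × ℕ → Ξ) => ⨅ y : A.reachable g ω.1 ω.2 t, φ y := by
  set S : Z × (Fin n × ℕ → Ξ) → Fin n → Fin d → Prop := fun ω i c =>
    c ∈ (A.info g ω.1 ω.2 i t).support with hS
  have hSm : Measurable S := measurable_pi_lambda _ fun i => measurable_pi_lambda _ fun c =>
    measurableSet_setOfPred.1 (measurableSet_mem_info_support A hg measurable_fst measurable_snd i t c)
  exact (Measurable.of_discrete (f := fun σ : Fin n → Fin d → Prop =>
    ⨅ y : {y : Vec d | ∃ i, ∀ c, y c ≠ 0 → σ i c}, φ y)).comp hSm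

/-- Some placement of the chain is at least as good as the average one. -/
theorem exists_measure_reached_le {s lam p : ℝ} (P : unitInterval) (ℙ : Measure Z)
    [IsProbabilityMeasure ℙ] (hd : B * K ≤ d) (u : ℕ) (t : ℝ) {η : ENNReal}
    (h : ∀ z, ∑ π : Chain B K ↪ Fin d, (Measure.infinitePi fun _ : Fin n × ℕ => coins B K P)
      {ξ | Reached A s lam p z π ξ u t} ≤ η * Fintype.card (Chain B K ↪ Fin d)) :
    ∃ π : Chain B K ↪ Fin d, (ℙ.prod (Measure.infinitePi fun _ : Fin n × ℕ => coins B K P))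
      {ω | Reached A s lam p ω.1 π ω.2 u t} ≤ η := by
  set μ := Measure.infinitePi fun _ : Fin n × ℕ => coins B K P with hμ
  have hR := fun π => measurableSet_reached A s lam p π (measurable_fst (α := Z))
    (measurable_snd (β := Fin n × ℕ → Chain B K → Bool)) u t
  obtain ⟨π₀⟩ : Nonempty (Chain B K ↪ Fin d) :=
    Function.Embedding.nonempty_of_card_le (by simpa using hd)
  have hm : ∀ π, Measurable fun z => μ {ξ | Reached A s lam p z π ξ u t} := fun π =>
    measurable_measure_prodMk_left (hR π)
  have hsum : ∑ π : Chain B K ↪ Fin d, (ℙ.prod μ) {ω | Reached A s lam p ω.1 π ω.2 u t} ≤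
      ∑ _π : Chain B K ↪ Fin d, η := by
    calc ∑ π : Chain B K ↪ Fin d, (ℙ.prod μ) {ω | Reached A s lam p ω.1 π ω.2 u t}
        = ∑ π : Chain B K ↪ Fin d, ∫⁻ z, μ {ξ | Reached A s lam p z π ξ u t} ∂ℙ :=
          Finset.sum_congr rfl fun π _ => Measure.prod_apply (hR π)
      _ = ∫⁻ z, ∑ π : Chain B K ↪ Fin d, μ {ξ | Reached A s lam p z π ξ u t} ∂ℙ :=
          (lintegral_finsetSum _ fun π _ => hm π).symm
      _ ≤ ∫⁻ _z, η * Fintype.card (Chain B K ↪ Fin d) ∂ℙ := lintegral_mono h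
      _ = ∑ _π : Chain B K ↪ Fin d, η := by simp [mul_comm]
  by_contra! hcon
  exact (ENNReal.sum_lt_sum_of_nonempty ⟨π₀, Finset.mem_univ _⟩ fun π _ => hcon π).not_ge hsum

/-- If block `u` is unlikely to be reached, then all gradients at the reachable points are large in
expectation, since they are large as long as one coordinate of the chain vanishes. -/
theorem lt_integral_iInf (hn : 0 < n) (P : unitInterval) (ℙ : Measure Z) [IsProbabilityMeasure ℙ]
    {π : Chain B K ↪ Fin d} {s lam p t : ℝ} (hs : s ≠ 0) (hlam : lam ≠ 0) (c : Chain B K)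
    (h : (ℙ.prod (Measure.infinitePi fun _ : Fin n × ℕ => coins B K P))
      {ω | Reached A s lam p ω.1 π ω.2 c.1 t} ≤ ENNReal.ofReal (1 / 8)) :
    s ^ 2 < ∫ ω, (⨅ y : A.reachable (hardOracle π s lam p) ω.1 ω.2 t,
      ‖gradient (hardFun π s lam) y‖ ^ 2)
        ∂(ℙ.prod (Measure.infinitePi fun _ : Fin n × ℕ => coins B K P)) := by
  set μ := ℙ.prod (Measure.infinitePi fun _ : Fin n × ℕ => coins B K P) with hμ
  set F : Z × (Fin n × ℕ → Chain B K → Bool) → ℝ := fun ω =>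
    ⨅ y : A.reachable (hardOracle π s lam p) ω.1 ω.2 t, ‖gradient (hardFun π s lam) y‖ ^ 2 with hF
  have hbdd : ∀ ω : Z × (Fin n × ℕ → Chain B K → Bool), BddBelow (Set.range
      fun y : A.reachable (hardOracle π s lam p) ω.1 ω.2 t =>
        ‖gradient (hardFun π s lam) (y : Vec d)‖ ^ 2) := fun ω =>
    ⟨0, by rintro _ ⟨y, rfl⟩; positivity⟩
  have hzero : ∀ ω : Z × (Fin n × ℕ → Chain B K → Bool),
      (0 : Vec d) ∈ A.reachable (hardOracle π s lam p) ω.1 ω.2 t := fun ω =>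
    ⟨⟨0, hn⟩, fun c hc => absurd rfl hc⟩
  have hF0 : ∀ ω, 0 ≤ F ω := fun ω => Real.iInf_nonneg fun y => by positivity
  have hFle : ∀ ω, F ω ≤ ‖gradient (hardFun π s lam) 0‖ ^ 2 := fun ω =>
    ciInf_le (hbdd ω) ⟨0, hzero ω⟩
  have hFm : Measurable F := measurable_iInf_reachable A (measurable_hardOracle π s lam p) t
    fun y => ‖gradient (hardFun π s lam) y‖ ^ 2
  have hFi : Integrable F μ := by
    refine Integrable.of_bound hFm.aestronglyMeasurable (‖gradient (hardFun π s lam) 0‖ ^ 2)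
      (Filter.Eventually.of_forall fun ω => ?_)
    rw [Real.norm_of_nonneg (hF0 ω)]
    exact hFle ω
  set R := {ω : Z × (Fin n × ℕ → Chain B K → Bool) | Reached A s lam p ω.1 π ω.2 c.1 t} with hR
  have hRm : MeasurableSet R := measurableSet_reached A s lam p π measurable_fst measurable_snd _ t
  have hlow : ∀ ω, Rᶜ.indicator (fun _ => 4 * s ^ 2) ω ≤ F ω := by
    intro ω
    by_cases hω : ω ∈ R
    · rw [Set.indicator_of_notMem (not_not.2 hω)]
      exact hF0 ω
    · rw [Set.indicator_of_mem hω]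
      have : Nonempty (A.reachable (hardOracle π s lam p) ω.1 ω.2 t) := ⟨0, hzero ω⟩
      refine le_ciInf fun ⟨y, i, hy⟩ => ?_
      dsimp only
      rw [gradient_hardFun π s hlam]
      refine le_norm_hardGrad_sq π s lam (c := c) ?_
      by_contra hc
      exact hω ⟨i, c, le_rfl, hy _ hc⟩
  have hR8 : μ.real R ≤ 1 / 8 := ENNReal.toReal_le_of_le_ofReal (by norm_num) h
  have hRc : μ.real Rᶜ = 1 - μ.real R := by
    rw [probReal_compl_eq_one_sub hRm]
  have hs2 : 0 < s ^ 2 := by positivity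
  calc s ^ 2 < (1 - μ.real R) * (4 * s ^ 2) := by nlinarith
    _ = ∫ ω, Rᶜ.indicator (fun _ => 4 * s ^ 2) ω ∂μ := by
        rw [integral_indicator hRm.compl, setIntegral_const, hRc, smul_eq_mul]
    _ ≤ ∫ ω, F ω ∂μ := integral_mono ((integrable_const _).indicator hRm.compl) hFi hlow

end Expectation

/-! ### The choice of the parameters -/

theorem one_half_le_log (n : ℕ) (hn : 0 < n) : 1 / 2 ≤ Real.log (n + 1) := by
  have h1 : (1 : ℝ) ≤ n := by exact_mod_cast hn
  have h2 := Real.log_le_log (by norm_num) (show (2 : ℝ) ≤ n + 1 by linarith)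
  have := Real.log_two_gt_d9
  linarith

theorem natLog_add_three_le (n : ℕ) (hn : 0 < n) :
    ((Nat.log 2 n + 3 : ℕ) : ℝ) ≤ 6 * Real.log (n + 1) := by
  have h1 : (1 : ℝ) ≤ n := by exact_mod_cast hn
  have h2 := Real.log_le_log (by norm_num) (show (2 : ℝ) ≤ n + 1 by linarith)
  have h3 : ((2 : ℝ) ^ Nat.log 2 n) ≤ n := by exact_mod_cast Nat.pow_log_le_self 2 hn.ne'
  have h4 := Real.log_le_log (by positivity) (h3.trans (show (n : ℝ) ≤ n + 1 by linarith))
  rw [Real.log_pow] at h4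
  have h5 := Real.log_two_gt_d9
  push_cast
  nlinarith [mul_nonneg (Nat.cast_nonneg (α := ℝ) (Nat.log 2 n)) (sub_nonneg.2 h5.le)]

theorem log_le_natLog_add_three (n : ℕ) : Real.log (n + 1) ≤ ((Nat.log 2 n + 3 : ℕ) : ℝ) := by
  have h1 : ((n : ℝ) + 1) ≤ 2 ^ (Nat.log 2 n + 1) := by
    exact_mod_cast Nat.lt_pow_succ_log_self one_lt_two n
  have h2 := Real.log_le_log (by positivity) h1
  rw [Real.log_pow] at h2
  have h5 := Real.log_two_lt_d9
  have h6 := mul_le_mul_of_nonneg_left h5.le (Nat.cast_nonneg (α := ℝ) (Nat.log 2 n + 1))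
  push_cast at *
  nlinarith [Nat.cast_nonneg (α := ℝ) (Nat.log 2 n)]

/-- The union bound over the workers and the blocks. -/
theorem union_bound (n : ℕ) {q ρ : ENNReal} (hq : q ≤ ENNReal.ofReal (1 / 8))
    (hρ : ρ ≤ ENNReal.ofReal (1 / 8)) :
    n * ((Nat.log 2 n : ℕ) + 1) * (q + ρ) ^ (Nat.log 2 n + 3) ≤ ENNReal.ofReal (1 / 16) := by
  set l := Nat.log 2 n with hl
  have h1 : (q + ρ) ≤ ENNReal.ofReal (1 / 4) := by
    refine (add_le_add hq hρ).trans (le_of_eq ?_)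
    rw [← ENNReal.ofReal_add (by norm_num) (by norm_num)]
    norm_num
  have h2 : (n : ℝ) ≤ 2 ^ (l + 1) := by exact_mod_cast (Nat.lt_pow_succ_log_self one_lt_two n).le
  have h3 : (l : ℝ) + 1 ≤ 2 ^ l := by exact_mod_cast Nat.lt_two_pow_self
  calc (n : ENNReal) * (l + 1) * (q + ρ) ^ (l + 3)
      ≤ n * (l + 1) * ENNReal.ofReal (1 / 4) ^ (l + 3) := by gcongr
    _ = ENNReal.ofReal (n * (l + 1) * (1 / 4) ^ (l + 3)) := by
        rw [ENNReal.ofReal_mul (by positivity), ENNReal.ofReal_mul (by positivity),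
          ENNReal.ofReal_natCast, ENNReal.ofReal_pow (by norm_num),
          ENNReal.ofReal_add (by positivity) (by norm_num), ENNReal.ofReal_natCast,
          ENNReal.ofReal_one]
    _ ≤ ENNReal.ofReal (1 / 16) := by
        refine ENNReal.ofReal_le_ofReal ?_
        calc (n : ℝ) * (l + 1) * (1 / 4) ^ (l + 3) ≤ 2 ^ (l + 1) * 2 ^ l * (1 / 4) ^ (l + 3) := by
              gcongr
          _ = (2 * 2 * (1 / 4)) ^ l * (1 / 32) := by
              rw [mul_pow, mul_pow, pow_add, pow_add]
              norm_num
              ring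
          _ ≤ 1 / 16 := by norm_num

/-- The lower bound for a chain of `W` stages, in terms of `K` and `W`. The scales `s` and `lam` of the
function are dictated by the gradient norm and the smoothness, and the bias of the coins by the
variance. -/
theorem exists_hard_instance {n d : ℕ} {L Δ ε σsq : ℝ} (hn : 0 < n) (hL : 0 < L)
    (hε : 0 < ε) (hσ : 0 < σsq) {N : Network n} (T : SortedGomoryHuTree N) {Z : Type*}
    [MeasurableSpace Z] (ℙ : Measure Z) [IsProbabilityMeasure ℙ] (A : Algorithm N d Z) {K W : ℕ}
    (hK : K = Nat.log 2 n + 3) (hW : 0 < W) (hX : 12288 * (K : ℝ) ^ 5 * W ≤ L * Δ / ε)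
    (hd : 4 * (W : ℝ) * K ^ 2 ≤ d) :
    ∃ f : Vec d → ℝ, SmoothClass L Δ f ∧
      ∃ (Ξ : Type) (_ : MeasurableSpace Ξ) (D : Measure Ξ) (_ : IsProbabilityMeasure D)
        (g : Vec d → Ξ → Vec d), IsOracle D g f σsq ∧
      ∀ t : ℝ, t ≤ W * (T.graceTime d (σsq / ε) / (1024 * K)) →
        ε < ∫ ω, (⨅ y : A.reachable g ω.1 ω.2 t, ‖gradient f y‖ ^ 2)
          ∂(ℙ.prod (Measure.infinitePi fun _ : Fin n × ℕ => D)) := by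
  have hK1 : (1 : ℝ) ≤ K := by exact_mod_cast (by omega : 1 ≤ K)
  have hW1 : (1 : ℝ) ≤ W := by exact_mod_cast hW
  have hK0 : (0 : ℝ) < K := by linarith
  -- there is one block beyond the `W` stages, which is still to be reached at time `W * θ`
  set B := W * K + 1 with hB
  have hBK : (B : ℝ) * K ≤ 2 * W * K ^ 2 := by
    rw [hB]
    push_cast
    nlinarith [mul_nonneg (sub_nonneg.2 hW1) hK0.le, mul_nonneg (sub_nonneg.2 hK1) hK0.le,
      mul_nonneg (sub_nonneg.2 hW1) (sq_nonneg (K : ℝ))]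
  have hd0 : (0 : ℝ) < d := lt_of_lt_of_le (by positivity) hd
  have hr : 0 < σsq / ε := by positivity
  obtain ⟨hg, lev, G, C, hlev, hG, hcut, hC, hbatch⟩ := exists_groups T hn hd0 hr
  set γ := T.graceTime d (σsq / ε) with hγ
  set θ := γ / (1024 * K) with hθ
  have hθ0 : 0 < θ := by positivity
  -- the scales of the function
  set s := Real.sqrt ε with hs
  have hs0 : 0 < s := Real.sqrt_pos.2 hε
  have hs2 : s ^ 2 = ε := Real.sq_sqrt hε.le
  set lam := s * (768 * K ^ 2) / L with hlam
  have hlam0 : 0 < lam := by positivity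
  -- the probability of the coins
  have hP : min 1 (16 * K * ε / σsq) ∈ Set.Icc (0 : ℝ) 1 :=
    ⟨le_min zero_le_one (by positivity), min_le_left _ _⟩
  set P : unitInterval := ⟨min 1 (16 * K * ε / σsq), hP⟩ with hPdef
  have hP0 : 0 < (P : ℝ) := lt_min one_pos (by positivity)
  have hPle : (P : ℝ) ≤ 16 * K * ε / σsq := min_le_right _ _
  have horacle : 16 * K * s ^ 2 * ((1 - P) / P) ≤ σsq := by
    rw [hs2, ← mul_div_assoc, div_le_iff₀ hP0]
    rcases min_choice 1 (16 * K * ε / σsq) with h | h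
    · have : (P : ℝ) = 1 := h
      rw [this]
      linarith
    · have h1 : (P : ℝ) = 16 * K * ε / σsq := h
      have h2 : σsq * P = 16 * K * ε := by rw [h1]; field_simp
      rw [h2]
      have : 0 < 16 * K * ε := by positivity
      nlinarith
  have hq : ∀ i, ENNReal.ofReal P * (∑ j ∈ C i, ⌊2 * θ / N.time j⌋₊ : ℕ) ≤
      ENNReal.ofReal (1 / 8) := by
    intro i
    obtain ⟨S, hCS, hS⟩ := hbatch i
    have h1 := sum_floor_le N.time_pos hr hθ0 (c := 1 / (512 * K)) (S := S) ?_ (by positivity) ?_ hCS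
    · rw [← ENNReal.ofReal_natCast, ← ENNReal.ofReal_mul P.2.1]
      refine ENNReal.ofReal_le_ofReal ?_
      push_cast
      calc (P : ℝ) * ∑ j ∈ C i, (⌊2 * θ / N.time j⌋₊ : ℝ)
          ≤ 16 * K * ε / σsq * (4 * (1 / (512 * K)) * (σsq / ε)) := by gcongr
        _ = 1 / 8 := by field_simp; norm_num
    · rw [div_le_div_iff₀ (by positivity) (by norm_num)]
      linarith
    · rw [hθ, div_le_iff₀ (by positivity)]
      calc γ ≤ 2 * batchTime N.time (σsq / ε) S := hS
        _ = _ := by field_simp; ring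
  have hcard : Fintype.card (Chain B K) = B * K := by simp [Chain]
  have hBKd : B * K ≤ d := by
    have : ((B * K : ℕ) : ℝ) ≤ d := by push_cast; linarith
    exact_mod_cast this
  have hρ : ∀ z i t, (((A.plan z).enteringCoords (G i) t (t + 2 * θ)).ncard : ENNReal) ≤
      ENNReal.ofReal (1 / 8) * (d - Fintype.card (Chain B K) : ℕ) := by
    intro z i t
    rw [hcard, ← ENNReal.ofReal_natCast, ← ENNReal.ofReal_natCast (d - B * K),
      ← ENNReal.ofReal_mul (by norm_num)]
    refine ENNReal.ofReal_le_ofReal ?_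
    rw [Nat.cast_sub hBKd]
    push_cast
    have h1 := CommPlan.ncard_enteringCoords_le (A.plan z) (G i) (t₀ := t) (t₁ := t + 2 * θ) (by linarith)
    have h2 : cutValue N (G i) * (t + 2 * θ - t) = cutValue N (G i) * γ / (512 * K) := by
      rw [hθ, add_sub_cancel_left]; field_simp; ring
    rw [h2] at h1
    have h3 : cutValue N (G i) * γ / (512 * K) ≤ 4 * d / 512 := by
      rw [div_le_div_iff₀ (by positivity) (by norm_num)]
      nlinarith [hcut i]
    linarith
  obtain ⟨π, hπ⟩ := exists_measure_reached_le A (s := s) (lam := lam) (p := P) P ℙ hBKd (W * K)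
    (W * θ) fun z => sum_measure_reached_le (K := K) A z (ℓ := Nat.log 2 n)
      (η := ENNReal.ofReal (1 / 16)) (by omega) hW hθ0.le
      hlev hG hC hq (hρ z) (by rw [hK]; exact union_bound n le_rfl le_rfl)
  refine ⟨hardFun π s lam, smoothClass_hardFun π hs0 hlam0 ?_ ?_, Chain B K → Bool, inferInstance,
    coins B K P, inferInstance, hardOracle π s lam P,
    isOracle_hardOracle π hlam0.ne' P hP0 horacle, fun t ht => ?_⟩
  · rw [hlam]
    refine le_of_eq ?_
    field_simp
  · have h1 : s * lam * (8 * (B * K)) = 6144 * K ^ 2 * (B * K) * ε / L := by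
      rw [hlam, ← hs2]
      field_simp
      ring
    rw [h1, div_le_iff₀ hL]
    have h2 := mul_le_mul_of_nonneg_right hX hε.le
    rw [div_mul_cancel₀ _ hε.ne'] at h2
    calc 6144 * (K : ℝ) ^ 2 * (B * K) * ε ≤ 6144 * (K : ℝ) ^ 2 * (2 * W * K ^ 2) * ε := by gcongr
      _ = 12288 * (K : ℝ) ^ 4 * W * ε := by ring
      _ ≤ 12288 * (K : ℝ) ^ 5 * W * ε := by
        gcongr ?_ * (W : ℝ) * ε
        exact mul_le_mul_of_nonneg_left (pow_le_pow_right₀ hK1 (by norm_num)) (by norm_num)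
      _ ≤ Δ * L := by linarith
  · rw [← hs2]
    refine lt_integral_iInf A hn P ℙ hs0.ne' hlam0.ne' (⟨W * K, by omega⟩, ⟨0, by omega⟩) ?_
    refine (measure_mono fun ω hω => ?_).trans (hπ.trans (le_of_eq ?_))
    · exact Reached.mono hω le_rfl ht
    · rw [show (2 : ENNReal) = ENNReal.ofReal 2 by simp, ← ENNReal.ofReal_mul (by norm_num)]
      norm_num

end Decentralized

end

theorem theorem2 :
    ∃ c₁ > (0 : ℝ), ∃ c₂ > (0 : ℝ), ∃ c₃ > (0 : ℝ),
      ∀ (n d : ℕ) (L Δ ε σsq : ℝ), 0 < n → 0 < d → 0 < L → 0 < Δ → 0 < ε → 0 < σsq →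
      c₁ * Real.log (n + 1) ^ 10 ≤ L * Δ / ε →
      c₃ * (L * Δ) / (Real.log (n + 1) ^ 3 * ε) ≤ d →
      ∀ (N : Network n) (T : SortedGomoryHuTree N)
        (Z : Type*) [MeasurableSpace Z] (ℙ : Measure Z) [IsProbabilityMeasure ℙ]
        (A : Algorithm N d Z),
      ∃ f : Vec d → ℝ, SmoothClass L Δ f ∧
      ∃ (Ξ : Type) (_ : MeasurableSpace Ξ) (D : Measure Ξ) (_ : IsProbabilityMeasure D)
        (g : Vec d → Ξ → Vec d), IsOracle D g f σsq ∧
      ∀ t : ℝ,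
        t ≤ c₂ / Real.log (n + 1) ^ 14 * T.graceTime d (σsq / ε) * (L * Δ / ε) →
        ε < ∫ ω, (⨅ y : A.reachable g ω.1 ω.2 t, ‖gradient f y‖ ^ 2)
          ∂(ℙ.prod (Measure.infinitePi fun _ : Fin n × ℕ => D)) := by
  refine ⟨12288 * 6 ^ 5 * 2 ^ 5, by norm_num, 1 / (2 ^ 8 * 6 ^ 6 * 24576 * 1024), by norm_num, 1,
    one_pos, ?_⟩
  intro n d L Δ ε σsq hn hd hL hΔ hε hσ hX hdim N T Z _ ℙ _ A
  set ℒ := Real.log (n + 1) with hℒ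
  set K := Nat.log 2 n + 3 with hK
  set X := L * Δ / ε with hXdef
  have hℒ2 : 1 / 2 ≤ ℒ := one_half_le_log n hn
  have hKle : (K : ℝ) ≤ 6 * ℒ := natLog_add_three_le n hn
  have hℒK : ℒ ≤ K := log_le_natLog_add_three n
  have hℒ0 : 0 < ℒ := by linarith
  have hK0 : (0 : ℝ) < K := by linarith
  have hX0 : 0 < X := by positivity
  -- `log (n + 1)` may be less than `1`, so that raising its exponent costs powers of two
  have hpow : ∀ j : ℕ, (1 : ℝ) ≤ 2 ^ j * ℒ ^ j := fun j => by
    rw [← mul_pow]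
    exact one_le_pow₀ (by linarith)
  set W := ⌊X / (12288 * (K : ℝ) ^ 5)⌋₊ with hWdef
  have hone : 1 ≤ X / (12288 * (K : ℝ) ^ 5) := by
    rw [one_le_div (by positivity)]
    calc 12288 * (K : ℝ) ^ 5 ≤ 12288 * (6 * ℒ) ^ 5 := by gcongr
      _ ≤ 12288 * (6 * ℒ) ^ 5 * (2 ^ 5 * ℒ ^ 5) := le_mul_of_one_le_right (by positivity) (hpow 5)
      _ = 12288 * 6 ^ 5 * 2 ^ 5 * ℒ ^ 10 := by ring
      _ ≤ X := hX
  have hW : 0 < W := Nat.floor_pos.2 hone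
  have hWle : (W : ℝ) ≤ X / (12288 * (K : ℝ) ^ 5) := Nat.floor_le (by positivity)
  have hWge : X / (24576 * (K : ℝ) ^ 5) ≤ W := by
    have h1 := Nat.lt_floor_add_one (X / (12288 * (K : ℝ) ^ 5))
    have h2 : (1 : ℝ) ≤ W := by exact_mod_cast hW
    have h3 : X / (24576 * (K : ℝ) ^ 5) = X / (12288 * (K : ℝ) ^ 5) / 2 := by
      field_simp; norm_num
    rw [h3]
    linarith
  have hg := (exists_groups T hn (Nat.cast_pos.2 hd : (0 : ℝ) < d) (r := σsq / ε) (by positivity)).1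
  obtain ⟨f, hf, Ξ, m, D, hD, g, hgo, ht⟩ := exists_hard_instance hn hL hε hσ T ℙ A hK hW
    (by rwa [le_div_iff₀ (by positivity), mul_comm] at hWle) (by
      refine le_trans ?_ hdim
      have h1 : 1 * (L * Δ) / (ℒ ^ 3 * ε) = X / ℒ ^ 3 := by rw [hXdef]; field_simp
      rw [h1]
      calc 4 * (W : ℝ) * K ^ 2 ≤ 4 * (X / (12288 * (K : ℝ) ^ 5)) * K ^ 2 := by gcongr
        _ = X / (3072 * (K : ℝ) ^ 3) := by field_simp; norm_num
        _ ≤ X / ℒ ^ 3 := by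
          gcongr
          nlinarith [pow_le_pow_left₀ hℒ0.le hℒK 3, pow_pos hK0 3])
  refine ⟨f, hf, Ξ, m, D, hD, g, hgo, fun t htle => ht t (htle.trans ?_)⟩
  set γ := T.graceTime d (σsq / ε) with hγ
  calc 1 / (2 ^ 8 * 6 ^ 6 * 24576 * 1024) / ℒ ^ 14 * γ * X
      ≤ 1 / (2 ^ 8 * 6 ^ 6 * 24576 * 1024) / ℒ ^ 14 * γ * X * (2 ^ 8 * ℒ ^ 8) :=
        le_mul_of_one_le_right (by positivity) (hpow 8)
    _ = X / (24576 * (6 * ℒ) ^ 5) * (γ / (1024 * (6 * ℒ))) := by field_simp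
    _ ≤ X / (24576 * (K : ℝ) ^ 5) * (γ / (1024 * K)) := by gcongr
    _ ≤ W * (γ / (1024 * K)) := by gcongr
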